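/- **Model.** A (Markovian) binary linear model on binary variables $X_1,\dots,X_n,Y$ ($n\ge1$) consists of a directed acyclic graph on these variables in which $Y$ has no outgoing edge and $X_1$, which always equals $1$, has no parent and is a parent of every other variable; of weights $\theta^*_{X',X}\in[0,1]$ for the edges $X'\to X$; and of independent zero-mean noises $\varepsilon_X$, drawn afresh in every round, such that $P(X=1\mid \mathrm{Pa}(X),\varepsilon_X)=\sum_{X'\in \mathrm{Pa}(X)}\theta^*_{X',X}X'+\varepsilon_X$ lies in $[0,1]$ for all values of the parents with $X_1=1$. The action set $\mathcal A$ is a set of interventions $do(S=s)$ with $S\subseteq\{X_2,\dots,X_n\}$, $s\in\{0,1\}^S$, which contains $do()$ and all $do(X_i=x)$, $2\le i\le n$, $x\in\{0,1\}$. In each of $T$ rounds a policy chooses an intervention and observes all variables; its regret is $R(T)=\mathbb E\big[\sum_{t=1}^T(\max_{a\in\mathcal A}\mathbb E[Y\mid a]-\mathbb E[Y\mid a_t])\big]$. **Algorithm (BLM-LR-Unknown).** It knows $n,T,\mathcal A$ and constants $c_0,c_1>0$, $c_1\neq1$, but neither the graph nor the weights. Let $N=\lceil c_0T^{2/3}\log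 T\rceil$ and $T_0=2(n-1)N$. 1. In rounds $1,\dots,T_0$ it plays $do(X_2=1),do(X_2=0),\dots,do(X_n=1),do(X_n=0)$, each $N$ times in a row (and stops at round $T$ if $T<T_0$). For distinct $i,j\in\{2,\dots,n\}$, $X_i$ is detected as an ancestor of $X_j$ if the sum of the $N$ values of $X_j$ under $do(X_i=1)$ minus the sum of the $N$ values of $X_j$ under $do(X_i=0)$ exceeds $c_0c_1T^{1/3}\log(T^2)$. For $j\ge2$, $\widehat{\mathrm{Anc}}(X_j)$ consists of $X_1$ and of the ancestors of $X_j$ in the transitive closure of the detected relation; $\widehat{\mathrm{Anc}}(X_1)=\emptyset$ and $\widehat{\mathrm{Anc}}(Y)=\{X_1,\dots,X_n\}$. 2. Put $\delta=1/(n\sqrt T)$ and $\rho_t=\sqrt{n\log(1+tn)+2\log(1/\delta)}+\sqrt n$. For every node $X$ and $t\ge T_0$ let $M_{t,X}=I+\sum_s V_{s,X}V_{s,X}^{\top}$, $b_{t,X}=\sum_s X^{(s)}V_{s,X}$ and $\hat\theta_{t,X}=M_{t,X}^{-1}b_{t,X}$, where the sums range over the rounds $T_0<s\le t$ in which $X$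 was not intervened and $V_{s,X}\in\{0,1\}^{\widehat{\mathrm{Anc}}(X)}$ is the vector of the values of $\widehat{\mathrm{Anc}}(X)$ in round $s$. 3. In each round $t$ with $T_0<t\le T$ let $\mathcal C_{t,X}=\{\theta\in[0,1]^{\widehat{\mathrm{Anc}}(X)}:\|\theta-\hat\theta_{t-1,X}\|_{M_{t-1,X}}\le\rho_{t-1}\}$; if this set is empty, let $\mathcal C_{t,X}$ consist of the points of $[0,1]^{\widehat{\mathrm{Anc}}(X)}$ nearest to $\hat\theta_{t-1,X}$ in the norm $\|\cdot\|_{M_{t-1,X}}$. The algorithm plays the intervention of a pair maximizing $\mathbb E_{\theta}[Y\mid do(S=s)]$ over $do(S=s)\in\mathcal A$ and $\theta=(\theta_X)_X$ with $\theta_X\in\mathcal C_{t,X}$ for all $X$, with ties broken arbitrarily; the expectation is taken in the model on the graph with parent sets $\widehat{\mathrm{Anc}}(X)$, in which $X_1=1$ and every other $X$ equals $1$ with conditional probability $\min\{1,\sum_{X'}\theta_{X',X}X'\}$. (If this graph has a cycle, any intervention in $\mathcal A$ may be played.) **Theorem.** Suppose $c_0\ge\max\{1/c_1^2,1/(1-c_1)^2\}$.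 Then the regret of BLM-LR-Unknown on binary linear models, with no knowledge of the graph skeleton and no weight gap assumption, is $O(n^3T^{2/3}\log T)$: there is a constant $C>0$, depending only on $c_0$ and $c_1$, such that for all $n\ge1$ and $T\ge2$, all binary linear models, all action sets and all executions (tie-breaking rules) of the algorithm, $R(T)\le C\,n^3\,T^{2/3}\log T$. -/

import Mathlib

open scoped Matrix
open MeasureTheory

noncomputable section

namespace CCB

/-! ### Nodes, outcomes, interventions -/

/-- The nodes of a causal graph with variables `X_1, …, X_n` and a target `Y`:
`X_i` is the node with value `i - 1`, and `Y` is the last node. -/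
abbrev Node (n : ℕ) : Type := Fin (n + 1)

/-- The special variable `X_1`, which always takes the value `1`. -/
abbrev root (n : ℕ) : Node n := 0

/-- The target (reward) variable `Y`. -/
abbrev target (n : ℕ) : Node n := Fin.last n

/-- Joint values of all variables in one round. -/
abbrev Outcome (n : ℕ) : Type := Node n → Bool

/-- An intervention `do(S = s)`: `a v = some b` means `v ∈ S` and `v` is set to `b`;
`a v = none` means `v ∉ S`. -/
abbrev Action (n : ℕ) : Type := Node n → Option Bool

/-- The number `0` or `1` represented by a Boolean value. -/
def val (b : Bool) : ℝ := if b then 1 else 0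

/-- The null intervention `do()`. -/
def nullAction (n : ℕ) : Action n := fun _ => none

/-- The atomic intervention `do(v = b)`. -/
def atomic {n : ℕ} (v : Node n) (b : Bool) : Action n := Function.update (nullAction n) v (some b)

/-- Admissible action sets: only nodes other than `X_1` and `Y` are intervened, and the null
intervention and all atomic interventions are available. -/
structure IsActionSet {n : ℕ} (𝒜 : Finset (Action n)) : Prop where
  not_root : ∀ a ∈ 𝒜, a (root n) = none
  not_target : ∀ a ∈ 𝒜, a (target n) = none
  null_mem : nullAction n ∈ 𝒜
  atomic_mem : ∀ v : Node n, v ≠ root n → v ≠ target n → ∀ b : Bool, atomic v b ∈ 𝒜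

/-- Given the conditional probabilities `q v x` that node `v` equals `1` when the other nodes
take the values in `x` (only the parents of `v` matter), the probability of the outcome `x` under
the intervention `a`: the truncated factorization of a causal Bayesian network. -/
def doProb {n : ℕ} (q : Node n → Outcome n → ℝ) (a : Action n) (x : Outcome n) : ℝ :=
  ∏ v : Node n,
    match a v with
    | some b => if x v = b then 1 else 0
    | none => if x v then q v x else 1 - q v x

/-- `𝔼[Y | do(S = s)]` for a causal model with conditional probabilities `q`. -/
def expReward {n : ℕ} (q : Node n → Outcome n → ℝ) (a : Action n) : ℝ :=
  ∑ x : Outcome n, doProb q a x * val (x (target n))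

/-- A directed graph, given by its parent sets, has no directed cycle. -/
def Acyclic {n : ℕ} (pa : Node n → Finset (Node n)) : Prop :=
  ∀ v, ¬ Relation.TransGen (fun u w => u ∈ pa w) v v

/-! ### Binary linear models -/

/-- A Markovian binary linear model: a DAG in which `X_1` (constantly `1`) is a parent of every
other node and `Y` has no outgoing edge, edge weights `θ u v ∈ [0,1]` for `u ∈ Pa(v)`, and
independent zero-mean noises `ε_v` with laws `noise v`, such that
`P(v = 1 | Pa(v) = pa, ε_v) = θ_v · pa + ε_v` is a probability for every parent value in which
`X_1 = 1`. (In particular the noises are bounded, hence sub-Gaussian.) -/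
structure BLM (n : ℕ) where
  pa : Node n → Finset (Node n)
  acyclic : Acyclic pa
  pa_root : pa (root n) = ∅
  root_mem : ∀ v, v ≠ root n → root n ∈ pa v
  target_notMem : ∀ v, target n ∉ pa v
  θ : Node n → Node n → ℝ
  θ_mem : ∀ v, ∀ u ∈ pa v, θ u v ∈ Set.Icc (0 : ℝ) 1
  noise : Node n → Measure ℝ
  noise_prob : ∀ v, IsProbabilityMeasure (noise v)
  noise_mean : ∀ v, v ≠ root n → ∫ e, e ∂(noise v) = 0
  noise_bound : ∀ v, v ≠ root n → ∀ᵐ e ∂(noise v), ∀ x : Outcome n, x (root n) = true →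
    (∑ u ∈ pa v, θ u v * val (x u)) + e ∈ Set.Icc (0 : ℝ) 1

/-- The probability that `v = 1` given the values of its parents, the noise being averaged out;
`X_1` is always `1`. As the noises of different nodes are independent, `doProb M.condProb a` is
the law of a round played with the intervention `a`. -/
def BLM.condProb {n : ℕ} (M : BLM n) (v : Node n) (x : Outcome n) : ℝ :=
  if v = root n then 1 else ∫ e, ((∑ u ∈ M.pa v, M.θ u v * val (x u)) + e) ∂(M.noise v)

/-! ### Interaction and regret -/

/-- A policy chooses the intervention of the round with (zero-based) index `t` from the outcomes of
the `t` earlier rounds. (The earlier interventions are determined by these outcomes.) -/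
abbrev Policy (n : ℕ) : Type := (t : ℕ) → (Fin t → Outcome n) → Action n

/-- The outcomes of the rounds before round `s`. -/
def past {n t : ℕ} (h : Fin t → Outcome n) (s : Fin t) : Fin s.val → Outcome n :=
  fun u => h ⟨u.val, u.isLt.trans s.isLt⟩

/-- The probability of a sequence of `T` outcomes when `π` is run on the model `M`. -/
def trajProb {n : ℕ} (M : BLM n) (π : Policy n) {T : ℕ} (ω : Fin T → Outcome n) : ℝ :=
  ∏ t : Fin T, doProb M.condProb (π t (past ω t)) (ω t)

/-- The largest expected reward of an available intervention. -/
def bestReward {n : ℕ} (M : BLM n) (𝒜 : Finset (Action n)) : ℝ :=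
  sSup (expReward M.condProb '' (𝒜 : Set (Action n)))

/-- The expected cumulative regret of `π` over `T` rounds. -/
def regret {n : ℕ} (M : BLM n) (𝒜 : Finset (Action n)) (π : Policy n) (T : ℕ) : ℝ :=
  ∑ ω : Fin T → Outcome n, trajProb M π ω *
    ∑ t : Fin T, (bestReward M 𝒜 - expReward M.condProb (π t (past ω t)))

/-! ### The initialization phase -/

/-- The number of times each of the `2 (n - 1)` atomic interventions is played initially. -/
def initCount (c₀ : ℝ) (T : ℕ) : ℕ := ⌈c₀ * (T : ℝ) ^ (2 / 3 : ℝ) * Real.log T⌉₊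

/-- The length `T₀` of the initialization phase. -/
def initLength (n : ℕ) (c₀ : ℝ) (T : ℕ) : ℕ := 2 * (n - 1) * initCount c₀ T

/-- The intervention of round `t` (zero-based) of the initialization phase: `do(X_2 = 1)`,
`do(X_2 = 0)`, …, `do(X_n = 1)`, `do(X_n = 0)`, each of them `N` times in a row. -/
def initAction (n N t : ℕ) : Action n :=
  fun v => if v.val = t / N / 2 + 1 then some (decide (t / N % 2 = 0)) else none

/-- The observed value of `v` in round `s` of the history `h` (`0` if that round is not in `h`). -/
def obs {n t : ℕ} (h : Fin t → Outcome n) (s : ℕ) (v : Node n) : ℝ :=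
  if hs : s < t then val (h ⟨s, hs⟩ v) else 0

/-- The sum of the differences of the values of `j` in the initial rounds with `do(i = 1)` and in
those with `do(i = 0)`. -/
def effectSum {n t : ℕ} (N : ℕ) (h : Fin t → Outcome n) (i j : Node n) : ℝ :=
  ∑ k ∈ Finset.range N,
    (obs h (2 * (i.val - 1) * N + k) j - obs h ((2 * (i.val - 1) + 1) * N + k) j)

/-- The test by which `i` is put among the estimated ancestors of `j`, for distinct
`i, j ∈ {X_2, …, X_n}`. -/
def Detected {n t : ℕ} (c₀ c₁ : ℝ) (T : ℕ) (h : Fin t → Outcome n) (i j : Node n) : Prop :=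
  i ≠ j ∧ i ≠ root n ∧ i ≠ target n ∧ j ≠ root n ∧ j ≠ target n ∧
    c₀ * c₁ * (T : ℝ) ^ (1 / 3 : ℝ) * Real.log ((T : ℝ) ^ 2) < effectSum (initCount c₀ T) h i j

open Classical in
/-- The estimated ancestors: all of `X_1, …, X_n` for `Y`; none for `X_1`; for `X_2, …, X_n` the
transitive closure of the detected relation, together with `X_1`. -/
def ancHat {n t : ℕ} (c₀ c₁ : ℝ) (T : ℕ) (h : Fin t → Outcome n) (v : Node n) :
    Finset (Node n) :=
  if v = target n then Finset.univ.filter (fun u => u ≠ target n)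
  else if v = root n then ∅
  else Finset.univ.filter
    (fun u => u = root n ∨ Relation.TransGen (Detected c₀ c₁ T h) u v)

/-! ### The iterative phase: linear regression and optimism -/

/-- The vector of the values of the nodes in `A`. -/
def designVec {n : ℕ} (A : Finset (Node n)) (x : Outcome n) : A → ℝ := fun u => val (x u.val)

/-- `M_{t,v} = I + ∑ V Vᵀ`, over the rounds after the first `T₀` in which `v` was not intervened. -/
def gram {n t : ℕ} (π : Policy n) (T₀ : ℕ) (A : Finset (Node n)) (v : Node n)
    (h : Fin t → Outcome n) : Matrix A A ℝ :=
  1 + ∑ s : Fin t, if T₀ ≤ s.val ∧ π s (past h s) v = none then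
    Matrix.vecMulVec (designVec A (h s)) (designVec A (h s)) else 0

/-- `b_{t,v} = ∑ v^{(s)} V_s`, over the same rounds. -/
def response {n t : ℕ} (π : Policy n) (T₀ : ℕ) (A : Finset (Node n)) (v : Node n)
    (h : Fin t → Outcome n) : A → ℝ :=
  ∑ s : Fin t, if T₀ ≤ s.val ∧ π s (past h s) v = none then
    val (h s v) • designVec A (h s) else 0

/-- The regression estimate `M_{t,v}⁻¹ b_{t,v}`. -/
def estimate {n t : ℕ} (π : Policy n) (T₀ : ℕ) (A : Finset (Node n)) (v : Node n)
    (h : Fin t → Outcome n) : A → ℝ :=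
  (gram π T₀ A v h)⁻¹ *ᵥ response π T₀ A v h

/-- The weighted norm `√(xᵀ B x)`. -/
def wnorm {ι : Type*} [Fintype ι] (B : Matrix ι ι ℝ) (x : ι → ℝ) : ℝ :=
  Real.sqrt (x ⬝ᵥ (B *ᵥ x))

/-- The confidence radius `ρ_t`, with `δ = 1 / (n √T)`. -/
def radius (n T t : ℕ) : ℝ :=
  Real.sqrt (n * Real.log (1 + t * n) + 2 * Real.log (1 / (1 / (n * Real.sqrt T))))
    + Real.sqrt n

/-- The part of the ellipsoid of radius `ρ` around `c` that lies in the unit box. -/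
def confSet {ι : Type*} [Fintype ι] (B : Matrix ι ι ℝ) (c : ι → ℝ) (ρ : ℝ) : Set (ι → ℝ) :=
  {θ | (∀ i, θ i ∈ Set.Icc (0 : ℝ) 1) ∧ wnorm B (θ - c) ≤ ρ}

/-- The points of the unit box that are nearest to `c` in the weighted norm. -/
def nearestSet {ι : Type*} [Fintype ι] (B : Matrix ι ι ℝ) (c : ι → ℝ) : Set (ι → ℝ) :=
  {θ | (∀ i, θ i ∈ Set.Icc (0 : ℝ) 1) ∧
    ∀ θ' : ι → ℝ, (∀ i, θ' i ∈ Set.Icc (0 : ℝ) 1) → wnorm B (θ - c) ≤ wnorm B (θ' - c)}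

open Classical in
/-- The weights the optimistic step ranges over: the confidence set, or, if that is empty, the
points of the unit box nearest to its center. -/
def searchSet {ι : Type*} [Fintype ι] (B : Matrix ι ι ℝ) (c : ι → ℝ) (ρ : ℝ) : Set (ι → ℝ) :=
  if (confSet B c ρ).Nonempty then confSet B c ρ else nearestSet B c

/-- The activation probabilities of the linear model on the graph with parent sets `A` and with
weights `θ` in the unit box: `v` is activated iff `θ_v · pa(v)` reaches a uniform random threshold
in `[0,1]`, so that the probability is `θ_v · pa(v)`, capped at `1`. -/
def linProb {n : ℕ} (A : Node n → Finset (Node n)) (θ : (v : Node n) → A v → ℝ)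
    (v : Node n) (x : Outcome n) : ℝ :=
  if v = root n then 1 else min 1 (∑ u : A v, θ v u * val (x u.val))

/-- The policy `π` is an execution of BLM-LR-Unknown with constants `c₀`, `c₁`, horizon `T` and
action set `𝒜`. Ties in the maximization are broken arbitrarily. If the estimated graph has a
cycle (so that it carries no causal model), any available intervention may be played. -/
structure IsBLMLRUnknown {n : ℕ} (𝒜 : Finset (Action n)) (c₀ c₁ : ℝ) (T : ℕ)
    (π : Policy n) : Prop where
  init : ∀ t : ℕ, t < T → t < initLength n c₀ T → ∀ h : Fin t → Outcome n,
    π t h = initAction n (initCount c₀ T) t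
  mem : ∀ t : ℕ, t < T → initLength n c₀ T ≤ t → ∀ h : Fin t → Outcome n, π t h ∈ 𝒜
  optimistic : ∀ t : ℕ, t < T → initLength n c₀ T ≤ t → ∀ h : Fin t → Outcome n,
    let A : Node n → Finset (Node n) := ancHat c₀ c₁ T h
    let C : (v : Node n) → Set (A v → ℝ) := fun v =>
      searchSet (gram π (initLength n c₀ T) (A v) v h)
        (estimate π (initLength n c₀ T) (A v) v h) (radius n T t)
    Acyclic A →
      ∃ θt : (v : Node n) → A v → ℝ, (∀ v, θt v ∈ C v) ∧
        ∀ a ∈ 𝒜, ∀ θ' : (v : Node n) → A v → ℝ, (∀ v, θ' v ∈ C v) →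
          expReward (linProb A θ') a ≤ expReward (linProb A θt) (π t h)

end CCB

end

/-! Write s = T^{1/3}. With no weight gap assumption, the initial phase cannot find all ancestors,
so the regressions are biased. Two facts hold with high probability. Every detected pair respects a
causal order of the true graph, because an intervention has no effect on nodes that do not come
later. Every undetected parent has weight below 4c₁/s, because the total effect of a parent is at
least the weight of its edge. Hence the linear model on the estimated parents, with the true weights
restricted to them, has bias at most ε = 4c₁n/s at each node.

Concentration of the regression comes from an exponential supermartingale (`noisePotential_step`),
and `wnorm_estimate_sub_le` adds the bias. After k iterative rounds the estimate is within noise +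
ε√k + 1 of the restricted weights in the Gram norm. The radius carries an extra √n beyond the noise,
so the restricted weights stay in the confidence set as long as ε√k + 1 ≤ √n, that is, for about t₀
= n/(16ε²) rounds. In these rounds the usual optimism argument applies (`GoodRun.early_regret_le`).

Later, optimism may fail, and a comparison with the past takes its place (`GoodRun.late_regret_le`).
The value of the chosen pair is at least the value that the same weights give to every earlier
intervention. Averaged over the earlier rounds, those values are close to the true expected rewards:
the chosen weights are within D = 2(ρ + ε√k) of the restricted ones in the Gram norm, which measures
prediction error on the sample itself. A multiplicative tail bound, made uniform over the weights by
a grid, passes from the sample to expectations (`sum_condExp_capLin_le`). So the regret of a late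
round exceeds the average regret of the preceding iterative rounds only by a drift of order n(ε +
ρ/√k + λ/k), where λ is the confidence level of the grid bound, plus the exploration bonus of the
round.

`sum_le_of_le_average` solves this recursion: up to the factor T, the total is the sum of the
per-round errors with weights 1/max(t₀, k+1). Since 1/√t₀ is about ε/√n, the drift sums to order nε
log T. The bonuses are bounded by Cauchy–Schwarz and the elliptical potential (`sum_bonus_le`),
giving at most order n²ε log T. As Tε = 4c₁ns², the result is n³T^{2/3} log T. The initial phase
costs at most its length, of order nT^{2/3} log T. Horizons that are small compared with a power of
n are covered by the trivial bound T. -/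

noncomputable section

namespace CCB

variable {n : ℕ}

/-! ### The truncated factorization -/

/-- The factor of the node `v` in the truncated factorization `doProb`. -/
def nodeProb (q : Node n → Outcome n → ℝ) (a : Action n) (v : Node n) (x : Outcome n) : ℝ :=
  match a v with
  | some b => if x v = b then 1 else 0
  | none => if x v then q v x else 1 - q v x

lemma doProb_eq_prod (q : Node n → Outcome n → ℝ) (a : Action n) (x : Outcome n) :
    doProb q a x = ∏ v, nodeProb q a v x := rfl

/-- `q v` only depends on the coordinates of rank smaller than that of `v`. -/
def DependsBelow (r : Node n → ℕ) (q : Node n → Outcome n → ℝ) : Prop :=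
  ∀ v x y, (∀ u, r u < r v → x u = y u) → q v x = q v y

/-- The outcome `x` with the value of `v` negated. -/
def flipAt (v : Node n) (x : Outcome n) : Outcome n := Function.update x v (!x v)

lemma flipAt_same (v : Node n) (x : Outcome n) : flipAt v x v = !x v := by simp [flipAt]

lemma flipAt_of_ne {u v : Node n} (h : u ≠ v) (x : Outcome n) : flipAt v x u = x u := by
  simp [flipAt, h]

lemma flipAt_involutive (v : Node n) : Function.Involutive (flipAt v) := by
  intro x
  simp [flipAt]

lemma sum_flipAt (v : Node n) (f : Outcome n → ℝ) : ∑ x, f (flipAt v x) = ∑ x, f x :=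
  Equiv.sum_comp (flipAt_involutive v).toPerm f

/-- `G` does not depend on the coordinate `v`. -/
def Ignores (v : Node n) (G : Outcome n → ℝ) : Prop := ∀ x, G (flipAt v x) = G x

lemma Ignores.mul {v : Node n} {G H : Outcome n → ℝ} (hG : Ignores v G) (hH : Ignores v H) :
    Ignores v (fun x => G x * H x) := fun x => by simp only [hG x, hH x]

lemma Ignores.prod {v : Node n} {S : Finset (Node n)} {G : Node n → Outcome n → ℝ}
    (hG : ∀ u ∈ S, Ignores v (G u)) : Ignores v (fun x => ∏ u ∈ S, G u x) :=
  fun x => Finset.prod_congr rfl fun u hu => hG u hu x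

lemma Ignores.sum {v : Node n} {S : Finset (Node n)} {G : Node n → Outcome n → ℝ}
    (hG : ∀ u ∈ S, Ignores v (G u)) : Ignores v (fun x => ∑ u ∈ S, G u x) :=
  fun x => Finset.sum_congr rfl fun u hu => hG u hu x

lemma DependsBelow.ignores {r : Node n → ℕ} {q : Node n → Outcome n → ℝ} (hq : DependsBelow r q)
    {u v : Node n} (h : ¬ r v < r u) : Ignores v (q u) := by
  intro x
  refine hq u _ _ fun w hw => flipAt_of_ne ?_ x
  rintro rfl
  exact h hw

lemma DependsBelow.nodeProb_ignores {r : Node n → ℕ} {q : Node n → Outcome n → ℝ}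
    (hq : DependsBelow r q) (a : Action n) {u v : Node n} (huv : u ≠ v) (h : ¬ r v < r u) :
    Ignores v (nodeProb q a u) := by
  intro x
  simp only [nodeProb, flipAt_of_ne huv, hq.ignores h x]

lemma DependsBelow.nodeProb_add_flipAt {r : Node n → ℕ} {q : Node n → Outcome n → ℝ}
    (hq : DependsBelow r q) (a : Action n) (v : Node n) (x : Outcome n) :
    nodeProb q a v x + nodeProb q a v (flipAt v x) = 1 := by
  have h := hq.ignores (lt_irrefl (r v)) x
  simp only [nodeProb, flipAt_same, h]
  cases a v with
  | none => cases x v <;> simp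
  | some b => cases x v <;> cases b <;> simp

lemma nodeProb_nonneg {q : Node n → Outcome n → ℝ} (h01 : ∀ v x, q v x ∈ Set.Icc (0 : ℝ) 1)
    (a : Action n) (v : Node n) (x : Outcome n) : 0 ≤ nodeProb q a v x := by
  have := h01 v x
  simp only [nodeProb]
  split
  · split_ifs <;> norm_num
  · split_ifs
    · exact this.1
    · linarith [this.2]

lemma doProb_nonneg {q : Node n → Outcome n → ℝ} (h01 : ∀ v x, q v x ∈ Set.Icc (0 : ℝ) 1)
    (a : Action n) (x : Outcome n) : 0 ≤ doProb q a x :=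
  Finset.prod_nonneg fun v _ => nodeProb_nonneg h01 a v x

/-- Pair each outcome with its flip at `v`: the two factors add up to 1. Sums run over the whole
cube instead of over partial assignments, so a summed-out coordinate shows up as a factor 2. -/
lemma sum_mul_nodeProb {r : Node n → ℕ} {q : Node n → Outcome n → ℝ} (hq : DependsBelow r q)
    (a : Action n) {v : Node n} {G : Outcome n → ℝ} (hG : Ignores v G) :
    2 * ∑ x, G x * nodeProb q a v x = ∑ x, G x := by
  have h : ∑ x, G x * nodeProb q a v x = ∑ x, G x * nodeProb q a v (flipAt v x) := by
    rw [← sum_flipAt v]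
    exact Finset.sum_congr rfl fun x _ => by rw [hG x]
  rw [two_mul]
  nth_rewrite 2 [h]
  rw [← Finset.sum_add_distrib]
  exact Finset.sum_congr rfl fun x _ => by
    rw [← mul_add, hq.nodeProb_add_flipAt, mul_one]

/-- Nodes are summed out from the largest rank downwards, since the value of a node of maximal rank
enters no other factor. -/
lemma sum_mul_prod_nodeProb {r : Node n → ℕ} {q : Node n → Outcome n → ℝ} (hq : DependsBelow r q)
    (a : Action n) (U : Finset (Node n)) :
    ∀ {G : Outcome n → ℝ}, (∀ v ∈ U, Ignores v G) →
      2 ^ U.card * ∑ x, G x * ∏ v ∈ U, nodeProb q a v x = ∑ x, G x := by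
  induction U using Finset.induction_on_max_value r with
  | empty => intro G _; simp
  | insert v S hv hmax ih =>
    intro G hG
    have h1 : Ignores v (fun x => G x * ∏ u ∈ S, nodeProb q a u x) :=
      (hG v (Finset.mem_insert_self v S)).mul (Ignores.prod fun u hu =>
        hq.nodeProb_ignores a (fun h => hv (h ▸ hu)) (not_lt.2 (hmax u hu)))
    have h2 := sum_mul_nodeProb hq a h1
    rw [Finset.card_insert_of_notMem hv, pow_succ]
    rw [← ih fun u hu => hG u (Finset.mem_insert_of_mem hu), ← h2, mul_assoc]
    congr 2
    exact Finset.sum_congr rfl fun x _ => by rw [Finset.prod_insert hv]; ring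

lemma sum_doProb {r : Node n → ℕ} {q : Node n → Outcome n → ℝ} (hq : DependsBelow r q)
    (a : Action n) : ∑ x, doProb q a x = 1 := by
  have h := sum_mul_prod_nodeProb hq a Finset.univ (G := fun _ => 1) fun _ _ _ => rfl
  simp only [one_mul, Finset.card_univ, Fintype.card_fin, Finset.sum_const, nsmul_eq_mul, mul_one,
    Fintype.card_pi, Fintype.card_bool, Finset.prod_const, Nat.cast_pow, Nat.cast_ofNat] at h
  have h2 : (2 : ℝ) ^ (n + 1) ≠ 0 := by positivity
  exact mul_left_cancel₀ h2 (by simpa [doProb_eq_prod] using h)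

/-- Averaging over the value of a node that is not intervened, given the nodes of smaller rank. -/
lemma sum_doProb_mul_eq {r : Node n → ℕ} {q : Node n → Outcome n → ℝ} (hq : DependsBelow r q)
    {a : Action n} {v : Node n} (hv : a v = none) {G : Outcome n → ℝ}
    (hG : ∀ u, u ≠ v → ¬ r u < r v → Ignores u G) :
    ∑ x, doProb q a x * G x = ∑ x, doProb q a x *
      (q v x * G (Function.update x v true) + (1 - q v x) * G (Function.update x v false)) := by
  classical
  set G' : Outcome n → ℝ := fun x =>
    q v x * G (Function.update x v true) + (1 - q v x) * G (Function.update x v false) with hG'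
  set W : Finset (Node n) := Finset.univ.filter fun u => u ≠ v ∧ ¬ r u < r v with hW
  set Lo : Finset (Node n) := Finset.univ.filter fun u => r u < r v with hLo
  have hvW : v ∉ W := by simp [hW]
  have hvL : v ∉ Lo := by simp [hLo]
  have hdisj : Disjoint (insert v Lo) W := by
    rw [Finset.disjoint_left]
    intro u hu hu'
    simp only [hW, hLo, Finset.mem_insert, Finset.mem_filter, Finset.mem_univ, true_and] at hu hu'
    rcases hu with rfl | hu
    · exact hu'.1 rfl
    · exact hu'.2 hu
  have huniv : (Finset.univ : Finset (Node n)) = insert v Lo ∪ W := by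
    ext u
    simp only [hW, hLo, Finset.mem_insert, Finset.mem_filter, Finset.mem_univ, true_and,
      Finset.mem_union, true_iff]
    tauto
  have hsplit : ∀ x, doProb q a x =
      (∏ u ∈ Lo, nodeProb q a u x) * nodeProb q a v x * ∏ u ∈ W, nodeProb q a u x := by
    intro x
    rw [doProb_eq_prod, huniv, Finset.prod_union hdisj, Finset.prod_insert hvL]
    ring
  have hLoIgn : ∀ w, (¬ r w < r v) → Ignores w fun x => ∏ u ∈ Lo, nodeProb q a u x := by
    intro w hw
    refine Ignores.prod fun u hu => hq.nodeProb_ignores a ?_ ?_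
    · rintro rfl; simp [hLo] at hu; exact hw hu
    · simp only [hLo, Finset.mem_filter, Finset.mem_univ, true_and] at hu; omega
  -- All nodes other than `v` that do not precede it are summed out. The sum on the right still
  -- ranges over their coordinates, hence the power of 2.
  have key : ∀ H : Outcome n → ℝ, (∀ u, u ≠ v → ¬ r u < r v → Ignores u H) →
      2 ^ W.card * ∑ x, doProb q a x * H x =
        ∑ x, (∏ u ∈ Lo, nodeProb q a u x) * nodeProb q a v x * H x := by
    intro H hH
    rw [← sum_mul_prod_nodeProb hq a W (G := fun x =>
      (∏ u ∈ Lo, nodeProb q a u x) * nodeProb q a v x * H x)]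
    · congr 1
      exact Finset.sum_congr rfl fun x _ => by rw [hsplit]; ring
    · intro w hw
      simp only [hW, Finset.mem_filter, Finset.mem_univ, true_and] at hw
      exact ((hLoIgn w hw.2).mul (hq.nodeProb_ignores a hw.1.symm hw.2)).mul (hH w hw.1 hw.2)
  have hG'Ign : ∀ u, u ≠ v → ¬ r u < r v → Ignores u G' := by
    intro u huv hru x
    have h1 : ∀ b, Function.update (flipAt u x) v b = flipAt u (Function.update x v b) := by
      intro b
      ext w
      by_cases hwv : w = v
      · subst hwv; simp [flipAt, huv.symm]
      · by_cases hwu : w = u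
        · subst hwu; simp [flipAt, hwv]
        · simp [flipAt, hwv, hwu]
    simp only [hG', h1, hG u huv hru _, hq.ignores hru x]
  have hG'v : Ignores v G' := by
    intro x
    have h1 : ∀ b, Function.update (flipAt v x) v b = Function.update x v b := by
      intro b; simp [flipAt]
    simp only [hG', h1, hq.ignores (lt_irrefl (r v)) x]
  -- The two values of `v`, weighted by their conditional probabilities, give the average `G'`,
  -- whichever of the two `x` carries.
  have hpt : ∀ x, nodeProb q a v x * G x + nodeProb q a v (flipAt v x) * G (flipAt v x) = G' x := by
    intro x
    have hx : Function.update x v (x v) = x := Function.update_eq_self v x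
    simp only [nodeProb, hv, flipAt_same, hq.ignores (lt_irrefl (r v)) x, hG']
    cases hxv : x v with
    | true =>
      rw [hxv] at hx
      simp [hx, flipAt, hxv]
    | false =>
      rw [hxv] at hx
      simp [hx, flipAt, hxv]; ring
  have h2 : (2 : ℝ) ^ W.card ≠ 0 := by positivity
  apply mul_left_cancel₀ h2
  rw [key G hG, key G' hG'Ign]
  apply mul_left_cancel₀ (two_ne_zero (α := ℝ))
  have e2 := sum_mul_nodeProb hq a ((hLoIgn v (lt_irrefl _)).mul hG'v)
  have e1 : ∑ x, (∏ u ∈ Lo, nodeProb q a u x) * nodeProb q a v x * G x =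
      ∑ x, (∏ u ∈ Lo, nodeProb q a u x) * (nodeProb q a v (flipAt v x) * G (flipAt v x)) := by
    rw [← sum_flipAt v]
    exact Finset.sum_congr rfl fun x _ => by
      have := hLoIgn v (lt_irrefl _) x
      simp only at this
      rw [this]; ring
  have e3 : 2 * ∑ x, (∏ u ∈ Lo, nodeProb q a u x) * nodeProb q a v x * G x =
      ∑ x, (∏ u ∈ Lo, nodeProb q a u x) * G' x := by
    rw [two_mul]
    nth_rewrite 2 [e1]
    rw [← Finset.sum_add_distrib]
    exact Finset.sum_congr rfl fun x _ => by rw [← hpt x]; ring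
  rw [e3, ← e2]
  congr 1
  exact Finset.sum_congr rfl fun x _ => by ring

/-! ### Comparison of two models with a common causal order -/

/-- The pointwise distance of two families of activation probabilities, at the nodes that are not
intervened. -/
def discrepancy (q q' : Node n → Outcome n → ℝ) (a : Action n) (v : Node n) (x : Outcome n) : ℝ :=
  if a v = none then |q v x - q' v x| else 0

/-- A hybrid argument: for the node `v` of largest rank, with P, P' the remaining products, write pP
- p'P' = P(p - p') + (P - P')p'. The factor p' sums out, leaving the induction hypothesis. The first
term costs the discrepancy at `v` once for each of its two values, whence the factor 2. Only the
first model weights the discrepancies, so the bound is an expectation under the true model when that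
one comes first. -/
lemma sum_abs_prod_sub_le {r : Node n → ℕ} {q q' : Node n → Outcome n → ℝ}
    (hq : DependsBelow r q) (hq' : DependsBelow r q') (h01 : ∀ v x, q v x ∈ Set.Icc (0 : ℝ) 1)
    (h01' : ∀ v x, q' v x ∈ Set.Icc (0 : ℝ) 1) (a : Action n) (S : Finset (Node n)) :
    ∑ x, |∏ v ∈ S, nodeProb q a v x - ∏ v ∈ S, nodeProb q' a v x| ≤
      ∑ x, (∏ v ∈ S, nodeProb q a v x) * ∑ v ∈ S, 2 * discrepancy q q' a v x := by
  induction S using Finset.induction_on_max_value r with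
  | empty => simp
  | insert v S hv hmax ih =>
    set P : Outcome n → ℝ := fun x => ∏ u ∈ S, nodeProb q a u x with hP
    set P' : Outcome n → ℝ := fun x => ∏ u ∈ S, nodeProb q' a u x with hP'
    set d : Outcome n → ℝ := fun x => ∑ u ∈ S, 2 * discrepancy q q' a u x with hd
    have hne : ∀ u ∈ S, u ≠ v := fun u hu h => hv (h ▸ hu)
    have iP : Ignores v P := Ignores.prod fun u hu =>
      hq.nodeProb_ignores a (hne u hu) (not_lt.2 (hmax u hu))
    have iP' : Ignores v P' := Ignores.prod fun u hu =>
      hq'.nodeProb_ignores a (hne u hu) (not_lt.2 (hmax u hu))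
    have idisc : ∀ u, ¬ r v < r u → Ignores v fun x => 2 * discrepancy q q' a u x := by
      intro u hu x
      simp only [discrepancy, hq.ignores hu x, hq'.ignores hu x]
    have id : Ignores v d := Ignores.sum fun u hu => idisc u (not_lt.2 (hmax u hu))
    have iPP : Ignores v fun x => |P x - P' x| := fun x => by simp only [iP x, iP' x]
    have e1 := sum_mul_nodeProb hq' a iPP
    have e2 := sum_mul_nodeProb hq a (iP.mul id)
    have e3 := sum_mul_nodeProb hq a (iP.mul (idisc v (lt_irrefl _)))
    have hPn : ∀ x, 0 ≤ P x := fun x => Finset.prod_nonneg fun u _ => nodeProb_nonneg h01 a u x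
    have hdiff : ∀ x, |nodeProb q a v x - nodeProb q' a v x| = discrepancy q q' a v x := by
      intro x
      simp only [nodeProb, discrepancy]
      cases a v with
      | some b => simp
      | none =>
        cases x v with
        | true => simp
        | false => simp [abs_sub_comm]
    have hpt : ∀ x, |∏ u ∈ insert v S, nodeProb q a u x - ∏ u ∈ insert v S, nodeProb q' a u x| ≤
        P x * discrepancy q q' a v x + |P x - P' x| * nodeProb q' a v x := by
      intro x
      rw [Finset.prod_insert hv, Finset.prod_insert hv]
      have : nodeProb q a v x * P x - nodeProb q' a v x * P' x =
          P x * (nodeProb q a v x - nodeProb q' a v x) + (P x - P' x) * nodeProb q' a v x := by ring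
      change |nodeProb q a v x * P x - nodeProb q' a v x * P' x| ≤ _
      rw [this]
      refine (abs_add_le _ _).trans ?_
      rw [abs_mul, abs_mul, abs_of_nonneg (hPn x), hdiff, abs_of_nonneg (nodeProb_nonneg h01' a v x)]
    have hR : ∑ x, (∏ u ∈ insert v S, nodeProb q a u x) *
        ∑ u ∈ insert v S, 2 * discrepancy q q' a u x =
        ∑ x, P x * (2 * discrepancy q q' a v x) * nodeProb q a v x +
          ∑ x, P x * d x * nodeProb q a v x := by
      rw [← Finset.sum_add_distrib]
      refine Finset.sum_congr rfl fun x _ => ?_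
      rw [Finset.prod_insert hv, Finset.sum_insert hv]
      simp only [hP, hd]
      ring
    have hL := Finset.sum_le_sum fun x (_ : x ∈ Finset.univ) => hpt x
    rw [Finset.sum_add_distrib] at hL
    rw [hR]
    have e4 : ∑ x, P x * (2 * discrepancy q q' a v x) = 2 * ∑ x, P x * discrepancy q q' a v x := by
      rw [Finset.mul_sum]; exact Finset.sum_congr rfl fun x _ => by ring
    change ∑ x, |P x - P' x| ≤ ∑ x, P x * d x at ih
    linarith

/-- Two causal models with a common causal order: their expected rewards differ by at most twice
the expected total discrepancy of their activation probabilities. -/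
lemma abs_expReward_sub_le {r : Node n → ℕ} {q q' : Node n → Outcome n → ℝ}
    (hq : DependsBelow r q) (hq' : DependsBelow r q') (h01 : ∀ v x, q v x ∈ Set.Icc (0 : ℝ) 1)
    (h01' : ∀ v x, q' v x ∈ Set.Icc (0 : ℝ) 1) (a : Action n) :
    |expReward q a - expReward q' a| ≤
      ∑ x, doProb q a x * ∑ v, 2 * discrepancy q q' a v x := by
  refine le_trans ?_ (sum_abs_prod_sub_le hq hq' h01 h01' a Finset.univ)
  rw [expReward, expReward, ← Finset.sum_sub_distrib]
  refine (Finset.abs_sum_le_sum_abs _ _).trans (Finset.sum_le_sum fun x _ => ?_)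
  rw [← sub_mul, abs_mul, doProb_eq_prod, doProb_eq_prod]
  refine mul_le_of_le_one_right (abs_nonneg _) ?_
  simp only [val]
  split_ifs <;> simp

lemma val_mem_Icc (b : Bool) : val b ∈ Set.Icc (0 : ℝ) 1 := by
  cases b <;> simp [val]

lemma val_nonneg (b : Bool) : 0 ≤ val b := (val_mem_Icc b).1

lemma val_le_one (b : Bool) : val b ≤ 1 := (val_mem_Icc b).2

lemma sum_doProb_mul_mem_Icc {r : Node n → ℕ} {q : Node n → Outcome n → ℝ}
    (hq : DependsBelow r q) (h01 : ∀ v x, q v x ∈ Set.Icc (0 : ℝ) 1) (a : Action n)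
    {F : Outcome n → ℝ} (hF : ∀ x, F x ∈ Set.Icc (0 : ℝ) 1) :
    ∑ x, doProb q a x * F x ∈ Set.Icc (0 : ℝ) 1 := by
  refine ⟨Finset.sum_nonneg fun x _ => mul_nonneg (doProb_nonneg h01 a x) (hF x).1, ?_⟩
  rw [← sum_doProb hq a]
  exact Finset.sum_le_sum fun x _ => mul_le_of_le_one_right (doProb_nonneg h01 a x) (hF x).2

/-! ### Binary linear models -/

/-- A rank function compatible with the graph of `M`, in which the target comes last. -/
structure IsCausalRank (M : BLM n) (r : Node n → ℕ) : Prop where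
  lt_of_mem_pa : ∀ v, ∀ u ∈ M.pa v, r u < r v
  lt_target : ∀ v, v ≠ target n → r v < r (target n)

/-- The number of ancestors is a rank: by acyclicity, a parent has strictly fewer ancestors than its
child. The target gets a value above all possible counts, since it must come after nodes that are
not its ancestors too. -/
lemma BLM.exists_isCausalRank (M : BLM n) : ∃ r, IsCausalRank M r := by
  classical
  let E : Node n → Node n → Prop := fun u w => u ∈ M.pa w
  let anc : Node n → Finset (Node n) := fun v => Finset.univ.filter fun u => Relation.TransGen E u v
  have hcard : ∀ v, (anc v).card < n + 5 := fun v => by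
    have := Finset.card_le_univ (anc v)
    simp only [Fintype.card_fin] at this
    omega
  refine ⟨fun v => if v = target n then n + 5 else (anc v).card, ?_, ?_⟩
  · intro v u hu
    have hut : u ≠ target n := fun h => M.target_notMem v (h ▸ hu)
    simp only [hut, if_false]
    split_ifs with hv
    · exact hcard u
    · apply Finset.card_lt_card
      rw [Finset.ssubset_iff_of_subset]
      · exact ⟨u, by simpa [anc] using Relation.TransGen.single hu, by
          simpa [anc] using M.acyclic u⟩
      · intro w hw
        simp only [anc, Finset.mem_filter, Finset.mem_univ, true_and] at hw ⊢
        exact hw.tail hu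
  · intro v hv
    simp only [hv, if_false, if_true]
    exact hcard v

lemma BLM.integrable_noise (M : BLM n) {v : Node n} (hv : v ≠ root n) :
    Integrable (fun e : ℝ => e) (M.noise v) := by
  have := M.noise_prob v
  set s := ∑ u ∈ M.pa v, M.θ u v * val true with hs
  refine Integrable.of_mem_Icc (-s) (1 - s) measurable_id.aemeasurable ?_
  filter_upwards [M.noise_bound v hv] with e he
  have := he (fun _ => true) rfl
  simp only [Set.mem_Icc] at this ⊢
  exact ⟨by linarith [this.1], by linarith [this.2]⟩

lemma BLM.condProb_eq (M : BLM n) {v : Node n} (hv : v ≠ root n) (x : Outcome n) :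
    M.condProb v x = ∑ u ∈ M.pa v, M.θ u v * val (x u) := by
  have := M.noise_prob v
  rw [BLM.condProb, if_neg hv, integral_add (integrable_const _) (M.integrable_noise hv),
    M.noise_mean v hv]
  simp

lemma BLM.condProb_root (M : BLM n) (x : Outcome n) : M.condProb (root n) x = 1 := by
  simp [BLM.condProb]

/-- Evaluate the noise bound at the all-ones outcome and average out the centered noise. It follows
that `condProb` is a probability for all outcomes, including those with X_1 = 0, for which the model
requires nothing. -/
lemma BLM.sum_θ_le_one (M : BLM n) {v : Node n} (hv : v ≠ root n) :
    ∑ u ∈ M.pa v, M.θ u v ≤ 1 := by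
  have := M.noise_prob v
  have h1 : ∫ e, ((∑ u ∈ M.pa v, M.θ u v * val true) + e) ∂(M.noise v) ≤ ∫ _, 1 ∂(M.noise v) := by
    refine integral_mono_ae ((integrable_const _).add (M.integrable_noise hv))
      (integrable_const _) ?_
    filter_upwards [M.noise_bound v hv] with e he
    exact (he (fun _ => true) rfl).2
  rw [integral_add (integrable_const _) (M.integrable_noise hv), M.noise_mean v hv] at h1
  simpa [val] using h1

lemma BLM.condProb_mem_Icc (M : BLM n) (v : Node n) (x : Outcome n) :
    M.condProb v x ∈ Set.Icc (0 : ℝ) 1 := by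
  by_cases hv : v = root n
  · subst hv; simp [M.condProb_root]
  · rw [M.condProb_eq hv]
    refine ⟨Finset.sum_nonneg fun u hu => mul_nonneg (M.θ_mem v u hu).1 (val_nonneg _), ?_⟩
    refine le_trans (Finset.sum_le_sum fun u hu => ?_) (M.sum_θ_le_one hv)
    exact mul_le_of_le_one_right (M.θ_mem v u hu).1 (val_le_one _)

lemma IsCausalRank.dependsBelow {M : BLM n} {r : Node n → ℕ} (hr : IsCausalRank M r) :
    DependsBelow r M.condProb := by
  intro v x y h
  by_cases hv : v = root n
  · subst hv; simp [M.condProb_root]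
  · rw [M.condProb_eq hv, M.condProb_eq hv]
    exact Finset.sum_congr rfl fun u hu => by rw [h u (hr.lt_of_mem_pa v u hu)]

lemma IsCausalRank.notMem_pa_self {M : BLM n} {r : Node n → ℕ} (hr : IsCausalRank M r)
    (v : Node n) : v ∉ M.pa v := fun h => lt_irrefl _ (hr.lt_of_mem_pa v v h)

/-! ### Interventional means and total effects -/

/-- The probability that `v = 1` under the intervention `a`. -/
def BLM.mean (M : BLM n) (a : Action n) (v : Node n) : ℝ :=
  ∑ x, doProb M.condProb a x * val (x v)

lemma IsCausalRank.sum_doProb_mul_val {M : BLM n} {r : Node n → ℕ} (hr : IsCausalRank M r)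
    {a : Action n} {v : Node n} (ha : a v = none) :
    M.mean a v = ∑ x, doProb M.condProb a x * M.condProb v x := by
  rw [BLM.mean, sum_doProb_mul_eq hr.dependsBelow ha (G := fun x => val (x v))]
  · simp [val]
  · intro u hu _ x
    simp [flipAt_of_ne hu.symm]

lemma IsCausalRank.mean_root {M : BLM n} {r : Node n → ℕ} (hr : IsCausalRank M r)
    {a : Action n} (ha : a (root n) = none) : M.mean a (root n) = 1 := by
  rw [hr.sum_doProb_mul_val ha]
  simp [M.condProb_root, sum_doProb hr.dependsBelow]

/-- Linearity of the conditional probabilities closes the means under a linear recursion along the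
graph, however dependent the parents are. The facts about effects below are obtained from this
recursion, and their signs from the nonnegativity of the weights. -/
lemma IsCausalRank.mean_eq {M : BLM n} {r : Node n → ℕ} (hr : IsCausalRank M r)
    {a : Action n} {v : Node n} (ha : a v = none) (hv : v ≠ root n) :
    M.mean a v = ∑ u ∈ M.pa v, M.θ u v * M.mean a u := by
  rw [hr.sum_doProb_mul_val ha]
  simp only [M.condProb_eq hv, BLM.mean, Finset.mul_sum]
  rw [Finset.sum_comm]
  exact Finset.sum_congr rfl fun u _ => Finset.sum_congr rfl fun x _ => by ring

lemma IsCausalRank.mean_of_some {M : BLM n} {r : Node n → ℕ} (hr : IsCausalRank M r)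
    {a : Action n} {v : Node n} {b : Bool} (ha : a v = some b) : M.mean a v = val b := by
  have h : ∀ x, doProb M.condProb a x * val (x v) = doProb M.condProb a x * val b := by
    intro x
    by_cases hx : x v = b
    · rw [hx]
    · have : doProb M.condProb a x = 0 := by
        rw [doProb_eq_prod]
        exact Finset.prod_eq_zero (Finset.mem_univ v) (by simp [nodeProb, ha, hx])
      simp [this]
  rw [BLM.mean, Finset.sum_congr rfl fun x _ => h x, ← Finset.sum_mul, sum_doProb hr.dependsBelow,
    one_mul]

lemma atomic_same (i : Node n) (b : Bool) : atomic i b i = some b := by simp [atomic]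

lemma atomic_of_ne {i j : Node n} (h : j ≠ i) (b : Bool) : atomic i b j = none := by
  simp [atomic, h, nullAction]

lemma IsCausalRank.mean_mem_Icc {M : BLM n} {r : Node n → ℕ} (hr : IsCausalRank M r)
    (a : Action n) (v : Node n) : M.mean a v ∈ Set.Icc (0 : ℝ) 1 :=
  sum_doProb_mul_mem_Icc hr.dependsBelow M.condProb_mem_Icc a fun _ => val_mem_Icc _

/-- Intervening on a node has no effect on nodes that do not come later. -/
lemma IsCausalRank.mean_atomic_eq {M : BLM n} {r : Node n → ℕ} (hr : IsCausalRank M r)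
    {i : Node n} (hi : i ≠ root n) : ∀ {j : Node n}, j ≠ i → ¬ r i < r j →
      M.mean (atomic i true) j = M.mean (atomic i false) j := by
  suffices h : ∀ k, ∀ j : Node n, r j = k → j ≠ i → ¬ r i < r j →
      M.mean (atomic i true) j = M.mean (atomic i false) j from fun {j} => h _ j rfl
  intro k
  induction k using Nat.strong_induction_on with
  | _ k ih =>
    intro j hk hji hrj
    by_cases hj : j = root n
    · subst hj
      rw [hr.mean_root (atomic_of_ne hi.symm _), hr.mean_root (atomic_of_ne hi.symm _)]
    · rw [hr.mean_eq (atomic_of_ne hji _) hj, hr.mean_eq (atomic_of_ne hji _) hj]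
      refine Finset.sum_congr rfl fun u hu => ?_
      have hlt := hr.lt_of_mem_pa j u hu
      have hui : u ≠ i := by rintro rfl; exact hrj hlt
      rw [ih (r u) (hk ▸ hlt) u rfl hui (by omega)]

lemma IsCausalRank.mean_atomic_le {M : BLM n} {r : Node n → ℕ} (hr : IsCausalRank M r)
    {i : Node n} (hi : i ≠ root n) (j : Node n) :
    M.mean (atomic i false) j ≤ M.mean (atomic i true) j := by
  suffices h : ∀ k, ∀ j : Node n, r j = k →
      M.mean (atomic i false) j ≤ M.mean (atomic i true) j from h _ j rfl
  intro k
  induction k using Nat.strong_induction_on with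
  | _ k ih =>
    intro j hk
    by_cases hji : j = i
    · subst hji
      rw [hr.mean_of_some (atomic_same j _), hr.mean_of_some (atomic_same j _)]
      simp [val]
    by_cases hj : j = root n
    · subst hj
      rw [hr.mean_root (atomic_of_ne hi.symm _), hr.mean_root (atomic_of_ne hi.symm _)]
    · rw [hr.mean_eq (atomic_of_ne hji _) hj, hr.mean_eq (atomic_of_ne hji _) hj]
      refine Finset.sum_le_sum fun u hu => ?_
      exact mul_le_mul_of_nonneg_left
        (ih (r u) (hk ▸ hr.lt_of_mem_pa j u hu) u rfl) (M.θ_mem j u hu).1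

/-- The total effect of a parent is at least the weight of its edge. -/
lemma IsCausalRank.θ_le_mean_sub {M : BLM n} {r : Node n → ℕ} (hr : IsCausalRank M r)
    {i j : Node n} (hi : i ≠ root n) (hj : j ≠ root n) (hij : i ∈ M.pa j) :
    M.θ i j ≤ M.mean (atomic i true) j - M.mean (atomic i false) j := by
  have hji : j ≠ i := by rintro rfl; exact hr.notMem_pa_self _ hij
  rw [hr.mean_eq (atomic_of_ne hji _) hj, hr.mean_eq (atomic_of_ne hji _) hj,
    ← Finset.sum_sub_distrib]
  have h1 : M.θ i j = M.θ i j * M.mean (atomic i true) i - M.θ i j * M.mean (atomic i false) i := by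
    rw [hr.mean_of_some (atomic_same i _), hr.mean_of_some (atomic_same i _)]
    simp [val]
  rw [h1]
  refine Finset.single_le_sum (f := fun u => M.θ u j * M.mean (atomic i true) u -
    M.θ u j * M.mean (atomic i false) u) (fun u hu => ?_) hij
  rw [← mul_sub]
  exact mul_nonneg (M.θ_mem j u hu).1 (sub_nonneg.2 (hr.mean_atomic_le hi u))

/-! ### Trajectories -/

/-- The expectation of a function of the first `T` outcomes. -/
def trajExp (M : BLM n) (π : Policy n) (T : ℕ) (F : (Fin T → Outcome n) → ℝ) : ℝ :=
  ∑ ω : Fin T → Outcome n, trajProb M π ω * F ω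

/-- A history extended by one round. -/
def extend {t : ℕ} (h : Fin t → Outcome n) (x : Outcome n) : Fin (t + 1) → Outcome n :=
  Fin.snoc (α := fun _ => Outcome n) h x

/-- The first `t` rounds of a history. -/
def pre {t T : ℕ} (ht : t ≤ T) (ω : Fin T → Outcome n) : Fin t → Outcome n :=
  fun u => ω ⟨u.val, u.isLt.trans_le ht⟩

lemma extend_castSucc {t : ℕ} (h : Fin t → Outcome n) (x : Outcome n) (s : Fin t) :
    extend h x s.castSucc = h s := by
  simp [extend]

lemma extend_last {t : ℕ} (h : Fin t → Outcome n) (x : Outcome n) :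
    extend h x (Fin.last t) = x := by
  simp [extend]

lemma past_extend_castSucc {t : ℕ} (h : Fin t → Outcome n) (x : Outcome n) (s : Fin t) :
    past (extend h x) s.castSucc = past h s :=
  funext fun u => extend_castSucc h x ⟨u.val, u.isLt.trans s.isLt⟩

lemma past_extend_last {t : ℕ} (h : Fin t → Outcome n) (x : Outcome n) :
    past (extend h x) (Fin.last t) = h :=
  funext fun u => extend_castSucc h x u

lemma pre_extend {s t : ℕ} (hs : s ≤ t) (h : Fin t → Outcome n) (x : Outcome n) :
    pre (hs.trans t.le_succ) (extend h x) = pre hs h :=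
  funext fun u => extend_castSucc h x ⟨u.val, u.isLt.trans_le hs⟩

lemma trajProb_extend (M : BLM n) (π : Policy n) {t : ℕ} (h : Fin t → Outcome n)
    (x : Outcome n) :
    trajProb M π (extend h x) = trajProb M π h * doProb M.condProb (π t h) x := by
  rw [trajProb, Fin.prod_univ_castSucc, extend_last]
  congr 1
  · refine Finset.prod_congr rfl fun s _ => ?_
    rw [extend_castSucc, past_extend_castSucc]
    rfl
  · rw [past_extend_last]
    rfl

lemma trajExp_succ (M : BLM n) (π : Policy n) (t : ℕ) (F : (Fin (t + 1) → Outcome n) → ℝ) :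
    trajExp M π (t + 1) F =
      trajExp M π t fun h => ∑ x, doProb M.condProb (π t h) x * F (extend h x) := by
  rw [trajExp, trajExp, ← (Fin.snocEquiv fun _ => Outcome n).sum_comp, Fintype.sum_prod_type_right]
  refine Finset.sum_congr rfl fun h _ => ?_
  rw [Finset.mul_sum]
  refine Finset.sum_congr rfl fun x _ => ?_
  change trajProb M π (extend h x) * F (extend h x) = _
  rw [trajProb_extend]
  ring

lemma trajExp_zero (M : BLM n) (π : Policy n) (F : (Fin 0 → Outcome n) → ℝ) :
    trajExp M π 0 F = F Fin.elim0 := by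
  rw [trajExp, Fintype.sum_unique]
  simp only [trajProb, Finset.univ_eq_empty, Finset.prod_empty, one_mul]
  congr 1

lemma trajProb_nonneg (M : BLM n) (π : Policy n) {T : ℕ} (ω : Fin T → Outcome n) :
    0 ≤ trajProb M π ω :=
  Finset.prod_nonneg fun _ _ => doProb_nonneg M.condProb_mem_Icc _ _

lemma trajExp_mono (M : BLM n) (π : Policy n) {T : ℕ} {F G : (Fin T → Outcome n) → ℝ}
    (h : ∀ ω, F ω ≤ G ω) : trajExp M π T F ≤ trajExp M π T G :=
  Finset.sum_le_sum fun ω _ => mul_le_mul_of_nonneg_left (h ω) (trajProb_nonneg M π ω)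

lemma trajExp_add (M : BLM n) (π : Policy n) {T : ℕ} (F G : (Fin T → Outcome n) → ℝ) :
    trajExp M π T (fun ω => F ω + G ω) = trajExp M π T F + trajExp M π T G := by
  simp only [trajExp, mul_add, Finset.sum_add_distrib]

lemma trajExp_const_mul (M : BLM n) (π : Policy n) {T : ℕ} (c : ℝ)
    (F : (Fin T → Outcome n) → ℝ) :
    trajExp M π T (fun ω => c * F ω) = c * trajExp M π T F := by
  simp only [trajExp, Finset.mul_sum]
  exact Finset.sum_congr rfl fun ω _ => by ring

lemma trajExp_sum (M : BLM n) (π : Policy n) {T : ℕ} {ι : Type*} (S : Finset ι)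
    (F : ι → (Fin T → Outcome n) → ℝ) :
    trajExp M π T (fun ω => ∑ i ∈ S, F i ω) = ∑ i ∈ S, trajExp M π T (F i) := by
  simp only [trajExp, Finset.mul_sum]
  exact Finset.sum_comm

lemma sum_doProb_condProb (M : BLM n) (a : Action n) : ∑ x, doProb M.condProb a x = 1 := by
  obtain ⟨r, hr⟩ := M.exists_isCausalRank
  exact sum_doProb hr.dependsBelow a

lemma trajExp_pre (M : BLM n) (π : Policy n) {t T : ℕ} (ht : t ≤ T)
    (F : (Fin t → Outcome n) → ℝ) :
    trajExp M π T (fun ω => F (pre ht ω)) = trajExp M π t F := by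
  induction T, ht using Nat.le_induction with
  | base => rfl
  | succ T ht ih =>
    rw [trajExp_succ, ← ih]
    congr 1
    funext h
    simp_rw [pre_extend ht]
    rw [← Finset.sum_mul, sum_doProb_condProb, one_mul]

lemma trajExp_const (M : BLM n) (π : Policy n) (T : ℕ) (c : ℝ) :
    trajExp M π T (fun _ => c) = c := by
  have := trajExp_pre M π (Nat.zero_le T) fun _ => c
  rwa [trajExp_zero] at this

/-- A supermartingale does not increase in expectation. -/
lemma trajExp_le_of_supermartingale (M : BLM n) (π : Policy n) (Z : ∀ t, (Fin t → Outcome n) → ℝ)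
    (T : ℕ) (hZ : ∀ t < T, ∀ h : Fin t → Outcome n,
      ∑ x, doProb M.condProb (π t h) x * Z (t + 1) (extend h x) ≤ Z t h) :
    trajExp M π T (Z T) ≤ Z 0 Fin.elim0 := by
  induction T with
  | zero => rw [trajExp_zero]
  | succ T ih =>
    rw [trajExp_succ]
    exact (trajExp_mono M π (hZ T T.lt_succ_self)).trans (ih fun t ht => hZ t (ht.trans T.lt_succ_self))

/-! ### Probabilities of events and union bounds -/

open Classical in
/-- The probability of an event. -/
def trajPr (M : BLM n) (π : Policy n) (T : ℕ) (E : (Fin T → Outcome n) → Prop) : ℝ :=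
  trajExp M π T fun ω => if E ω then 1 else 0

lemma trajPr_mono (M : BLM n) (π : Policy n) {T : ℕ} {E E' : (Fin T → Outcome n) → Prop}
    (h : ∀ ω, E ω → E' ω) : trajPr M π T E ≤ trajPr M π T E' := by
  classical
  refine trajExp_mono M π fun ω => ?_
  by_cases h1 : E ω
  · simp [h1, h ω h1]
  · simp only [h1, if_false]
    split_ifs <;> norm_num

lemma trajPr_or_le (M : BLM n) (π : Policy n) {T : ℕ} (E E' : (Fin T → Outcome n) → Prop) :
    trajPr M π T (fun ω => E ω ∨ E' ω) ≤ trajPr M π T E + trajPr M π T E' := by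
  classical
  rw [trajPr, trajPr, trajPr, ← trajExp_add]
  refine trajExp_mono M π fun ω => ?_
  by_cases h1 : E ω <;> by_cases h2 : E' ω <;> simp [h1, h2]

lemma trajPr_exists_le (M : BLM n) (π : Policy n) {T : ℕ} {ι : Type*} (S : Finset ι)
    (E : ι → (Fin T → Outcome n) → Prop) (p : ℝ) (hp : ∀ i ∈ S, trajPr M π T (E i) ≤ p) :
    trajPr M π T (fun ω => ∃ i ∈ S, E i ω) ≤ S.card * p := by
  classical
  have h1 : trajPr M π T (fun ω => ∃ i ∈ S, E i ω) ≤ ∑ i ∈ S, trajPr M π T (E i) := by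
    simp only [trajPr]
    rw [← trajExp_sum]
    refine trajExp_mono M π fun ω => ?_
    have hnn : ∀ i ∈ S, (0 : ℝ) ≤ if E i ω then 1 else 0 := fun i _ => by split_ifs <;> norm_num
    split_ifs with h
    · obtain ⟨i, hi, hE⟩ := h
      refine le_trans ?_ (Finset.single_le_sum hnn hi)
      simp [hE]
    · exact Finset.sum_nonneg hnn
  refine h1.trans ((Finset.sum_le_sum hp).trans_eq ?_)
  simp

/-- Markov's inequality at one fixed time. Uniformity in time comes later from a union bound over
the rounds, so no maximal inequality is needed. -/
lemma trajPr_le_of_supermartingale (M : BLM n) (π : Policy n)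
    (Z : ∀ t, (Fin t → Outcome n) → ℝ) {t T : ℕ} (htT : t ≤ T)
    (hZ : ∀ s < t, ∀ h : Fin s → Outcome n,
      ∑ x, doProb M.condProb (π s h) x * Z (s + 1) (extend h x) ≤ Z s h)
    (h0 : Z 0 Fin.elim0 ≤ 1) (hnn : ∀ h, 0 ≤ Z t h) {c : ℝ} (hc : 0 < c) :
    trajPr M π T (fun ω => c ≤ Z t (pre htT ω)) ≤ 1 / c := by
  classical
  rw [trajPr, trajExp_pre M π htT fun h => if c ≤ Z t h then (1 : ℝ) else 0]
  have h1 : trajExp M π t (fun h => if c ≤ Z t h then (1 : ℝ) else 0) ≤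
      trajExp M π t (fun h => 1 / c * Z t h) := by
    refine trajExp_mono M π fun h => ?_
    split_ifs with h2
    · rw [one_div, inv_mul_eq_div, le_div_iff₀ hc, one_mul]; exact h2
    · exact mul_nonneg (by positivity) (hnn h)
  refine h1.trans ?_
  rw [trajExp_const_mul]
  refine mul_le_of_le_one_right (by positivity) ?_
  exact (trajExp_le_of_supermartingale M π Z t hZ).trans h0

/-! ### Conditional expectations of a single round -/

/-- The conditional expectation of a function of the round `t`, given the earlier rounds. -/
def condExp (M : BLM n) (π : Policy n) {t : ℕ} (h : Fin t → Outcome n) (f : Outcome n → ℝ) : ℝ :=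
  ∑ x, doProb M.condProb (π t h) x * f x

/-- The tower property. It trades the expected bonus of each round for the realized one, to which
the pathwise potential argument applies. -/
lemma trajExp_sum_condExp (M : BLM n) (π : Policy n)
    (g : ∀ t : ℕ, (Fin t → Outcome n) → Outcome n → ℝ) (T : ℕ) :
    trajExp M π T (fun ω => ∑ t : Fin T, condExp M π (past ω t) (g t (past ω t))) =
      trajExp M π T (fun ω => ∑ t : Fin T, g t (past ω t) (ω t)) := by
  induction T with
  | zero => simp
  | succ T ih =>
    simp only [Fin.sum_univ_castSucc, trajExp_succ, extend_last, past_extend_last,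
      extend_castSucc, past_extend_castSucc]
    have hL : ∀ (h : Fin T → Outcome n) (A B : ℝ) ,
        ∑ x, doProb M.condProb (π T h) x * (A + B) = A + B := fun h A B => by
      rw [← Finset.sum_mul, sum_doProb_condProb, one_mul]
    have hR : ∀ (h : Fin T → Outcome n) (A : ℝ) (B : Outcome n → ℝ),
        ∑ x, doProb M.condProb (π T h) x * (A + B x) = A + condExp M π h B := fun h A B => by
      simp_rw [mul_add]
      rw [Finset.sum_add_distrib, ← Finset.sum_mul, sum_doProb_condProb, one_mul, condExp]
    have e1 : (trajExp M π T fun h => ∑ x, doProb M.condProb (π T h) x *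
        (∑ s : Fin T, condExp M π (past h s) (g s (past h s)) + condExp M π h (g T h))) =
        trajExp M π T fun h =>
          ∑ s : Fin T, condExp M π (past h s) (g s (past h s)) + condExp M π h (g T h) := by
      congr 1; funext h; exact hL h _ _
    have e2 : (trajExp M π T fun h => ∑ x, doProb M.condProb (π T h) x *
        (∑ s : Fin T, g s (past h s) (h s) + g T h x)) =
        trajExp M π T fun h => ∑ s : Fin T, g s (past h s) (h s) + condExp M π h (g T h) := by
      congr 1; funext h; exact hR h _ _
    refine e1.trans (Eq.trans ?_ e2.symm)
    rw [trajExp_add, trajExp_add, ih]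

lemma condExp_mono (M : BLM n) (π : Policy n) {t : ℕ} (h : Fin t → Outcome n)
    {f g : Outcome n → ℝ} (hfg : ∀ x, f x ≤ g x) : condExp M π h f ≤ condExp M π h g :=
  Finset.sum_le_sum fun x _ =>
    mul_le_mul_of_nonneg_left (hfg x) (doProb_nonneg M.condProb_mem_Icc _ x)

lemma condExp_const (M : BLM n) (π : Policy n) {t : ℕ} (h : Fin t → Outcome n) (c : ℝ) :
    condExp M π h (fun _ => c) = c := by
  rw [condExp, ← Finset.sum_mul, sum_doProb_condProb, one_mul]

lemma condExp_add (M : BLM n) (π : Policy n) {t : ℕ} (h : Fin t → Outcome n)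
    (f g : Outcome n → ℝ) :
    condExp M π h (fun x => f x + g x) = condExp M π h f + condExp M π h g := by
  simp only [condExp, mul_add, Finset.sum_add_distrib]

lemma condExp_const_mul (M : BLM n) (π : Policy n) {t : ℕ} (h : Fin t → Outcome n) (c : ℝ)
    (f : Outcome n → ℝ) : condExp M π h (fun x => c * f x) = c * condExp M π h f := by
  simp only [condExp, Finset.mul_sum]
  exact Finset.sum_congr rfl fun x _ => by ring

lemma condExp_sum (M : BLM n) (π : Policy n) {t : ℕ} (h : Fin t → Outcome n) {ι : Type*}
    (S : Finset ι) (f : ι → Outcome n → ℝ) :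
    condExp M π h (fun x => ∑ i ∈ S, f i x) = ∑ i ∈ S, condExp M π h (f i) := by
  simp only [condExp, Finset.mul_sum]
  exact Finset.sum_comm

/-! ### Weighted norms -/

section WeightedNorm

variable {ι : Type*} [Fintype ι] {B : Matrix ι ι ℝ}

lemma dotProduct_mulVec_comm (hB : B.PosDef) (x y : ι → ℝ) :
    x ⬝ᵥ (B *ᵥ y) = y ⬝ᵥ (B *ᵥ x) := by
  have h : B.IsSymm := by simpa using hB.isHermitian
  rw [Matrix.dotProduct_mulVec, ← Matrix.mulVec_transpose, h.eq, dotProduct_comm]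

lemma quad_nonneg (hB : B.PosDef) (x : ι → ℝ) : 0 ≤ x ⬝ᵥ (B *ᵥ x) := by
  simpa using hB.posSemidef.dotProduct_mulVec_nonneg x

lemma quad_add (hB : B.PosDef) (x y : ι → ℝ) : (x + y) ⬝ᵥ (B *ᵥ (x + y)) =
    x ⬝ᵥ (B *ᵥ x) + 2 * (x ⬝ᵥ (B *ᵥ y)) + y ⬝ᵥ (B *ᵥ y) := by
  rw [Matrix.mulVec_add, add_dotProduct, dotProduct_add, dotProduct_add,
    dotProduct_mulVec_comm hB y x]
  ring

lemma quad_smul (c : ℝ) (x : ι → ℝ) : (c • x) ⬝ᵥ (B *ᵥ (c • x)) = c ^ 2 * (x ⬝ᵥ (B *ᵥ x)) := by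
  rw [Matrix.mulVec_smul, smul_dotProduct, dotProduct_smul]
  simp only [smul_eq_mul]
  ring

lemma sq_dotProduct_mulVec_le (hB : B.PosDef) (x y : ι → ℝ) :
    (x ⬝ᵥ (B *ᵥ y)) ^ 2 ≤ (x ⬝ᵥ (B *ᵥ x)) * (y ⬝ᵥ (B *ᵥ y)) := by
  have h : ∀ c : ℝ, 0 ≤ (y ⬝ᵥ (B *ᵥ y)) * (c * c) + (2 * (x ⬝ᵥ (B *ᵥ y))) * c +
      x ⬝ᵥ (B *ᵥ x) := by
    intro c
    have h1 := quad_nonneg hB (x + c • y)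
    rw [quad_add hB, quad_smul, Matrix.mulVec_smul, dotProduct_smul, smul_eq_mul] at h1
    linarith
  have := discrim_le_zero h
  rw [discrim] at this
  linarith

lemma wnorm_nonneg (x : ι → ℝ) : 0 ≤ wnorm B x := Real.sqrt_nonneg _

lemma sq_wnorm (hB : B.PosDef) (x : ι → ℝ) : wnorm B x ^ 2 = x ⬝ᵥ (B *ᵥ x) :=
  Real.sq_sqrt (quad_nonneg hB x)

lemma abs_dotProduct_mulVec_le (hB : B.PosDef) (x y : ι → ℝ) :
    |x ⬝ᵥ (B *ᵥ y)| ≤ wnorm B x * wnorm B y := by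
  apply abs_le_of_sq_le_sq _ (mul_nonneg (wnorm_nonneg _) (wnorm_nonneg _))
  rw [mul_pow, sq_wnorm hB, sq_wnorm hB]
  exact sq_dotProduct_mulVec_le hB x y

lemma wnorm_add_le (hB : B.PosDef) (x y : ι → ℝ) :
    wnorm B (x + y) ≤ wnorm B x + wnorm B y := by
  apply le_of_sq_le_sq _ (add_nonneg (wnorm_nonneg _) (wnorm_nonneg _))
  rw [sq_wnorm hB, quad_add hB, add_sq, sq_wnorm hB, sq_wnorm hB]
  linarith [(abs_le.1 (abs_dotProduct_mulVec_le hB x y)).2]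

lemma wnorm_sub_comm (x y : ι → ℝ) : wnorm B (x - y) = wnorm B (y - x) := by
  rw [wnorm, wnorm, ← neg_sub y x, Matrix.mulVec_neg, neg_dotProduct_neg]

/-- A rank-one update. -/
def update1 (B : Matrix ι ι ℝ) (V : ι → ℝ) : Matrix ι ι ℝ := B + Matrix.vecMulVec V V

lemma update1_mulVec (V x : ι → ℝ) : update1 B V *ᵥ x = B *ᵥ x + (V ⬝ᵥ x) • V := by
  rw [update1, Matrix.add_mulVec, Matrix.vecMulVec_mulVec]
  simp [op_smul_eq_smul]

lemma posSemidef_vecMulVec (V : ι → ℝ) : (Matrix.vecMulVec V V).PosSemidef := by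
  simpa using Matrix.posSemidef_vecMulVec_self_star V

lemma posDef_update1 (hB : B.PosDef) (V : ι → ℝ) : (update1 B V).PosDef :=
  hB.add_posSemidef (posSemidef_vecMulVec V)

variable [DecidableEq ι]

lemma mulVec_inv_mulVec (hB : B.PosDef) (x : ι → ℝ) : B *ᵥ (B⁻¹ *ᵥ x) = x := by
  rw [Matrix.mulVec_mulVec, Matrix.mul_nonsing_inv _ hB.det_pos.ne'.isUnit, Matrix.one_mulVec]

lemma inv_mulVec_mulVec (hB : B.PosDef) (x : ι → ℝ) : B⁻¹ *ᵥ (B *ᵥ x) = x := by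
  rw [Matrix.mulVec_mulVec, Matrix.nonsing_inv_mul _ hB.det_pos.ne'.isUnit, Matrix.one_mulVec]

lemma wnorm_inv_mulVec (hB : B.PosDef) (x : ι → ℝ) : wnorm B (B⁻¹ *ᵥ x) = wnorm B⁻¹ x := by
  rw [wnorm, wnorm, mulVec_inv_mulVec hB, dotProduct_comm]

/-- The Cauchy–Schwarz inequality for dual weighted norms. -/
lemma abs_dotProduct_le (hB : B.PosDef) (x y : ι → ℝ) :
    |x ⬝ᵥ y| ≤ wnorm B⁻¹ x * wnorm B y := by
  have h := abs_dotProduct_mulVec_le hB y (B⁻¹ *ᵥ x)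
  rwa [mulVec_inv_mulVec hB, wnorm_inv_mulVec hB, dotProduct_comm, mul_comm] at h

lemma det_update1 (hB : B.PosDef) (V : ι → ℝ) :
    (update1 B V).det = B.det * (1 + V ⬝ᵥ (B⁻¹ *ᵥ V)) := by
  have h := Matrix.det_add_replicateCol_mul_replicateRow (ι := Unit) hB.det_pos.ne'.isUnit V V
  rw [update1, Matrix.vecMulVec_eq Unit, h]
  congr 1
  simp only [Matrix.det_unique, Matrix.add_apply, Matrix.one_apply_eq]
  congr 1
  rw [Matrix.mul_assoc, Matrix.mul_apply]
  simp only [dotProduct, Matrix.mulVec, Matrix.mul_apply, Matrix.replicateRow_apply,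
    Matrix.replicateCol_apply]

lemma one_add_quad_inv_pos (hB : B.PosDef) (V : ι → ℝ) : 0 < 1 + V ⬝ᵥ (B⁻¹ *ᵥ V) := by
  linarith [quad_nonneg hB.inv V]

/-- The Sherman–Morrison formula. -/
lemma inv_update1_mulVec (hB : B.PosDef) (V z : ι → ℝ) :
    (update1 B V)⁻¹ *ᵥ z = B⁻¹ *ᵥ z -
      ((V ⬝ᵥ (B⁻¹ *ᵥ z)) / (1 + V ⬝ᵥ (B⁻¹ *ᵥ V))) • (B⁻¹ *ᵥ V) := by
  have hw := (one_add_quad_inv_pos hB V).ne'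
  set u := B⁻¹ *ᵥ z - ((V ⬝ᵥ (B⁻¹ *ᵥ z)) / (1 + V ⬝ᵥ (B⁻¹ *ᵥ V))) • (B⁻¹ *ᵥ V) with hu
  have h : update1 B V *ᵥ u = z := by
    rw [update1_mulVec, hu, Matrix.mulVec_sub, Matrix.mulVec_smul, mulVec_inv_mulVec hB,
      mulVec_inv_mulVec hB, dotProduct_sub, dotProduct_smul, smul_eq_mul]
    ext i
    simp only [Pi.add_apply, Pi.sub_apply, Pi.smul_apply, smul_eq_mul]
    field_simp
    ring
  rw [← h, inv_mulVec_mulVec (posDef_update1 hB V)]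

/-- This is the one-round increment of the self-normalized noise, in terms of the two scalars V·B⁻¹S
and V·B⁻¹V. It reduces the supermartingale property of `noisePotential` to a scalar inequality. -/
lemma quad_inv_update1 (hB : B.PosDef) (V S : ι → ℝ) (η : ℝ) :
    (S + η • V) ⬝ᵥ ((update1 B V)⁻¹ *ᵥ (S + η • V)) = S ⬝ᵥ (B⁻¹ *ᵥ S) +
      (2 * η * (V ⬝ᵥ (B⁻¹ *ᵥ S)) + η ^ 2 * (V ⬝ᵥ (B⁻¹ *ᵥ V)) - (V ⬝ᵥ (B⁻¹ *ᵥ S)) ^ 2) /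
        (1 + V ⬝ᵥ (B⁻¹ *ᵥ V)) := by
  have hw := (one_add_quad_inv_pos hB V).ne'
  rw [inv_update1_mulVec hB, dotProduct_sub, quad_add hB.inv, quad_smul, dotProduct_smul,
    Matrix.mulVec_add, Matrix.mulVec_smul, dotProduct_add, dotProduct_smul, dotProduct_smul,
    add_dotProduct, smul_dotProduct, dotProduct_mulVec_comm hB.inv S V]
  simp only [smul_eq_mul]
  field_simp
  ring

/-- The determinant is the product of the eigenvalues, each of which is the quadratic form at a unit
eigenvector. -/
lemma det_le_pow_of_quad_le (hB : B.PosDef) {b : ℝ} (h : ∀ x, x ⬝ᵥ (B *ᵥ x) ≤ b * (x ⬝ᵥ x)) :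
    B.det ≤ b ^ Fintype.card ι := by
  rw [hB.isHermitian.det_eq_prod_eigenvalues]
  simp only [RCLike.ofReal_real_eq_id, id]
  rw [← Finset.card_univ, ← Finset.prod_const]
  refine Finset.prod_le_prod (fun i _ => (hB.eigenvalues_pos i).le) fun i _ => ?_
  set v : ι → ℝ := (hB.isHermitian.eigenvectorBasis i).ofLp with hv
  have h1 : v ⬝ᵥ v = 1 := by
    have h2 := (hB.isHermitian.eigenvectorBasis).orthonormal.1 i
    have h3 : inner ℝ (hB.isHermitian.eigenvectorBasis i) (hB.isHermitian.eigenvectorBasis i) =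
        (1 : ℝ) := by
      rw [real_inner_self_eq_norm_sq, h2, one_pow]
    rw [EuclideanSpace.inner_eq_star_dotProduct] at h3
    simpa using h3
  have h4 := h v
  rw [hv, hB.isHermitian.mulVec_eigenvectorBasis i, dotProduct_smul, ← hv, h1] at h4
  simpa using h4

end WeightedNorm

/-! ### Scalar inequalities -/

/-- Hoeffding's lemma for a centered Bernoulli variable. -/
lemma bernoulli_mgf_le {p : ℝ} (hp : p ∈ Set.Icc (0 : ℝ) 1) (α : ℝ) :
    p * Real.exp (α * (1 - p)) + (1 - p) * Real.exp (α * (0 - p)) ≤ Real.exp (α ^ 2 / 8) := by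
  set μ : Measure ℝ := ENNReal.ofReal p • Measure.dirac 1 + ENNReal.ofReal (1 - p) • Measure.dirac 0
    with hμ
  have hprob : IsProbabilityMeasure μ := by
    constructor
    simp only [hμ, Measure.coe_add, Measure.coe_smul, Pi.add_apply, Pi.smul_apply, measure_univ,
      smul_eq_mul, mul_one]
    rw [← ENNReal.ofReal_add hp.1 (by linarith [hp.2])]
    simp
  have hint : ∀ f : ℝ → ℝ, ∫ x, f x ∂μ = p * f 1 + (1 - p) * f 0 := by
    intro f
    rw [hμ, integral_add_measure, integral_smul_measure, integral_smul_measure, integral_dirac,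
      integral_dirac, ENNReal.toReal_ofReal hp.1, ENNReal.toReal_ofReal (by linarith [hp.2])]
    · rfl
    · exact (integrable_dirac (by simp)).smul_measure ENNReal.ofReal_ne_top
    · exact (integrable_dirac (by simp)).smul_measure ENNReal.ofReal_ne_top
  have hb : ∀ᵐ x ∂μ, x ∈ Set.Icc (0 : ℝ) 1 := by
    rw [hμ, ae_add_measure_iff]
    constructor
    · refine Measure.ae_smul_measure ?_ _
      exact (ae_dirac_iff measurableSet_Icc).2 (by simp)
    · refine Measure.ae_smul_measure ?_ _
      exact (ae_dirac_iff measurableSet_Icc).2 (by simp)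
  have h := (ProbabilityTheory.hasSubgaussianMGF_of_mem_Icc (μ := μ) (X := fun x : ℝ => x)
    measurable_id.aemeasurable hb).mgf_le α
  rw [ProbabilityTheory.mgf, hint] at h
  simp only [hint] at h
  refine le_trans (le_of_eq ?_) (h.trans (le_of_eq ?_))
  · simp
  · congr 1
    simp
    ring

lemma div_one_add_le_log {w : ℝ} (hw : 0 ≤ w) : w / (1 + w) ≤ Real.log (1 + w) := by
  have h := Real.one_sub_inv_le_log_of_pos (show 0 < 1 + w by linarith)
  refine le_trans (le_of_eq ?_) h
  field_simp
  ring

lemma min_one_le_two_mul_log {w : ℝ} (hw : 0 ≤ w) : min 1 w ≤ 2 * Real.log (1 + w) := by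
  have h := div_one_add_le_log hw
  have h2 : min 1 w / 2 ≤ w / (1 + w) := by
    rw [div_le_div_iff₀ (by norm_num) (by linarith)]
    rcases min_cases 1 w with ⟨h1, h3⟩ | ⟨h1, h3⟩ <;> rw [h1] <;> nlinarith
  linarith

/-- On [0,1], e^{-g} ≤ 1/(1+g) ≤ 1 - g/2, so the expectation is at most e^{m/2}(1 - m/2) ≤ 1.
Comparing g with half its mean avoids any variance term: the resulting tail bound has a deviation
that does not grow with the number of rounds. -/
lemma exp_half_sub_mean_le {ι : Type*} (S : Finset ι) (p g : ι → ℝ) (hp : ∀ i ∈ S, 0 ≤ p i)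
    (hp1 : ∑ i ∈ S, p i = 1) (hg : ∀ i ∈ S, g i ∈ Set.Icc (0 : ℝ) 1) :
    ∑ i ∈ S, p i * Real.exp ((∑ j ∈ S, p j * g j) / 2 - g i) ≤ 1 := by
  set m := ∑ j ∈ S, p j * g j with hm
  have h1 : ∀ i ∈ S, p i * Real.exp (m / 2 - g i) ≤ Real.exp (m / 2) * (p i - p i * g i / 2) := by
    intro i hi
    have h2 : Real.exp (-g i) ≤ 1 - g i / 2 := by
      have h3 := Real.add_one_le_exp (g i)
      have hgi := hg i hi
      rw [Real.exp_neg, inv_le_comm₀ (Real.exp_pos _) (by linarith [hgi.2])]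
      refine le_trans ?_ h3
      rw [inv_le_iff_one_le_mul₀ (by linarith [hgi.2])]
      nlinarith [hgi.1, hgi.2]
    rw [sub_eq_add_neg, Real.exp_add]
    have := mul_le_mul_of_nonneg_left h2 (mul_nonneg (hp i hi) (Real.exp_pos (m / 2)).le)
    linarith
  refine (Finset.sum_le_sum h1).trans ?_
  rw [← Finset.mul_sum, Finset.sum_sub_distrib, hp1, ← Finset.sum_div, ← hm]
  have h4 := Real.add_one_le_exp (-(m / 2))
  rw [Real.exp_neg] at h4
  have h5 := mul_le_mul_of_nonneg_left h4 (Real.exp_pos (m / 2)).le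
  rw [mul_inv_cancel₀ (Real.exp_pos _).ne'] at h5
  linarith

/-! ### The regression matrices -/

/-- The sum of the noises times the design vectors, over the rounds used in the regression. -/
def noiseSum {t : ℕ} (M : BLM n) (π : Policy n) (T₀ : ℕ) (A : Finset (Node n)) (v : Node n)
    (h : Fin t → Outcome n) : A → ℝ :=
  ∑ s : Fin t, if T₀ ≤ s.val ∧ π s (past h s) v = none then
    (val (h s v) - M.condProb v (h s)) • designVec A (h s) else 0

lemma gram_extend (π : Policy n) (T₀ : ℕ) (A : Finset (Node n)) (v : Node n) {t : ℕ}
    (h : Fin t → Outcome n) (x : Outcome n) :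
    gram π T₀ A v (extend h x) = if T₀ ≤ t ∧ π t h v = none then
      update1 (gram π T₀ A v h) (designVec A x) else gram π T₀ A v h := by
  rw [gram, gram, Fin.sum_univ_castSucc, ← add_assoc]
  simp only [extend_castSucc, past_extend_castSucc, extend_last, past_extend_last,
    Fin.val_castSucc, Fin.val_last]
  split_ifs with hc
  · rfl
  · rw [add_zero]

lemma noiseSum_extend (M : BLM n) (π : Policy n) (T₀ : ℕ) (A : Finset (Node n)) (v : Node n)
    {t : ℕ} (h : Fin t → Outcome n) (x : Outcome n) :
    noiseSum M π T₀ A v (extend h x) = if T₀ ≤ t ∧ π t h v = none then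
      noiseSum M π T₀ A v h + (val (x v) - M.condProb v x) • designVec A x
      else noiseSum M π T₀ A v h := by
  rw [noiseSum, noiseSum, Fin.sum_univ_castSucc]
  simp only [extend_castSucc, past_extend_castSucc, extend_last, past_extend_last,
    Fin.val_castSucc, Fin.val_last]
  split_ifs with hc
  · rfl
  · rw [add_zero]

lemma gram_eq_one (π : Policy n) {T₀ t : ℕ} (ht : t ≤ T₀) (A : Finset (Node n)) (v : Node n)
    (h : Fin t → Outcome n) : gram π T₀ A v h = 1 := by
  rw [gram, Finset.sum_eq_zero, add_zero]
  intro s _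
  rw [if_neg]
  rintro ⟨hs, -⟩
  exact absurd s.isLt (by omega)

lemma noiseSum_eq_zero (M : BLM n) (π : Policy n) {T₀ t : ℕ} (ht : t ≤ T₀) (A : Finset (Node n))
    (v : Node n) (h : Fin t → Outcome n) : noiseSum M π T₀ A v h = 0 := by
  rw [noiseSum, Finset.sum_eq_zero]
  intro s _
  rw [if_neg]
  rintro ⟨hs, -⟩
  exact absurd s.isLt (by omega)

lemma posDef_gram (π : Policy n) (T₀ : ℕ) (A : Finset (Node n)) (v : Node n) {t : ℕ}
    (h : Fin t → Outcome n) : (gram π T₀ A v h).PosDef := by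
  refine Matrix.PosDef.one.add_posSemidef (Matrix.posSemidef_sum _ fun s _ => ?_)
  split_ifs
  · exact posSemidef_vecMulVec _
  · exact Matrix.PosSemidef.zero

lemma dotProduct_gram_mulVec (π : Policy n) (T₀ : ℕ) (A : Finset (Node n)) (v : Node n) {t : ℕ}
    (h : Fin t → Outcome n) (x y : A → ℝ) :
    x ⬝ᵥ (gram π T₀ A v h *ᵥ y) = x ⬝ᵥ y + ∑ s : Fin t,
      if T₀ ≤ s.val ∧ π s (past h s) v = none then
        (designVec A (h s) ⬝ᵥ x) * (designVec A (h s) ⬝ᵥ y) else 0 := by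
  rw [gram, Matrix.add_mulVec, Matrix.one_mulVec, dotProduct_add, Matrix.sum_mulVec,
    dotProduct_sum]
  congr 1
  refine Finset.sum_congr rfl fun s _ => ?_
  split_ifs
  · rw [Matrix.vecMulVec_mulVec, op_smul_eq_smul, dotProduct_smul, smul_eq_mul,
      dotProduct_comm x, mul_comm]
  · simp

lemma sq_designVec_dotProduct_le (A : Finset (Node n)) (x : Outcome n) (y : A → ℝ) :
    (designVec A x ⬝ᵥ y) ^ 2 ≤ A.card * (y ⬝ᵥ y) := by
  have h := Finset.sum_mul_sq_le_sq_mul_sq Finset.univ (designVec A x) y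
  refine h.trans ?_
  have h1 : ∑ u, designVec A x u ^ 2 ≤ A.card := by
    calc ∑ u, designVec A x u ^ 2 ≤ ∑ _u : A, (1 : ℝ) := Finset.sum_le_sum fun _ _ =>
          pow_le_one₀ (val_nonneg _) (val_le_one _)
      _ = A.card := by simp
  have h2 : y ⬝ᵥ y = ∑ u, y u ^ 2 := Finset.sum_congr rfl fun _ _ => (pow_two _).symm
  rw [h2]
  exact mul_le_mul_of_nonneg_right h1 (Finset.sum_nonneg fun u _ => sq_nonneg _)

lemma dotProduct_self_nonneg' {ι : Type*} [Fintype ι] (y : ι → ℝ) : 0 ≤ y ⬝ᵥ y :=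
  Finset.sum_nonneg fun _ _ => mul_self_nonneg _

lemma log_det_gram_le (π : Policy n) (T₀ : ℕ) {A : Finset (Node n)} (hA : A.card ≤ n)
    (v : Node n) {t : ℕ} (h : Fin t → Outcome n) :
    Real.log (gram π T₀ A v h).det ≤ n * Real.log (1 + t * n) := by
  have hpd := posDef_gram π T₀ A v h
  have hn : (A.card : ℝ) ≤ n := by exact_mod_cast hA
  have h1 : (gram π T₀ A v h).det ≤ (1 + t * n : ℝ) ^ Fintype.card A := by
    refine det_le_pow_of_quad_le hpd fun x => ?_
    rw [dotProduct_gram_mulVec, add_mul, one_mul]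
    have h2 : ∑ s : Fin t, (if T₀ ≤ s.val ∧ π s (past h s) v = none then
        (designVec A (h s) ⬝ᵥ x) * (designVec A (h s) ⬝ᵥ x) else 0) ≤
        ∑ _s : Fin t, (n : ℝ) * (x ⬝ᵥ x) := by
      refine Finset.sum_le_sum fun s _ => ?_
      have h3 : (0 : ℝ) ≤ n * (x ⬝ᵥ x) := mul_nonneg (Nat.cast_nonneg _) (dotProduct_self_nonneg' x)
      split_ifs
      · rw [← pow_two]
        exact (sq_designVec_dotProduct_le A (h s) x).trans
          (mul_le_mul_of_nonneg_right hn (dotProduct_self_nonneg' x))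
      · exact h3
    simp only [Finset.sum_const, Finset.card_univ, Fintype.card_fin, nsmul_eq_mul] at h2
    linarith
  have h1' : (1 : ℝ) ≤ 1 + t * n := by
    have : (0 : ℝ) ≤ t * n := by positivity
    linarith
  have h4 := Real.log_le_log hpd.det_pos h1
  rw [Real.log_pow, Fintype.card_coe] at h4
  exact h4.trans (mul_le_mul_of_nonneg_right hn (Real.log_nonneg h1'))

/-! ### Confidence of the regression -/

/-- The exponential process that controls the noise in the regression of `v` on `A`. -/
def noisePotential {t : ℕ} (M : BLM n) (π : Policy n) (T₀ : ℕ) (A : Finset (Node n)) (v : Node n)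
    (h : Fin t → Outcome n) : ℝ :=
  Real.exp (2 * (noiseSum M π T₀ A v h ⬝ᵥ ((gram π T₀ A v h)⁻¹ *ᵥ noiseSum M π T₀ A v h)) -
    2 * Real.log (gram π T₀ A v h).det)

/-- The three parts of the increment are treated separately. The part quadratic in the noise is at
most w/(1+w) ≤ log(1+w) and is paid for by the growth of the determinant. Hoeffding's lemma bounds
the linear part by exp(2s²/(1+w)²), which the term -2s²/(1+w) cancels. A full power of the
determinant is spent where a Gaussian mixture would spend a square root; the radius has room for it.
-/
lemma selfNormalized_step {p w s : ℝ} (hp : p ∈ Set.Icc (0 : ℝ) 1) (hw : 0 ≤ w) :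
    p * Real.exp (2 * ((2 * (1 - p) * s + (1 - p) ^ 2 * w - s ^ 2) / (1 + w)) -
        2 * Real.log (1 + w)) +
      (1 - p) * Real.exp (2 * ((2 * (0 - p) * s + (0 - p) ^ 2 * w - s ^ 2) / (1 + w)) -
        2 * Real.log (1 + w)) ≤ 1 := by
  have hw1 : 0 < 1 + w := by linarith
  have hlog := div_one_add_le_log hw
  have hb : ∀ η : ℝ, η ^ 2 ≤ 1 →
      Real.exp (2 * ((2 * η * s + η ^ 2 * w - s ^ 2) / (1 + w)) - 2 * Real.log (1 + w)) ≤
        Real.exp (4 * s / (1 + w) * η) * Real.exp (-(2 * s ^ 2 / (1 + w))) := by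
    intro η hη
    rw [← Real.exp_add, Real.exp_le_exp]
    have h1 : 2 * ((2 * η * s + η ^ 2 * w - s ^ 2) / (1 + w)) =
        4 * s / (1 + w) * η + 2 * (η ^ 2 * (w / (1 + w))) - 2 * s ^ 2 / (1 + w) := by
      field_simp; ring
    have h2 : η ^ 2 * (w / (1 + w)) ≤ w / (1 + w) :=
      mul_le_of_le_one_left (by positivity) hη
    rw [h1]
    linarith
  have h1 := hb (1 - p) (by nlinarith [hp.1, hp.2])
  have h0 := hb (0 - p) (by nlinarith [hp.1, hp.2])
  have hH := bernoulli_mgf_le hp (4 * s / (1 + w))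
  have hs : (4 * s / (1 + w)) ^ 2 / 8 ≤ 2 * s ^ 2 / (1 + w) := by
    rw [div_pow, div_div, div_le_div_iff₀ (by positivity) hw1]
    have : 0 ≤ s ^ 2 * w * (1 + w) := by positivity
    nlinarith
  calc _ ≤ p * (Real.exp (4 * s / (1 + w) * (1 - p)) * Real.exp (-(2 * s ^ 2 / (1 + w)))) +
        (1 - p) * (Real.exp (4 * s / (1 + w) * (0 - p)) * Real.exp (-(2 * s ^ 2 / (1 + w)))) :=
        add_le_add (mul_le_mul_of_nonneg_left h1 hp.1)
          (mul_le_mul_of_nonneg_left h0 (by linarith [hp.2]))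
    _ = (p * Real.exp (4 * s / (1 + w) * (1 - p)) +
        (1 - p) * Real.exp (4 * s / (1 + w) * (0 - p))) * Real.exp (-(2 * s ^ 2 / (1 + w))) := by
        ring
    _ ≤ Real.exp (2 * s ^ 2 / (1 + w)) * Real.exp (-(2 * s ^ 2 / (1 + w))) := by
        refine mul_le_mul_of_nonneg_right (hH.trans ?_) (Real.exp_pos _).le
        exact Real.exp_le_exp.2 hs
    _ = 1 := by rw [← Real.exp_add, add_neg_cancel, Real.exp_zero]

/-- Given the nodes that precede `v`, the design vector is fixed and `v` is a Bernoulli variable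
with mean `condProb`, so `selfNormalized_step` applies. This is why all regressors must precede `v`.
The noise is centered at the true conditional probability, hence missing parents do no harm here. -/
lemma noisePotential_step {M : BLM n} {r : Node n → ℕ} (hr : IsCausalRank M r) (π : Policy n)
    (T₀ : ℕ) {A : Finset (Node n)} {v : Node n} (hA : ∀ u ∈ A, r u < r v) {t : ℕ}
    (h : Fin t → Outcome n) :
    ∑ x, doProb M.condProb (π t h) x * noisePotential M π T₀ A v (extend h x) ≤
      noisePotential M π T₀ A v h := by
  by_cases hc : T₀ ≤ t ∧ π t h v = none
  swap
  · simp only [noisePotential, gram_extend, noiseSum_extend, if_neg hc]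
    rw [← Finset.sum_mul, sum_doProb_condProb, one_mul]
  set B := gram π T₀ A v h with hB
  set S := noiseSum M π T₀ A v h with hS
  have hpd : B.PosDef := posDef_gram π T₀ A v h
  set w : Outcome n → ℝ := fun x => designVec A x ⬝ᵥ (B⁻¹ *ᵥ designVec A x) with hw
  set s : Outcome n → ℝ := fun x => designVec A x ⬝ᵥ (B⁻¹ *ᵥ S) with hs
  set η : Outcome n → ℝ := fun x => val (x v) - M.condProb v x with hη
  set G : Outcome n → ℝ := fun x => Real.exp (2 * ((2 * η x * s x + η x ^ 2 * w x - s x ^ 2) /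
    (1 + w x)) - 2 * Real.log (1 + w x)) with hG
  have hw0 : ∀ x, 0 ≤ w x := fun x => quad_nonneg hpd.inv _
  have hfac : ∀ x, noisePotential M π T₀ A v (extend h x) = noisePotential M π T₀ A v h * G x := by
    intro x
    have h1 : (1 + w x) ≠ 0 := by linarith [hw0 x]
    simp only [noisePotential, gram_extend, noiseSum_extend, if_pos hc]
    rw [← hB, ← hS, det_update1 hpd, quad_inv_update1 hpd, Real.log_mul hpd.det_pos.ne' h1,
      ← Real.exp_add]
    congr 1
    simp only [hw, hs, hη]
    ring
  have hdes : ∀ (u : Node n) (b : Bool) (x : Outcome n), ¬ r u < r v →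
      designVec A (Function.update x u b) = designVec A x := by
    intro u b x hu
    funext y
    have : y.val ≠ u := by rintro rfl; exact hu (hA _ y.2)
    simp [designVec, this]
  have hcond : ∀ (b : Bool) (x : Outcome n),
      M.condProb v (Function.update x v b) = M.condProb v x := by
    intro b x
    refine hr.dependsBelow v _ _ fun u hu => ?_
    have : u ≠ v := by rintro rfl; exact lt_irrefl _ hu
    simp [this]
  have hign : ∀ u, u ≠ v → ¬ r u < r v → Ignores u G := by
    intro u huv hu x
    have h1 : designVec A (flipAt u x) = designVec A x := hdes u _ x hu
    have h2 := hr.dependsBelow.ignores hu x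
    simp only [hG, hη, hw, hs, h1, h2, flipAt_of_ne huv.symm]
  calc ∑ x, doProb M.condProb (π t h) x * noisePotential M π T₀ A v (extend h x)
      = noisePotential M π T₀ A v h * ∑ x, doProb M.condProb (π t h) x * G x := by
        rw [Finset.mul_sum]
        exact Finset.sum_congr rfl fun x _ => by rw [hfac]; ring
    _ ≤ noisePotential M π T₀ A v h * 1 := by
        refine mul_le_mul_of_nonneg_left ?_ (Real.exp_pos _).le
        rw [sum_doProb_mul_eq hr.dependsBelow hc.2 hign]
        refine (Finset.sum_le_sum fun x _ => ?_).trans_eq (sum_doProb_condProb M (π t h))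
        refine
          mul_le_of_le_one_right (doProb_nonneg M.condProb_mem_Icc _ _) ?_
        have := selfNormalized_step (s := s x) (M.condProb_mem_Icc v x) (hw0 x)
        simpa only [hG, hη, hw, hs, hdes v _ x (lt_irrefl _), hcond, Function.update_self, val,
          if_true, Bool.false_eq_true, if_false] using this
    _ = noisePotential M π T₀ A v h := mul_one _

/-- The regression noise is controlled with high probability, for every set of regressors that is
determined by the first `T₀` rounds. -/
lemma trajPr_noisePotential_le {M : BLM n} {r : Node n → ℕ} (hr : IsCausalRank M r) (π : Policy n)
    (T₀ : ℕ) (v : Node n) (A : ∀ t, (Fin t → Outcome n) → Finset (Node n))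
    (hA : ∀ t h, ∀ u ∈ A t h, r u < r v)
    (hA' : ∀ t, T₀ ≤ t → ∀ h x, A (t + 1) (extend h x) = A t h) {t T : ℕ} (ht : t ≤ T) {c : ℝ}
    (hc : 0 < c) :
    trajPr M π T (fun ω => c ≤ noisePotential M π T₀ (A t (pre ht ω)) v (pre ht ω)) ≤ 1 / c := by
  -- Up to `T₀` the regression has no data and the potential is 1 for every regressor set, so the
  -- set may still change with the history.
  have hone : ∀ s ≤ T₀, ∀ (A : Finset (Node n)) (h : Fin s → Outcome n),
      noisePotential M π T₀ A v h = 1 := by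
    intro s hs A h
    rw [noisePotential, gram_eq_one π hs, noiseSum_eq_zero M π hs]
    simp
  refine trajPr_le_of_supermartingale M π (fun t h => noisePotential M π T₀ (A t h) v h) ht
    (fun s _ h => ?_) (hone 0 (Nat.zero_le _) _ _).le (fun h => (Real.exp_pos _).le) hc
  by_cases hs : T₀ ≤ s
  · simp only [hA' s hs]
    exact noisePotential_step hr π T₀ (hA s h) h
  · rw [hone s (by omega)]
    simp only [hone (s + 1) (by omega), mul_one]
    rw [sum_doProb_condProb]

/-! ### Concentration of bounded functions and of the observed values -/

/-- A multiplicative lower-tail bound for the sum of a `[0,1]`-valued function over the rounds in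
which `v` is not intervened. -/
lemma trajPr_condExp_sub_le (M : BLM n) (π : Policy n) (T₀ : ℕ) (v : Node n) {g : Outcome n → ℝ}
    (hg : ∀ x, g x ∈ Set.Icc (0 : ℝ) 1) {t T : ℕ} (ht : t ≤ T) (lam : ℝ) :
    trajPr M π T (fun ω => lam ≤ ∑ s : Fin t,
      if T₀ ≤ s.val ∧ π s (past (pre ht ω) s) v = none then
        condExp M π (past (pre ht ω) s) g / 2 - g (pre ht ω s) else 0) ≤ Real.exp (-lam) := by
  have h := trajPr_le_of_supermartingale M π (fun t h => Real.exp (∑ s : Fin t,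
    if T₀ ≤ s.val ∧ π s (past h s) v = none then
      condExp M π (past h s) g / 2 - g (h s) else 0)) ht (fun s _ h => ?_) (by simp)
    (fun h => (Real.exp_pos _).le) (Real.exp_pos lam)
  · simp only [Real.exp_le_exp] at h
    rwa [one_div, ← Real.exp_neg] at h
  · simp only [Fin.sum_univ_castSucc, extend_castSucc, past_extend_castSucc, extend_last,
      past_extend_last, Fin.val_castSucc, Fin.val_last, Real.exp_add]
    have h1 : ∀ (E : ℝ) (f : Outcome n → ℝ), 0 ≤ E →
        ∑ x, doProb M.condProb (π s h) x * f x ≤ 1 →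
        ∑ x, doProb M.condProb (π s h) x * (E * f x) ≤ E := by
      intro E f hE hf
      calc ∑ x, doProb M.condProb (π s h) x * (E * f x)
          = E * ∑ x, doProb M.condProb (π s h) x * f x := by
            rw [Finset.mul_sum]; exact Finset.sum_congr rfl fun x _ => by ring
        _ ≤ E * 1 := mul_le_mul_of_nonneg_left hf hE
        _ = E := mul_one E
    refine h1 _ _ (Real.exp_pos _).le ?_
    by_cases hc : T₀ ≤ s ∧ π s h v = none
    · simp only [if_pos hc]
      exact exp_half_sub_mean_le Finset.univ _ g
        (fun x _ => doProb_nonneg M.condProb_mem_Icc _ x) (sum_doProb_condProb M _)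
        fun x _ => hg x
    · simp only [if_neg hc, Real.exp_zero, mul_one]
      rw [sum_doProb_condProb]

/-- A Hoeffding bound for a weighted sum of the values of `j`. -/
lemma trajPr_val_sub_mean_le (M : BLM n) (π : Policy n) (j : Node n) (c : ℕ → ℝ) (T : ℕ)
    (lam : ℝ) :
    trajPr M π T (fun ω => lam ≤ ∑ s : Fin T,
      (c s * (val (ω s j) - M.mean (π s (past ω s)) j) - c s ^ 2 / 8)) ≤ Real.exp (-lam) := by
  have h := trajPr_le_of_supermartingale M π (fun t h => Real.exp (∑ s : Fin t,
    (c s * (val (h s j) - M.mean (π s (past h s)) j) - c s ^ 2 / 8))) le_rfl (fun s _ h => ?_)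
    (by simp) (fun h => (Real.exp_pos _).le) (Real.exp_pos lam) (T := T)
  · simp only [Real.exp_le_exp] at h
    rwa [one_div, ← Real.exp_neg] at h
  · simp only [Fin.sum_univ_castSucc, extend_castSucc, past_extend_castSucc, extend_last,
      past_extend_last, Fin.val_castSucc, Fin.val_last]
    set E := ∑ u : Fin s, (c u * (val (h u j) - M.mean (π u (past h u)) j) - c u ^ 2 / 8)
    set m := M.mean (π s h) j with hm
    have hmI : m ∈ Set.Icc (0 : ℝ) 1 := by
      obtain ⟨r, hr⟩ := M.exists_isCausalRank
      exact hr.mean_mem_Icc _ _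
    have h1 : ∀ x : Outcome n, Real.exp (E + (c s * (val (x j) - m) - c s ^ 2 / 8)) =
        Real.exp E * Real.exp (-(c s ^ 2 / 8)) * (val (x j) * Real.exp (c s * (1 - m)) +
          (1 - val (x j)) * Real.exp (c s * (0 - m))) := by
      intro x
      rw [sub_eq_add_neg (c s * _), Real.exp_add, Real.exp_add]
      cases x j <;> simp [val] <;> ring
    calc ∑ x, doProb M.condProb (π s h) x * Real.exp (E + (c s * (val (x j) - m) - c s ^ 2 / 8))
        = Real.exp E * Real.exp (-(c s ^ 2 / 8)) *
            ∑ x, (doProb M.condProb (π s h) x * val (x j) * Real.exp (c s * (1 - m)) +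
            (doProb M.condProb (π s h) x - doProb M.condProb (π s h) x * val (x j)) *
              Real.exp (c s * (0 - m))) := by
          rw [Finset.mul_sum]
          exact Finset.sum_congr rfl fun x _ => by rw [h1]; ring
      _ = Real.exp E * Real.exp (-(c s ^ 2 / 8)) *
            (m * Real.exp (c s * (1 - m)) + (1 - m) * Real.exp (c s * (0 - m))) := by
          rw [Finset.sum_add_distrib, ← Finset.sum_mul, ← Finset.sum_mul, Finset.sum_sub_distrib,
            sum_doProb_condProb]
          rfl
      _ ≤ Real.exp E * Real.exp (-(c s ^ 2 / 8)) * Real.exp (c s ^ 2 / 8) :=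
          mul_le_mul_of_nonneg_left (bernoulli_mgf_le hmI _) (by positivity)
      _ = Real.exp E := by rw [mul_assoc, ← Real.exp_add]; simp

/-! ### Ancestor detection -/

lemma initAction_eq_atomic {N : ℕ} {i : Node n} {t : ℕ} (h : t / N / 2 + 1 = i.val) :
    initAction n N t = atomic i (decide (t / N % 2 = 0)) := by
  funext v
  simp only [initAction, atomic, h, Function.update_apply, nullAction, Fin.ext_iff]

lemma node_val_bounds {i : Node n} (hi : i ≠ root n) (hi' : i ≠ target n) :
    1 ≤ i.val ∧ i.val + 1 ≤ n := by
  have h1 : i.val ≠ 0 := fun h => hi (Fin.ext h)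
  have h2 : i.val ≠ n := fun h => hi' (Fin.ext h)
  have := i.isLt
  omega

lemma two_mul_add_lt {i : Node n} (hi : i ≠ root n) (hi' : i ≠ target n) {N k e : ℕ} (hk : k < N)
    (he : e ≤ 1) : (2 * (i.val - 1) + e) * N + k < 2 * (n - 1) * N := by
  have := node_val_bounds hi hi'
  have h1 : 2 * (i.val - 1) + e + 1 ≤ 2 * (n - 1) := by omega
  calc (2 * (i.val - 1) + e) * N + k < (2 * (i.val - 1) + e + 1) * N := by
        rw [add_mul _ 1, one_mul]; omega
    _ ≤ 2 * (n - 1) * N := Nat.mul_le_mul_right N h1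

lemma initAction_block {i : Node n} (hi : i ≠ root n) (hi' : i ≠ target n) {N k e : ℕ} (hk : k < N)
    (he : e ≤ 1) :
    initAction n N ((2 * (i.val - 1) + e) * N + k) = atomic i (decide (e = 0)) := by
  have := node_val_bounds hi hi'
  have hN : 0 < N := by omega
  have h1 : ((2 * (i.val - 1) + e) * N + k) / N = 2 * (i.val - 1) + e := by
    rw [mul_comm, Nat.mul_add_div hN, Nat.div_eq_of_lt hk, add_zero]
  rw [initAction_eq_atomic (i := i) (by rw [h1]; omega), h1]
  congr 2
  simp only [eq_iff_iff]
  omega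

/-- The effect of `do(i = 1)` instead of `do(i = 0)` on the probability that `j = 1`. -/
def BLM.effect (M : BLM n) (i j : Node n) : ℝ :=
  M.mean (atomic i true) j - M.mean (atomic i false) j

lemma obs_pre {t T : ℕ} (ht : t ≤ T) (ω : Fin T → Outcome n) {s : ℕ} (hs : s < t) (v : Node n) :
    obs (pre ht ω) s v = obs ω s v := by
  simp only [obs, dif_pos hs, dif_pos (hs.trans_le ht)]
  rfl

/-- The signed indicator of the two blocks of rounds in which the node with value `i` is set. -/
def blockSign (N i : ℕ) (s : ℕ) : ℝ :=
  (if s ∈ Finset.Ico (2 * (i - 1) * N) (2 * (i - 1) * N + N) then 1 else 0) -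
    if s ∈ Finset.Ico ((2 * (i - 1) + 1) * N) ((2 * (i - 1) + 1) * N + N) then 1 else 0

lemma sum_block_eq {N T p : ℕ} (hp : p + N ≤ T) (F : ℕ → ℝ) :
    ∑ s ∈ Finset.range T, (if s ∈ Finset.Ico p (p + N) then 1 else 0) * F s =
      ∑ k ∈ Finset.range N, F (p + k) := by
  simp only [ite_mul, one_mul, zero_mul, Finset.sum_ite_mem]
  rw [Finset.inter_eq_right.2, Finset.sum_Ico_eq_sum_range]
  · simp
  · intro s hs
    rw [Finset.mem_Ico] at hs
    rw [Finset.mem_range]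
    omega

/-- The two blocks contain 2N rounds with coefficients ±μ, so the compensators μ²/8 of Hoeffding's
lemma add up to Nμ²/4. -/
lemma sum_blockSign_eq (M : BLM n) {π : Policy n} {N T : ℕ}
    (hπ : ∀ t, t < T → t < 2 * (n - 1) * N → ∀ h : Fin t → Outcome n, π t h = initAction n N t)
    (hT : 2 * (n - 1) * N ≤ T) {i : Node n} (hi : i ≠ root n) (hi' : i ≠ target n) (j : Node n)
    (μ : ℝ) (ω : Fin T → Outcome n) :
    ∑ s : Fin T, (μ * blockSign N i s * (val (ω s j) - M.mean (π s (past ω s)) j) -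
      (μ * blockSign N i s) ^ 2 / 8) =
      μ * (effectSum N ω i j - N * M.effect i j) - N * μ ^ 2 / 4 := by
  set p := 2 * (i.val - 1) * N with hp
  have hp' : (2 * (i.val - 1) + 1) * N = p + N := by rw [hp]; ring
  have hpN : p + N + N ≤ T := by
    have := node_val_bounds hi hi'
    refine le_trans ?_ hT
    calc p + N + N = (2 * (i.val - 1) + 2) * N := by rw [hp]; ring
      _ ≤ 2 * (n - 1) * N := Nat.mul_le_mul_right N (by omega)
  set F : ℕ → ℝ := fun s => if hs : s < T then
    val (ω ⟨s, hs⟩ j) - M.mean (π s (past ω ⟨s, hs⟩)) j else 0 with hF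
  have hFs : ∀ s : Fin T, val (ω s j) - M.mean (π s (past ω s)) j = F s := by
    intro s; simp only [hF, s.isLt, dif_pos]
  simp only [hFs]
  rw [Fin.sum_univ_eq_sum_range (fun s => μ * blockSign N i s * F s - (μ * blockSign N i s) ^ 2 / 8)]
  have hpt : ∀ s, μ * blockSign N i s * F s - (μ * blockSign N i s) ^ 2 / 8 =
      (if s ∈ Finset.Ico p (p + N) then 1 else 0) * (μ * F s - μ ^ 2 / 8) +
        (if s ∈ Finset.Ico (p + N) (p + N + N) then 1 else 0) * (-(μ * F s) - μ ^ 2 / 8) := by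
    intro s
    simp only [blockSign, hp', ← hp, Finset.mem_Ico]
    by_cases h1 : p ≤ s ∧ s < p + N
    · have h2 : ¬ (p + N ≤ s ∧ s < p + N + N) := by omega
      simp only [h1, h2, and_self, if_true, if_false]; ring
    · by_cases h2 : p + N ≤ s ∧ s < p + N + N
      · simp only [h1, h2, and_self, if_true, if_false]; ring
      · simp only [h1, h2, if_false]; ring
  rw [Finset.sum_congr rfl fun s _ => hpt s, Finset.sum_add_distrib, sum_block_eq (by omega),
    sum_block_eq hpN]
  have hF1 : ∀ k ∈ Finset.range N, F (p + k) = obs ω (p + k) j - M.mean (atomic i true) j := by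
    intro k hk
    rw [Finset.mem_range] at hk
    have h1 : p + k < T := by omega
    have h2 := initAction_block hi hi' hk (Nat.zero_le 1)
    rw [add_zero, ← hp] at h2
    have h3 := two_mul_add_lt hi hi' hk (Nat.zero_le 1)
    rw [add_zero, ← hp] at h3
    simp only [hF, obs, h1, dif_pos]
    rw [hπ _ h1 h3, h2]
    simp
  have hF0 : ∀ k ∈ Finset.range N, F (p + N + k) =
      obs ω (p + N + k) j - M.mean (atomic i false) j := by
    intro k hk
    rw [Finset.mem_range] at hk
    have h1 : p + N + k < T := by omega
    have h2 := initAction_block hi hi' hk le_rfl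
    rw [hp'] at h2
    have h3 := two_mul_add_lt hi hi' hk le_rfl
    rw [hp'] at h3
    simp only [hF, obs, h1, dif_pos]
    rw [hπ _ h1 h3, h2]
    simp
  rw [← Finset.sum_add_distrib, effectSum, hp', ← hp]
  have : ∀ k ∈ Finset.range N, (μ * F (p + k) - μ ^ 2 / 8) + (-(μ * F (p + N + k)) - μ ^ 2 / 8) =
      μ * (obs ω (p + k) j - obs ω (p + N + k) j) - (μ * M.effect i j + μ ^ 2 / 4) := by
    intro k hk
    rw [hF1 k hk, hF0 k hk, BLM.effect]
    ring
  rw [Finset.sum_congr rfl this, Finset.sum_sub_distrib, ← Finset.mul_sum]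
  simp only [Finset.sum_const, Finset.card_range, nsmul_eq_mul]
  ring

/-- A Hoeffding bound for the effect sums of the initialization phase. -/
lemma trajPr_effectSum_le (M : BLM n) {π : Policy n} {N T : ℕ}
    (hπ : ∀ t, t < T → t < 2 * (n - 1) * N → ∀ h : Fin t → Outcome n, π t h = initAction n N t)
    (hT : 2 * (n - 1) * N ≤ T) {i : Node n} (hi : i ≠ root n) (hi' : i ≠ target n) (j : Node n)
    (μ lam : ℝ) :
    trajPr M π T (fun ω => lam ≤ μ * (effectSum N ω i j - N * M.effect i j) - N * μ ^ 2 / 4) ≤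
      Real.exp (-lam) := by
  refine (trajPr_mono M π fun ω hω => ?_).trans
    (trajPr_val_sub_mean_le M π j (fun s => μ * blockSign N i s) T lam)
  rwa [sum_blockSign_eq M hπ hT hi hi' j μ ω]

/-! ### The estimated ancestors -/

section Estimated

variable {c₀ c₁ : ℝ} {T : ℕ}

lemma effectSum_pre {t T' : ℕ} (ht : t ≤ T') {N : ℕ} (hN : 2 * (n - 1) * N ≤ t)
    (ω : Fin T' → Outcome n) {i : Node n} (hi : i ≠ root n) (hi' : i ≠ target n) (j : Node n) :
    effectSum N (pre ht ω) i j = effectSum N ω i j := by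
  refine Finset.sum_congr rfl fun k hk => ?_
  rw [Finset.mem_range] at hk
  have h0 := two_mul_add_lt hi hi' hk (Nat.zero_le 1)
  have h1 := two_mul_add_lt hi hi' hk le_rfl
  rw [add_zero] at h0
  rw [obs_pre ht ω (by omega), obs_pre ht ω (by omega)]

lemma detected_pre {t T' : ℕ} (ht : t ≤ T') (hN : initLength n c₀ T ≤ t) (ω : Fin T' → Outcome n) :
    Detected c₀ c₁ T (pre ht ω) = Detected c₀ c₁ T ω := by
  funext i j
  simp only [Detected, eq_iff_iff]
  constructor
  · rintro ⟨h1, h2, h3, h4, h5, h6⟩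
    exact ⟨h1, h2, h3, h4, h5, by rwa [effectSum_pre ht hN ω h2 h3] at h6⟩
  · rintro ⟨h1, h2, h3, h4, h5, h6⟩
    exact ⟨h1, h2, h3, h4, h5, by rwa [effectSum_pre ht hN ω h2 h3]⟩

/-- The tests read only the initial rounds, so the estimated graph is frozen from then on and each
node has a single regression with growing data. -/
lemma ancHat_pre {t T' : ℕ} (ht : t ≤ T') (hN : initLength n c₀ T ≤ t) (ω : Fin T' → Outcome n)
    (v : Node n) : ancHat c₀ c₁ T (pre ht ω) v = ancHat c₀ c₁ T ω v := by
  unfold ancHat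
  rw [detected_pre ht hN]

lemma card_ancHat_le {t : ℕ} (hn : 1 ≤ n) (h : Fin t → Outcome n) (v : Node n) :
    (ancHat c₀ c₁ T h v).card ≤ n := by
  classical
  have hsub : ancHat c₀ c₁ T h v ⊆ Finset.univ.erase (target n) := by
    intro u hu
    rw [Finset.mem_erase]
    refine ⟨?_, Finset.mem_univ _⟩
    rintro rfl
    simp only [ancHat] at hu
    have hrt : target n ≠ root n := by
      intro h
      have := congrArg Fin.val h
      simp at this
      omega
    split_ifs at hu with h1 h2
    · simp at hu
    · simp at hu
    · simp only [Finset.mem_filter, Finset.mem_univ, true_and, hrt, false_or] at hu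
      have : ∀ w, ¬ Relation.TransGen (Detected c₀ c₁ T h) (target n) w := by
        intro w hw
        induction hw with
        | single h' => exact h'.2.2.1 rfl
        | tail _ _ ih => exact ih
      exact this _ hu
  refine (Finset.card_le_card hsub).trans ?_
  rw [Finset.card_erase_of_mem (Finset.mem_univ _), Finset.card_univ, Fintype.card_fin]
  simp

/-- Compatibility with one causal order passes to the transitive closure. A detected pair need not
consist of a true ancestor and its descendant: superfluous regressors that come earlier have true
weight 0. -/
lemma lt_of_mem_ancHat {M : BLM n} {r : Node n → ℕ} (hr : IsCausalRank M r) {t : ℕ}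
    {h : Fin t → Outcome n} (hdet : ∀ i j, Detected c₀ c₁ T h i j → r i < r j) {u v : Node n}
    (hu : u ∈ ancHat c₀ c₁ T h v) : r u < r v := by
  classical
  simp only [ancHat] at hu
  split_ifs at hu with h1 h2
  · subst h1
    simp only [Finset.mem_filter, Finset.mem_univ, true_and] at hu
    exact hr.lt_target u hu
  · simp at hu
  · simp only [Finset.mem_filter, Finset.mem_univ, true_and] at hu
    rcases hu with rfl | hu
    · exact hr.lt_of_mem_pa _ _ (M.root_mem v h2)
    · clear h1 h2
      induction hu with
      | single h' => exact hdet _ _ h'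
      | tail _ h' ih => exact ih.trans (hdet _ _ h')

lemma acyclic_of_rank {A : Node n → Finset (Node n)} {r : Node n → ℕ}
    (h : ∀ v, ∀ u ∈ A v, r u < r v) : Acyclic A := by
  intro v hv
  have : ∀ u w, Relation.TransGen (fun u w => u ∈ A w) u w → r u < r w := by
    intro u w huw
    induction huw with
    | single h' => exact h _ _ h'
    | tail _ h' ih => exact ih.trans (h _ _ h')
  exact lt_irrefl _ (this v v hv)

/-- A parent that is missing from the estimated ancestors was not detected. -/
lemma not_detected_of_notMem {M : BLM n} {t : ℕ} {h : Fin t → Outcome n} {u v : Node n}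
    (hv : v ≠ root n) (hu : u ∈ M.pa v) (hu' : u ∉ ancHat c₀ c₁ T h v) :
    u ≠ root n ∧ v ≠ target n ∧ ¬ Detected c₀ c₁ T h u v := by
  classical
  have hut : u ≠ target n := fun h => M.target_notMem v (h ▸ hu)
  have hvt : v ≠ target n := by
    rintro rfl
    exact hu' (by simp [ancHat, hut])
  simp only [ancHat, if_neg hvt, if_neg hv, Finset.mem_filter, Finset.mem_univ, true_and,
    not_or] at hu'
  exact ⟨hu'.1, hvt, fun hd => hu'.2 (Relation.TransGen.single hd)⟩

end Estimated

/-! ### The good event -/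

lemma rpow_two_thirds (T : ℕ) : (T : ℝ) ^ (2 / 3 : ℝ) = ((T : ℝ) ^ (1 / 3 : ℝ)) ^ 2 := by
  rw [← Real.rpow_natCast, ← Real.rpow_mul (Nat.cast_nonneg T)]
  norm_num

lemma rpow_one_third_pow (T : ℕ) : ((T : ℝ) ^ (1 / 3 : ℝ)) ^ 3 = T := by
  rw [← Real.rpow_natCast, ← Real.rpow_mul (Nat.cast_nonneg T)]
  norm_num

/-- The function `min 1 |z · x|` of an outcome `x`. -/
def capLin (z : Node n → ℝ) (x : Outcome n) : ℝ := min 1 |∑ u, z u * val (x u)|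

lemma capLin_mem_Icc (z : Node n → ℝ) (x : Outcome n) : capLin z x ∈ Set.Icc (0 : ℝ) 1 :=
  ⟨le_min zero_le_one (abs_nonneg _), min_le_left _ _⟩

/-- The point of a grid in the cube `[-1,1]^n` with the index `ζ`. -/
def gridPoint (m : ℕ) (ζ : Node n → Fin (2 * m + 1)) : Node n → ℝ := fun u => (ζ u : ℝ) / m - 1

/-- The deviation of `capLin z` in the rounds before `t` in which `v` is not intervened. -/
def capDeviation {t : ℕ} (M : BLM n) (π : Policy n) (T₀ : ℕ) (v : Node n) (z : Node n → ℝ)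
    (h : Fin t → Outcome n) : ℝ :=
  ∑ s : Fin t, if T₀ ≤ s.val ∧ π s (past h s) v = none then
    condExp M π (past h s) (capLin z) / 2 - capLin z (h s) else 0

/-- The confidence level of the concentration bounds for the grid. -/
def gridLevel (n T m : ℕ) : ℝ := (n + 1) * Real.log (2 * m + 1) + 2 * Real.log T

/-- The runs on which the detection, the regressions and the empirical averages are accurate. -/
structure GoodRun (M : BLM n) (π : Policy n) (c₀ c₁ : ℝ) (T m : ℕ) (r : Node n → ℕ)
    (ω : Fin T → Outcome n) : Prop where
  rank_lt : ∀ i j, Detected c₀ c₁ T ω i j → r i < r j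
  θ_lt : ∀ j, j ≠ root n → j ≠ target n → ∀ i ∈ M.pa j, i ≠ root n → ¬ Detected c₀ c₁ T ω i j →
    M.θ i j < 4 * c₁ / (T : ℝ) ^ (1 / 3 : ℝ)
  noise_lt : ∀ (t : Fin T) (v : Node n), initLength n c₀ T ≤ t →
    noisePotential M π (initLength n c₀ T) (ancHat c₀ c₁ T ω v) v (past ω t) < (T : ℝ) ^ 2
  cap_lt : ∀ (t : Fin T) (v : Node n) (ζ : Node n → Fin (2 * m + 1)),
    capDeviation M π (initLength n c₀ T) v (gridPoint m ζ) (past ω t) < gridLevel n T m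

lemma exp_neg_two_mul_log {T : ℕ} (hT : 2 ≤ T) : Real.exp (-(2 * Real.log T)) = 1 / (T : ℝ) ^ 2 := by
  have hT0 : (0 : ℝ) < T := by positivity
  rw [Real.exp_neg, one_div, mul_comm, Real.exp_mul, Real.exp_log hT0]
  norm_num

lemma trajPr_of_not (M : BLM n) (π : Policy n) {T : ℕ} {E : (Fin T → Outcome n) → Prop}
    (h : ∀ ω, ¬ E ω) : trajPr M π T E = 0 := by
  simp [trajPr, trajExp, h]

lemma log_pos_of_two_le {T : ℕ} (hT : 2 ≤ T) : 0 < Real.log T :=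
  Real.log_pos (by exact_mod_cast hT)

section Detection

variable {c₀ c₁ : ℝ} {T : ℕ} {M : BLM n} {π : Policy n}

/-- The Hoeffding parameter is μ = 2c₁/s with s = T^{1/3}. The threshold 2c₀c₁s log T contributes
4c₀c₁² log T. Since rounding up at most doubles a number that is at least 1, the count is at most
2c₀s² log T, and the compensator is at most 2c₀c₁² log T. The difference is at least 2 log T, so
both kinds of test error have probability at most 1/T². -/
lemma detection_exponent (hc₁ : 0 < c₁) (hc : 1 ≤ c₀ * c₁ ^ 2) (hT : 2 ≤ T)
    (hx : 1 ≤ c₀ * (T : ℝ) ^ (2 / 3 : ℝ) * Real.log T) :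
    2 * Real.log T ≤ 2 * c₁ / (T : ℝ) ^ (1 / 3 : ℝ) *
      (c₀ * c₁ * (T : ℝ) ^ (1 / 3 : ℝ) * Real.log ((T : ℝ) ^ 2)) -
      initCount c₀ T * (2 * c₁ / (T : ℝ) ^ (1 / 3 : ℝ)) ^ 2 / 4 := by
  have hT0 : (0 : ℝ) < T := by positivity
  have hl := log_pos_of_two_le hT
  have hN : (initCount c₀ T : ℝ) ≤ 2 * (c₀ * (T : ℝ) ^ (2 / 3 : ℝ) * Real.log T) := by
    have := Nat.ceil_lt_add_one (show 0 ≤ c₀ * (T : ℝ) ^ (2 / 3 : ℝ) * Real.log T by linarith)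
    rw [initCount]
    linarith
  rw [rpow_two_thirds] at hN
  set s := (T : ℝ) ^ (1 / 3 : ℝ) with hs
  have hs0 : 0 < s := Real.rpow_pos_of_pos hT0 _
  rw [Real.log_pow]
  push_cast
  have h1 : (initCount c₀ T : ℝ) * (2 * c₁ / s) ^ 2 / 4 ≤
      2 * (c₀ * s ^ 2 * Real.log T) * (2 * c₁ / s) ^ 2 / 4 := by gcongr
  have h2 : 2 * (c₀ * s ^ 2 * Real.log T) * (2 * c₁ / s) ^ 2 / 4 =
      2 * (c₀ * c₁ ^ 2) * Real.log T := by field_simp; ring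
  have h3 : 2 * c₁ / s * (c₀ * c₁ * s * (2 * Real.log T)) = 4 * (c₀ * c₁ ^ 2) * Real.log T := by
    field_simp; ring
  nlinarith

lemma trajPr_detected_le {r : Node n → ℕ} (hr : IsCausalRank M r) (hc₁ : 0 < c₁)
    (hc : 1 ≤ c₀ * c₁ ^ 2) (hT : 2 ≤ T) (hx : 1 ≤ c₀ * (T : ℝ) ^ (2 / 3 : ℝ) * Real.log T)
    (hπ : ∀ t, t < T → t < initLength n c₀ T → ∀ h : Fin t → Outcome n,
      π t h = initAction n (initCount c₀ T) t) (hT₀ : initLength n c₀ T ≤ T) (i j : Node n)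
    (hij : ¬ r i < r j) :
    trajPr M π T (fun ω => Detected c₀ c₁ T ω i j) ≤ 1 / (T : ℝ) ^ 2 := by
  by_cases hd : i ≠ j ∧ i ≠ root n ∧ i ≠ target n
  swap
  · rw [trajPr_of_not]
    · positivity
    · exact fun ω h => hd ⟨h.1, h.2.1, h.2.2.1⟩
  have heff : M.effect i j = 0 := by
    rw [BLM.effect, hr.mean_atomic_eq hd.2.1 hd.1.symm hij, sub_self]
  have h := trajPr_effectSum_le M hπ hT₀ hd.2.1 hd.2.2 j (2 * c₁ / (T : ℝ) ^ (1 / 3 : ℝ))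
    (2 * Real.log T)
  rw [exp_neg_two_mul_log hT] at h
  refine (trajPr_mono M π fun ω hω => ?_).trans h
  rw [heff, mul_zero, sub_zero]
  have hT0 : (0 : ℝ) < T := by positivity
  have hs0 : 0 < (T : ℝ) ^ (1 / 3 : ℝ) := Real.rpow_pos_of_pos hT0 _
  refine (detection_exponent hc₁ hc hT hx).trans ?_
  have := mul_le_mul_of_nonneg_left hω.2.2.2.2.2.le
    (show 0 ≤ 2 * c₁ / (T : ℝ) ^ (1 / 3 : ℝ) by positivity)
  linarith

/-- A weight of 4c₁/T^{1/3} makes the expected effect sum at least twice the threshold. A missed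
detection is then a downward deviation by a full threshold, with the same exponent as a false one.
-/
lemma trajPr_not_detected_le {r : Node n → ℕ} (hr : IsCausalRank M r) (hc₁ : 0 < c₁)
    (hc : 1 ≤ c₀ * c₁ ^ 2) (hT : 2 ≤ T) (hx : 1 ≤ c₀ * (T : ℝ) ^ (2 / 3 : ℝ) * Real.log T)
    (hπ : ∀ t, t < T → t < initLength n c₀ T → ∀ h : Fin t → Outcome n,
      π t h = initAction n (initCount c₀ T) t) (hT₀ : initLength n c₀ T ≤ T) (i j : Node n)
    (hi : i ≠ root n) (hj : j ≠ root n) (hj' : j ≠ target n) (hij : i ∈ M.pa j)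
    (hθ : 4 * c₁ / (T : ℝ) ^ (1 / 3 : ℝ) ≤ M.θ i j) :
    trajPr M π T (fun ω => ¬ Detected c₀ c₁ T ω i j) ≤ 1 / (T : ℝ) ^ 2 := by
  have hne : i ≠ j := by rintro rfl; exact hr.notMem_pa_self _ hij
  have hi' : i ≠ target n := fun h => M.target_notMem j (h ▸ hij)
  have heff := hθ.trans (hr.θ_le_mean_sub hi hj hij)
  change _ ≤ M.effect i j at heff
  have h := trajPr_effectSum_le M hπ hT₀ hi hi' j (-(2 * c₁ / (T : ℝ) ^ (1 / 3 : ℝ)))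
    (2 * Real.log T)
  rw [exp_neg_two_mul_log hT] at h
  refine (trajPr_mono M π fun ω hω => ?_).trans h
  have hle : effectSum (initCount c₀ T) ω i j ≤
      c₀ * c₁ * (T : ℝ) ^ (1 / 3 : ℝ) * Real.log ((T : ℝ) ^ 2) := by
    by_contra hlt
    exact hω ⟨hne, hi, hi', hj, hj', not_le.1 hlt⟩
  refine (detection_exponent hc₁ hc hT hx).trans ?_
  have hT0 : (0 : ℝ) < T := by positivity
  have hl := log_pos_of_two_le hT
  have hN : c₀ * (T : ℝ) ^ (2 / 3 : ℝ) * Real.log T ≤ initCount c₀ T := Nat.le_ceil _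
  rw [rpow_two_thirds] at hN
  rw [Real.log_pow] at hle ⊢
  push_cast at hle ⊢
  set s := (T : ℝ) ^ (1 / 3 : ℝ) with hs
  have hs0 : 0 < s := Real.rpow_pos_of_pos hT0 _
  have hmean : 2 * (c₀ * c₁ * s * (2 * Real.log T)) ≤ initCount c₀ T * M.effect i j := by
    calc 2 * (c₀ * c₁ * s * (2 * Real.log T)) = c₀ * s ^ 2 * Real.log T * (4 * c₁ / s) := by
          field_simp; ring
      _ ≤ initCount c₀ T * (4 * c₁ / s) := by gcongr
      _ ≤ initCount c₀ T * M.effect i j := by gcongr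
  have hμ : 0 ≤ 2 * c₁ / s := by positivity
  have := mul_le_mul_of_nonneg_left
    (show c₀ * c₁ * s * (2 * Real.log T) ≤
      initCount c₀ T * M.effect i j - effectSum (initCount c₀ T) ω i j by linarith) hμ
  rw [neg_sq]
  linarith

end Detection

/-- The probability of a run that is not good. -/
lemma trajPr_not_goodRun_le {M : BLM n} {π : Policy n} {c₀ c₁ : ℝ} {T : ℕ} {r : Node n → ℕ}
    (hr : IsCausalRank M r) (hc₁ : 0 < c₁)
    (hc : 1 ≤ c₀ * c₁ ^ 2) (hT : 2 ≤ T) (hx : 1 ≤ c₀ * (T : ℝ) ^ (2 / 3 : ℝ) * Real.log T)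
    (hπ : ∀ t, t < T → t < initLength n c₀ T → ∀ h : Fin t → Outcome n,
      π t h = initAction n (initCount c₀ T) t) (hT₀ : initLength n c₀ T ≤ T) (m : ℕ) :
    trajPr M π T (fun ω => ¬ GoodRun M π c₀ c₁ T m r ω) ≤
      2 * (n + 1) ^ 2 / (T : ℝ) ^ 2 + 2 * (n + 1) / T := by
  classical
  have hT0 : (0 : ℝ) < T := by positivity
  set T₀ := initLength n c₀ T with hT₀def
  -- The filter makes the regressors precede `v` on every run, as the supermartingale requires.
  -- Where detection is correct it removes nothing.
  let A : Node n → ∀ t, (Fin t → Outcome n) → Finset (Node n) := fun v t h =>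
    (ancHat c₀ c₁ T h v).filter fun u => r u < r v
  let E1 : Node n × Node n → (Fin T → Outcome n) → Prop := fun p ω =>
    Detected c₀ c₁ T ω p.1 p.2 ∧ ¬ r p.1 < r p.2
  let E2 : Node n × Node n → (Fin T → Outcome n) → Prop := fun p ω =>
    (p.1 ≠ root n ∧ p.2 ≠ root n ∧ p.2 ≠ target n ∧ p.1 ∈ M.pa p.2 ∧
      4 * c₁ / (T : ℝ) ^ (1 / 3 : ℝ) ≤ M.θ p.1 p.2) ∧ ¬ Detected c₀ c₁ T ω p.1 p.2
  let E3 : Fin T × Node n → (Fin T → Outcome n) → Prop := fun p ω =>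
    (T : ℝ) ^ 2 ≤ noisePotential M π T₀ (A p.2 p.1 (past ω p.1)) p.2 (past ω p.1)
  let E4 : (Fin T × Node n) × (Node n → Fin (2 * m + 1)) → (Fin T → Outcome n) → Prop := fun p ω =>
    gridLevel n T m ≤ capDeviation M π T₀ p.1.2 (gridPoint m p.2) (past ω p.1.1)
  have hsub : ∀ ω, ¬ GoodRun M π c₀ c₁ T m r ω →
      ((∃ p ∈ Finset.univ, E1 p ω) ∨ (∃ p ∈ Finset.univ, E2 p ω)) ∨
      ((∃ p ∈ Finset.univ, E3 p ω) ∨ (∃ p ∈ Finset.univ, E4 p ω)) := by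
    intro ω hω
    by_contra hcon
    push Not at hcon
    obtain ⟨⟨h1, h2⟩, h3, h4⟩ := hcon
    have hrank : ∀ i j, Detected c₀ c₁ T ω i j → r i < r j := by
      intro i j hd
      by_contra hlt
      exact h1 (i, j) (Finset.mem_univ _) ⟨hd, hlt⟩
    refine hω ⟨hrank, ?_, ?_, ?_⟩
    · intro j hj hj' i hi hir hd
      by_contra hlt
      exact h2 (i, j) (Finset.mem_univ _) ⟨⟨hir, hj, hj', hi, not_lt.1 hlt⟩, hd⟩
    · intro t v ht
      have h5 : A v t (past ω t) = ancHat c₀ c₁ T ω v := by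
        have h6 : ancHat c₀ c₁ T (past ω t) v = ancHat c₀ c₁ T ω v := ancHat_pre t.isLt.le ht ω v
        simp only [A]
        rw [h6]
        exact Finset.filter_true_of_mem fun u hu => lt_of_mem_ancHat hr hrank hu
      have h7 := h3 (t, v) (Finset.mem_univ _)
      simp only [E3, not_le] at h7
      rwa [h5] at h7
    · intro t v ζ
      exact not_le.1 (h4 ((t, v), ζ) (Finset.mem_univ _))
  have p1 := trajPr_exists_le M π Finset.univ E1 (1 / (T : ℝ) ^ 2) (by
    rintro ⟨i, j⟩ -
    by_cases hij : r i < r j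
    · rw [trajPr_of_not M π fun ω hω => hω.2 hij]; positivity
    · exact (trajPr_mono M π fun ω hω => hω.1).trans
        (trajPr_detected_le hr hc₁ hc hT hx hπ hT₀ i j hij))
  have p2 := trajPr_exists_le M π Finset.univ E2 (1 / (T : ℝ) ^ 2) (by
    rintro ⟨i, j⟩ -
    by_cases hij : i ≠ root n ∧ j ≠ root n ∧ j ≠ target n ∧ i ∈ M.pa j ∧
      4 * c₁ / (T : ℝ) ^ (1 / 3 : ℝ) ≤ M.θ i j
    · exact (trajPr_mono M π fun ω hω => hω.2).trans
        (trajPr_not_detected_le hr hc₁ hc hT hx hπ hT₀ i j hij.1 hij.2.1 hij.2.2.1 hij.2.2.2.1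
          hij.2.2.2.2)
    · rw [trajPr_of_not M π fun ω hω => hij hω.1]; positivity)
  have p3 := trajPr_exists_le M π Finset.univ E3 (1 / (T : ℝ) ^ 2) (by
    rintro ⟨t, v⟩ -
    refine trajPr_noisePotential_le hr π T₀ v (A v) (fun t h u hu => (Finset.mem_filter.1 hu).2)
      (fun t ht h x => ?_) t.isLt.le (by positivity)
    have h6 := ancHat_pre (c₁ := c₁) t.le_succ ht (extend h x) v
    have h7 : pre t.le_succ (extend h x) = h := pre_extend le_rfl h x
    rw [h7] at h6
    simp only [A]
    rw [h6])
  have p4 := trajPr_exists_le M π Finset.univ E4 (Real.exp (-gridLevel n T m)) (by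
    rintro ⟨⟨t, v⟩, ζ⟩ -
    exact trajPr_condExp_sub_le M π T₀ v (capLin_mem_Icc _) t.isLt.le _)
  -- The level is chosen so that the union over all grid points costs exactly 1/T² for each round
  -- and node.
  have hexp : ((2 * m + 1 : ℕ) : ℝ) ^ (n + 1) * Real.exp (-gridLevel n T m) = 1 / (T : ℝ) ^ 2 := by
    have hm : (0 : ℝ) < 2 * m + 1 := by positivity
    rw [gridLevel, neg_add, Real.exp_add, exp_neg_two_mul_log hT]
    have : Real.exp (-(((n : ℝ) + 1) * Real.log (2 * m + 1))) =
        (((2 * m + 1 : ℕ) : ℝ) ^ (n + 1))⁻¹ := by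
      rw [Real.exp_neg, mul_comm, Real.exp_mul, Real.exp_log hm]
      congr 1
      rw [← Real.rpow_natCast]
      push_cast
      rfl
    rw [this]
    have h0 : ((2 * m + 1 : ℕ) : ℝ) ^ (n + 1) ≠ 0 := by positivity
    rw [← mul_assoc, mul_inv_cancel₀ h0, one_mul]
  simp only [Finset.card_univ, Fintype.card_prod, Fintype.card_fin, Fintype.card_pi,
    Finset.prod_const, Nat.cast_mul] at p1 p2 p3 p4
  rw [Nat.cast_pow, mul_assoc _ _ (Real.exp _), hexp] at p4
  push_cast at p1 p2 p3 p4
  refine (trajPr_mono M π hsub).trans ?_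
  refine (trajPr_or_le M π _ _).trans ?_
  have q1 := trajPr_or_le M π (fun ω => ∃ p ∈ Finset.univ, E1 p ω) fun ω => ∃ p ∈ Finset.univ, E2 p ω
  have q2 := trajPr_or_le M π (fun ω => ∃ p ∈ Finset.univ, E3 p ω) fun ω => ∃ p ∈ Finset.univ, E4 p ω
  have e1 : 2 * ((n : ℝ) + 1) ^ 2 / (T : ℝ) ^ 2 + 2 * (n + 1) / T =
      ((n + 1) * (n + 1) * (1 / (T : ℝ) ^ 2) + (n + 1) * (n + 1) * (1 / (T : ℝ) ^ 2)) +
      (T * (n + 1) * (1 / (T : ℝ) ^ 2) + T * (n + 1) * (1 / (T : ℝ) ^ 2)) := by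
    field_simp
    ring
  rw [e1]
  exact add_le_add (q1.trans (add_le_add p1 p2)) (q2.trans (add_le_add p3 p4))

/-! ### The regression target -/

/-- The weights of the edges into `v` that start in `A`. -/
def BLM.restrict (M : BLM n) (A : Finset (Node n)) (v : Node n) : A → ℝ :=
  fun u => if u.val ∈ M.pa v then M.θ u v else 0

lemma BLM.restrict_mem_Icc (M : BLM n) (A : Finset (Node n)) (v : Node n) (u : A) :
    M.restrict A v u ∈ Set.Icc (0 : ℝ) 1 := by
  rw [BLM.restrict]
  split_ifs with h
  · exact M.θ_mem v u h
  · simp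

lemma BLM.sum_restrict (M : BLM n) (A : Finset (Node n)) (v : Node n) (f : Node n → ℝ) :
    ∑ u : A, f u * M.restrict A v u = ∑ u ∈ M.pa v ∩ A, M.θ u v * f u := by
  classical
  refine (Finset.sum_coe_sort A fun u => f u * if u ∈ M.pa v then M.θ u v else 0).trans ?_
  simp only [mul_ite, mul_zero]
  rw [Finset.sum_ite_mem, Finset.inter_comm]
  exact Finset.sum_congr rfl fun u _ => mul_comm _ _

lemma BLM.restrict_dotProduct_self_le (M : BLM n) (A : Finset (Node n)) {v : Node n}
    (hv : v ≠ root n) : M.restrict A v ⬝ᵥ M.restrict A v ≤ 1 := by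
  have h1 : M.restrict A v ⬝ᵥ M.restrict A v ≤ ∑ u : A, 1 * M.restrict A v u :=
    Finset.sum_le_sum fun u _ => mul_le_mul_of_nonneg_right (M.restrict_mem_Icc A v u).2
      (M.restrict_mem_Icc A v u).1
  refine h1.trans ?_
  rw [M.sum_restrict A v fun _ => 1]
  refine le_trans ?_ (M.sum_θ_le_one hv)
  simp only [mul_one]
  exact Finset.sum_le_sum_of_subset_of_nonneg Finset.inter_subset_left
    fun u hu _ => (M.θ_mem v u hu).1

/-- The bias of the regression on `A`. -/
def BLM.bias (M : BLM n) (A : Finset (Node n)) (v : Node n) (x : Outcome n) : ℝ :=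
  M.condProb v x - designVec A x ⬝ᵥ M.restrict A v

lemma BLM.bias_mem_Icc (M : BLM n) {A : Finset (Node n)} {v : Node n} (hv : v ≠ root n) {κ : ℝ}
    (hκ : 0 ≤ κ) (hA : ∀ u ∈ M.pa v, u ∉ A → M.θ u v ≤ κ) (x : Outcome n) :
    M.bias A v x ∈ Set.Icc (0 : ℝ) (n * κ) := by
  classical
  have h : M.bias A v x = ∑ u ∈ M.pa v \ A, M.θ u v * val (x u) := by
    have h1 : designVec A x ⬝ᵥ M.restrict A v = ∑ u ∈ M.pa v ∩ A, M.θ u v * val (x u) :=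
      M.sum_restrict A v fun u => val (x u)
    rw [BLM.bias, M.condProb_eq hv, h1, ← Finset.sum_inter_add_sum_sdiff (M.pa v) A]
    ring
  rw [h]
  have hnn : ∀ u ∈ M.pa v \ A, 0 ≤ M.θ u v * val (x u) := fun u hu =>
    mul_nonneg (M.θ_mem v u (Finset.mem_sdiff.1 hu).1).1 (val_nonneg _)
  refine ⟨Finset.sum_nonneg hnn, ?_⟩
  have h2 : ∀ u ∈ M.pa v \ A, M.θ u v * val (x u) ≤ κ := fun u hu =>
    (mul_le_of_le_one_right (M.θ_mem v u (Finset.mem_sdiff.1 hu).1).1 (val_le_one _)).trans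
      (hA u (Finset.mem_sdiff.1 hu).1 (Finset.mem_sdiff.1 hu).2)
  refine (Finset.sum_le_card_nsmul _ _ _ h2).trans ?_
  rw [nsmul_eq_mul]
  refine mul_le_mul_of_nonneg_right ?_ hκ
  have hsub : M.pa v \ A ⊆ Finset.univ.erase (target n) := by
    intro u hu
    rw [Finset.mem_erase]
    exact ⟨fun h => M.target_notMem v (h ▸ (Finset.mem_sdiff.1 hu).1), Finset.mem_univ _⟩
  have := Finset.card_le_card hsub
  rw [Finset.card_erase_of_mem (Finset.mem_univ _), Finset.card_univ, Fintype.card_fin] at this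
  exact_mod_cast this

lemma sum_fin_ite_le (t T₀ : ℕ) (P : Fin t → Prop) [DecidablePred P] {c : ℝ} (hc : 0 ≤ c) :
    ∑ s : Fin t, (if T₀ ≤ s.val ∧ P s then c else 0) ≤ ((t - T₀ : ℕ) : ℝ) * c := by
  calc ∑ s : Fin t, (if T₀ ≤ s.val ∧ P s then c else 0)
      ≤ ∑ s : Fin t, (if T₀ ≤ s.val then c else 0) := by
        refine Finset.sum_le_sum fun s _ => ?_
        by_cases h1 : T₀ ≤ s.val
        · by_cases h2 : P s <;> simp [h1, h2, hc]
        · simp [h1]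
    _ = ∑ s ∈ Finset.range t, (if T₀ ≤ s then c else 0) :=
        Fin.sum_univ_eq_sum_range (fun s => if T₀ ≤ s then c else 0) t
    _ = ((t - T₀ : ℕ) : ℝ) * c := by
        rw [← Finset.sum_filter, Finset.sum_const, nsmul_eq_mul]
        congr 2
        rw [← Nat.card_Ico]
        congr 1
        ext s
        simp only [Finset.mem_filter, Finset.mem_range, Finset.mem_Ico]
        omega

/-- The distance of the regression estimate from the restricted weights. -/
lemma wnorm_estimate_sub_le (M : BLM n) (π : Policy n) (T₀ : ℕ) (A : Finset (Node n))
    {v : Node n} (hv : v ≠ root n) {ε : ℝ} (hε : 0 ≤ ε) (hb : ∀ x, M.bias A v x ∈ Set.Icc 0 ε)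
    {t : ℕ} (h : Fin t → Outcome n) :
    wnorm (gram π T₀ A v h) (estimate π T₀ A v h - M.restrict A v) ≤
      wnorm (gram π T₀ A v h)⁻¹ (noiseSum M π T₀ A v h) + ε * Real.sqrt (t - T₀ : ℕ) + 1 := by
  set B := gram π T₀ A v h with hB
  have hpd : B.PosDef := posDef_gram π T₀ A v h
  set θ' := M.restrict A v with hθ'
  set z := estimate π T₀ A v h - θ' with hz
  set S := noiseSum M π T₀ A v h with hS
  set act : Fin t → Prop := fun s => T₀ ≤ s.val ∧ π s (past h s) v = none with hact
  set β : ℝ := ∑ s : Fin t, if T₀ ≤ s.val ∧ π s (past h s) v = none then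
    M.bias A v (h s) * (designVec A (h s) ⬝ᵥ z) else 0 with hβ
  have hquad : ∀ y : A → ℝ, y ⬝ᵥ (B *ᵥ y) = y ⬝ᵥ y + ∑ s : Fin t,
      if T₀ ≤ s.val ∧ π s (past h s) v = none then (designVec A (h s) ⬝ᵥ y) ^ 2 else 0 := by
    intro y
    rw [hB, dotProduct_gram_mulVec]
    simp only [pow_two]
  -- The normal equations express Bz as noise plus bias minus the effect of the regularizer. After
  -- pairing with z, each term is at most a constant times the weighted norm of z, and one factor of
  -- that norm is divided out at the end.
  have hexpand : z ⬝ᵥ (B *ᵥ z) = S ⬝ᵥ z + β - θ' ⬝ᵥ z := by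
    have h1 : B *ᵥ z = response π T₀ A v h - B *ᵥ θ' := by
      rw [hz, Matrix.mulVec_sub, estimate, ← hB, mulVec_inv_mulVec hpd]
    rw [h1, dotProduct_sub, hB, dotProduct_gram_mulVec, response, hS, noiseSum, dotProduct_sum,
      sum_dotProduct, hβ, dotProduct_comm z θ']
    have h2 : ∀ a b c d e : ℝ, a = b + d + c → a - (e + c) = b + d - e := by
      intros; linarith
    apply h2
    rw [← Finset.sum_add_distrib, ← Finset.sum_add_distrib]
    refine Finset.sum_congr rfl fun s _ => ?_
    split_ifs
    · rw [dotProduct_smul, smul_dotProduct, BLM.bias, ← hθ', dotProduct_comm z]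
      simp only [smul_eq_mul]
      ring
    · simp
  have hw0 := wnorm_nonneg (B := B) z
  have hzz : z ⬝ᵥ z ≤ wnorm B z ^ 2 := by
    rw [sq_wnorm hpd, hquad]
    have : 0 ≤ ∑ s : Fin t, if T₀ ≤ s.val ∧ π s (past h s) v = none then
      (designVec A (h s) ⬝ᵥ z) ^ 2 else 0 :=
      Finset.sum_nonneg fun s _ => by split_ifs <;> positivity
    linarith
  have hVV : ∑ s : Fin t, (if T₀ ≤ s.val ∧ π s (past h s) v = none then
      (designVec A (h s) ⬝ᵥ z) ^ 2 else 0) ≤ wnorm B z ^ 2 := by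
    rw [sq_wnorm hpd, hquad]
    linarith [dotProduct_self_nonneg' z]
  have h1 : S ⬝ᵥ z ≤ wnorm B⁻¹ S * wnorm B z := (le_abs_self _).trans (abs_dotProduct_le hpd S z)
  -- Cauchy–Schwarz over the rounds: the squared predictions of z on the sample sum to at most its
  -- squared Gram norm, so the bias grows only like the square root of the number of rounds.
  have h2 : β ≤ ε * Real.sqrt (t - T₀ : ℕ) * wnorm B z := by
    have hsq : β ^ 2 ≤ (ε * Real.sqrt (t - T₀ : ℕ) * wnorm B z) ^ 2 := by
      have hcs := Finset.sum_mul_sq_le_sq_mul_sq Finset.univ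
        (fun s : Fin t => if T₀ ≤ s.val ∧ π s (past h s) v = none then M.bias A v (h s) else 0)
        (fun s : Fin t => if T₀ ≤ s.val ∧ π s (past h s) v = none then
          designVec A (h s) ⬝ᵥ z else 0)
      have e0 : ∑ s : Fin t, (if T₀ ≤ s.val ∧ π s (past h s) v = none then
          M.bias A v (h s) else 0) * (if T₀ ≤ s.val ∧ π s (past h s) v = none then
          designVec A (h s) ⬝ᵥ z else 0) = β :=
        Finset.sum_congr rfl fun s _ => by split_ifs <;> simp
      rw [e0] at hcs
      have e1 : ∑ s : Fin t, (if T₀ ≤ s.val ∧ π s (past h s) v = none then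
          M.bias A v (h s) else 0) ^ 2 ≤ ((t - T₀ : ℕ) : ℝ) * ε ^ 2 := by
        refine le_trans (Finset.sum_le_sum fun s _ => ?_)
          (sum_fin_ite_le t T₀ (fun s => π s (past h s) v = none) (sq_nonneg ε))
        split_ifs
        · exact pow_le_pow_left₀ (hb _).1 (hb _).2 2
        · simp
      have e2 : ∑ s : Fin t, (if T₀ ≤ s.val ∧ π s (past h s) v = none then
          designVec A (h s) ⬝ᵥ z else 0) ^ 2 ≤ wnorm B z ^ 2 := by
        refine le_trans (le_of_eq (Finset.sum_congr rfl fun s _ => ?_)) hVV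
        split_ifs <;> simp
      rw [mul_pow, mul_pow, Real.sq_sqrt (Nat.cast_nonneg _), mul_comm (ε ^ 2)]
      exact hcs.trans (mul_le_mul e1 e2 (Finset.sum_nonneg fun _ _ => sq_nonneg _) (by positivity))
    exact (abs_le_of_sq_le_sq' hsq (by positivity)).2
  have h3 : -(θ' ⬝ᵥ z) ≤ wnorm B z := by
    have hcs := Finset.sum_mul_sq_le_sq_mul_sq Finset.univ θ' z
    have e1 : ∑ i, θ' i ^ 2 ≤ 1 := by
      refine le_trans (le_of_eq ?_) (M.restrict_dotProduct_self_le A hv)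
      exact Finset.sum_congr rfl fun i _ => pow_two _
    have e2 : ∑ i, z i ^ 2 ≤ wnorm B z ^ 2 := by
      refine le_trans (le_of_eq ?_) hzz
      exact Finset.sum_congr rfl fun i _ => pow_two _
    have e3 : (θ' ⬝ᵥ z) ^ 2 ≤ wnorm B z ^ 2 := by
      refine hcs.trans ?_
      calc _ ≤ 1 * wnorm B z ^ 2 := mul_le_mul e1 e2 (Finset.sum_nonneg fun _ _ => sq_nonneg _)
            zero_le_one
        _ = _ := one_mul _
    linarith [(abs_le_of_sq_le_sq' e3 hw0).1]
  by_contra hlt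
  rw [not_le] at hlt
  have hpos : 0 < wnorm B z := by
    refine lt_of_le_of_lt ?_ hlt
    have := wnorm_nonneg (B := B⁻¹) S
    positivity
  have h4 := mul_lt_mul_of_pos_right hlt hpos
  have h5 := sq_wnorm hpd z
  rw [hexpand] at h5
  nlinarith

/-- The noise uses only the first summand of the radius. The remaining √n is the slack that absorbs
the regularizer and, for a while, the bias. -/
lemma wnorm_noiseSum_le {M : BLM n} {π : Policy n} {T₀ T : ℕ} {A : Finset (Node n)}
    (hA : A.card ≤ n) {v : Node n} (hn : 1 ≤ n) (hT : 2 ≤ T) {t : ℕ} (h : Fin t → Outcome n)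
    (hpot : noisePotential M π T₀ A v h < (T : ℝ) ^ 2) :
    wnorm (gram π T₀ A v h)⁻¹ (noiseSum M π T₀ A v h) ≤ radius n T t - Real.sqrt n := by
  have hT0 : (0 : ℝ) < T := by positivity
  have hn0 : (1 : ℝ) ≤ n := by exact_mod_cast hn
  rw [radius, add_sub_cancel_right, wnorm]
  apply Real.sqrt_le_sqrt
  have h1 : 2 * (noiseSum M π T₀ A v h ⬝ᵥ ((gram π T₀ A v h)⁻¹ *ᵥ noiseSum M π T₀ A v h)) -
      2 * Real.log (gram π T₀ A v h).det < 2 * Real.log T := by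
    rw [noisePotential, ← Real.lt_log_iff_exp_lt (by positivity), Real.log_pow] at hpot
    exact_mod_cast hpot
  have h2 := log_det_gram_le π T₀ hA v h
  have h3 : Real.log T ≤ 2 * Real.log (1 / (1 / (n * Real.sqrt T))) := by
    rw [one_div_one_div, Real.log_mul (by positivity) (by positivity), Real.log_sqrt hT0.le]
    have := Real.log_nonneg hn0
    linarith
  linarith

/-! ### Comparison of the true model with the search models -/

/-- Extension by zero. -/
def extendZero {A : Finset (Node n)} (z : A → ℝ) : Node n → ℝ :=
  fun u => if h : u ∈ A then z ⟨u, h⟩ else 0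

lemma capLin_extendZero {A : Finset (Node n)} (z : A → ℝ) (x : Outcome n) :
    capLin (extendZero z) x = min 1 |designVec A x ⬝ᵥ z| := by
  classical
  rw [capLin]
  congr 2
  have h1 : designVec A x ⬝ᵥ z = ∑ u : A, extendZero z u.val * val (x u.val) := by
    refine Finset.sum_congr rfl fun u _ => ?_
    simp [extendZero, designVec, mul_comm]
  rw [h1, Finset.sum_coe_sort A fun u => extendZero z u * val (x u)]
  symm
  apply Finset.sum_subset (Finset.subset_univ A)
  intro u _ hu
  simp [extendZero, hu]

lemma dependsBelow_linProb {A : Node n → Finset (Node n)} {r : Node n → ℕ}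
    (hA : ∀ v, ∀ u ∈ A v, r u < r v) (θ : (v : Node n) → A v → ℝ) :
    DependsBelow r (linProb A θ) := by
  intro v x y hxy
  simp only [linProb]
  congr 2
  exact Finset.sum_congr rfl fun u _ => by rw [hxy u (hA v u u.2)]

lemma linProb_mem_Icc {A : Node n → Finset (Node n)} {θ : (v : Node n) → A v → ℝ}
    (hθ : ∀ v u, θ v u ∈ Set.Icc (0 : ℝ) 1) (v : Node n) (x : Outcome n) :
    linProb A θ v x ∈ Set.Icc (0 : ℝ) 1 := by
  rw [linProb]
  split_ifs
  · simp
  · exact ⟨le_min zero_le_one (Finset.sum_nonneg fun u _ =>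
      mul_nonneg (hθ v u).1 (val_nonneg _)), min_le_left _ _⟩

/-- Both sides of the comparison are probabilities, so the linear prediction error may be capped at
1. The cap makes it a [0,1]-valued function, to which the multiplicative tail bound applies. -/
lemma abs_condProb_sub_linProb_le {M : BLM n} {A : Node n → Finset (Node n)} {v : Node n}
    (hv : v ≠ root n) {ε : ℝ} (hε : 0 ≤ ε) (hb : ∀ x, M.bias (A v) v x ∈ Set.Icc 0 ε)
    {θ : (v : Node n) → A v → ℝ} (hθ : ∀ v u, θ v u ∈ Set.Icc (0 : ℝ) 1) (x : Outcome n) :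
    |M.condProb v x - linProb A θ v x| ≤
      capLin (extendZero (θ v - M.restrict (A v) v)) x + ε := by
  have h0 := M.condProb_mem_Icc v x
  have h1 := linProb_mem_Icc hθ v x
  have hle1 : |M.condProb v x - linProb A θ v x| ≤ 1 := by
    rw [abs_le]; constructor <;> linarith [h0.1, h0.2, h1.1, h1.2]
  have hlin : linProb A θ v x = min 1 (designVec (A v) x ⬝ᵥ θ v) := by
    rw [linProb, if_neg hv]
    congr 1
    exact Finset.sum_congr rfl fun u _ => mul_comm _ _
  have hle2 : |M.condProb v x - linProb A θ v x| ≤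
      |designVec (A v) x ⬝ᵥ (θ v - M.restrict (A v) v)| + ε := by
    have h2 : M.condProb v x = min 1 (M.condProb v x) := (min_eq_right h0.2).symm
    rw [h2, hlin]
    refine (abs_min_sub_min_le_max _ _ _ _).trans ?_
    rw [sub_self, abs_zero]
    refine max_le (by positivity) ?_
    have h3 : M.condProb v x - designVec (A v) x ⬝ᵥ θ v =
        -(designVec (A v) x ⬝ᵥ (θ v - M.restrict (A v) v)) + M.bias (A v) v x := by
      rw [dotProduct_sub, BLM.bias]; ring
    rw [h3]
    refine (abs_add_le _ _).trans ?_
    rw [abs_neg, abs_of_nonneg (hb x).1]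
    linarith [(hb x).2]
  rw [capLin_extendZero]
  rcases min_cases (1 : ℝ) |designVec (A v) x ⬝ᵥ (θ v - M.restrict (A v) v)| with ⟨h, -⟩ | ⟨h, -⟩ <;>
    rw [h] <;> linarith

/-- The expected rewards in the true model and in a linear model on the parent sets `A`. -/
lemma abs_expReward_sub_linProb_le {M : BLM n} {r : Node n → ℕ} (hr : IsCausalRank M r)
    {A : Node n → Finset (Node n)} (hA : ∀ v, ∀ u ∈ A v, r u < r v) {ε : ℝ} (hε : 0 ≤ ε)
    (hb : ∀ v, v ≠ root n → ∀ x, M.bias (A v) v x ∈ Set.Icc 0 ε)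
    {θ : (v : Node n) → A v → ℝ} (hθ : ∀ v u, θ v u ∈ Set.Icc (0 : ℝ) 1) (a : Action n) :
    |expReward M.condProb a - expReward (linProb A θ) a| ≤ 2 * (n * ε) + 2 * ∑ v,
      if a v = none then
        ∑ x, doProb M.condProb a x * capLin (extendZero (θ v - M.restrict (A v) v)) x else 0 := by
  classical
  refine (abs_expReward_sub_le hr.dependsBelow (dependsBelow_linProb hA θ) M.condProb_mem_Icc
    (linProb_mem_Icc hθ) a).trans ?_
  have hpt : ∀ x v, 2 * discrepancy M.condProb (linProb A θ) a v x ≤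
      2 * ((if v = root n then 0 else ε) + if a v = none then
        capLin (extendZero (θ v - M.restrict (A v) v)) x else 0) := by
    intro x v
    rw [discrepancy]
    have hc := (capLin_mem_Icc (extendZero (θ v - M.restrict (A v) v)) x).1
    by_cases hv : v = root n
    · have : M.condProb v x - linProb A θ v x = 0 := by
        subst hv; simp [M.condProb_root, linProb]
      rw [this, abs_zero, ite_self, if_pos hv]
      split_ifs <;> linarith
    · rw [if_neg hv]
      split_ifs
      · have := abs_condProb_sub_linProb_le hv hε (hb v hv) hθ x
        linarith
      · linarith
  have hε' : ∑ v : Node n, (if v = root n then 0 else ε) = n * ε := by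
    rw [Fin.sum_univ_succ]
    simp [Fin.succ_ne_zero]
  calc ∑ x, doProb M.condProb a x * ∑ v, 2 * discrepancy M.condProb (linProb A θ) a v x
      ≤ ∑ x, doProb M.condProb a x * (2 * (n * ε) + 2 * ∑ v, if a v = none then
        capLin (extendZero (θ v - M.restrict (A v) v)) x else 0) := by
        refine Finset.sum_le_sum fun x _ => mul_le_mul_of_nonneg_left ?_
          (doProb_nonneg M.condProb_mem_Icc a x)
        refine (Finset.sum_le_sum fun v _ => hpt x v).trans_eq ?_
        rw [← Finset.mul_sum, Finset.sum_add_distrib, hε']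
        ring
    _ = _ := by
        simp only [mul_add]
        rw [Finset.sum_add_distrib, ← Finset.sum_mul, sum_doProb_condProb, one_mul]
        congr 1
        simp only [Finset.mul_sum]
        rw [Finset.sum_comm]
        refine Finset.sum_congr rfl fun v _ => ?_
        split_ifs
        · rw [Finset.mul_sum]
          exact Finset.sum_congr rfl fun x _ => by ring
        · simp

/-! ### Rewards -/

lemma expReward_mem_Icc (M : BLM n) (a : Action n) :
    expReward M.condProb a ∈ Set.Icc (0 : ℝ) 1 := by
  obtain ⟨r, hr⟩ := M.exists_isCausalRank
  exact sum_doProb_mul_mem_Icc hr.dependsBelow M.condProb_mem_Icc a fun _ => val_mem_Icc _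

lemma exists_bestReward_eq (M : BLM n) {𝒜 : Finset (Action n)} (h𝒜 : IsActionSet 𝒜) :
    ∃ a ∈ 𝒜, bestReward M 𝒜 = expReward M.condProb a := by
  have hne : (expReward M.condProb '' (𝒜 : Set (Action n))).Nonempty :=
    ⟨_, nullAction n, h𝒜.null_mem, rfl⟩
  obtain ⟨a, ha, h⟩ := hne.csSup_mem (𝒜.finite_toSet.image _)
  exact ⟨a, ha, h.symm⟩

lemma bestReward_sub_le_one (M : BLM n) {𝒜 : Finset (Action n)} (h𝒜 : IsActionSet 𝒜)
    (a : Action n) : bestReward M 𝒜 - expReward M.condProb a ≤ 1 := by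
  obtain ⟨b, -, hb⟩ := exists_bestReward_eq M h𝒜
  rw [hb]
  linarith [(expReward_mem_Icc M b).2, (expReward_mem_Icc M a).1]

/-! ### Discretization -/

lemma abs_capLin_sub_le {z z' : Node n → ℝ} {c : ℝ} (h : ∀ u, |z u - z' u| ≤ c)
    (x : Outcome n) : |capLin z x - capLin z' x| ≤ (n + 1) * c := by
  have h1 : |∑ u, z u * val (x u) - ∑ u, z' u * val (x u)| ≤ (n + 1) * c := by
    rw [← Finset.sum_sub_distrib]
    refine (Finset.abs_sum_le_sum_abs _ _).trans ?_
    calc ∑ u, |z u * val (x u) - z' u * val (x u)| ≤ ∑ _u : Node n, c := by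
          refine Finset.sum_le_sum fun u _ => ?_
          rw [← sub_mul, abs_mul, abs_of_nonneg (val_nonneg _)]
          exact (mul_le_of_le_one_right (abs_nonneg _) (val_le_one _)).trans (h u)
      _ = (n + 1) * c := by simp
  rw [capLin, capLin]
  refine (abs_min_sub_min_le_max _ _ _ _).trans ?_
  rw [sub_self, abs_zero]
  exact max_le ((abs_nonneg _).trans h1) ((abs_abs_sub_abs_le _ _).trans h1)

lemma exists_gridPoint {m : ℕ} (hm : 0 < m) {z : Node n → ℝ} (hz : ∀ u, |z u| ≤ 1) :
    ∃ ζ, ∀ u, |z u - gridPoint m ζ u| ≤ 1 / m := by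
  have hm0 : (0 : ℝ) < m := by exact_mod_cast hm
  have hnn : ∀ u, 0 ≤ (z u + 1) * m := fun u => by
    have := (abs_le.1 (hz u)).1
    exact mul_nonneg (by linarith) hm0.le
  have hlt : ∀ u, ⌊(z u + 1) * m⌋₊ < 2 * m + 1 := by
    intro u
    rw [Nat.lt_succ_iff]
    apply Nat.floor_le_of_le
    push_cast
    have := (abs_le.1 (hz u)).2
    nlinarith
  refine ⟨fun u => ⟨⌊(z u + 1) * m⌋₊, hlt u⟩, fun u => ?_⟩
  simp only [gridPoint]
  have h1 := Nat.floor_le (hnn u)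
  have h2 := Nat.lt_floor_add_one ((z u + 1) * m)
  have h3 : z u - ((⌊(z u + 1) * m⌋₊ : ℝ) / m - 1) =
      ((z u + 1) * m - ⌊(z u + 1) * m⌋₊) / m := by field_simp; ring
  rw [h3, abs_of_nonneg (div_nonneg (by linarith) hm0.le)]
  exact div_le_div_of_nonneg_right (by linarith) hm0.le

/-- The expected values of `capLin z` along the actions played so far are controlled by the
weighted norm of `z`. -/
lemma sum_condExp_capLin_le (M : BLM n) (π : Policy n) (T₀ : ℕ) (A : Finset (Node n)) (v : Node n)
    {t T m : ℕ} (ht : t ≤ T) (h : Fin t → Outcome n) {lam : ℝ} (hm : m = (n + 1) * T) (hT : 0 < T)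
    (hcap : ∀ ζ : Node n → Fin (2 * m + 1),
      capDeviation M π T₀ v (gridPoint m ζ) h < lam) {z : A → ℝ} (hz : ∀ u, |z u| ≤ 1) :
    ∑ s : Fin t, (if T₀ ≤ s.val ∧ π s (past h s) v = none then
      condExp M π (past h s) (capLin (extendZero z)) else 0) ≤
      2 * (Real.sqrt (t - T₀ : ℕ) * wnorm (gram π T₀ A v h) z) + 2 * lam + 3 := by
  have hT0 : (0 : ℝ) < T := by exact_mod_cast hT
  have hm0 : 0 < m := by rw [hm]; positivity
  have hz' : ∀ u, |extendZero z u| ≤ 1 := by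
    intro u
    rw [extendZero]
    split_ifs
    · exact hz _
    · simp
  -- The vector z may depend on the history, so concentration is applied at a nearby grid point. The
  -- mesh 1/((n+1)T) changes `capLin` by at most 1/T per round.
  obtain ⟨ζ, hζ⟩ := exists_gridPoint hm0 hz'
  have hclose : ∀ x, |capLin (extendZero z) x - capLin (gridPoint m ζ) x| ≤ 1 / T := by
    intro x
    refine (abs_capLin_sub_le hζ x).trans (le_of_eq ?_)
    rw [hm]
    push_cast
    field_simp
  have hcnt : ∑ s : Fin t, (if T₀ ≤ s.val ∧ π s (past h s) v = none then (1 / T : ℝ) else 0) ≤ 1 := by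
    refine (sum_fin_ite_le t T₀ (fun s => π s (past h s) v = none) (by positivity)).trans ?_
    rw [mul_one_div, div_le_one hT0]
    exact_mod_cast (Nat.sub_le t T₀).trans ht
  have hdev := (hcap ζ).le
  rw [capDeviation] at hdev
  -- The squared predictions on the sample are part of the Gram quadratic form, so Cauchy–Schwarz
  -- costs only the square root of the number of rounds.
  have hcs : ∑ s : Fin t, (if T₀ ≤ s.val ∧ π s (past h s) v = none then
      capLin (extendZero z) (h s) else 0) ≤
      Real.sqrt (t - T₀ : ℕ) * wnorm (gram π T₀ A v h) z := by
    apply le_of_sq_le_sq _ (mul_nonneg (Real.sqrt_nonneg _) (wnorm_nonneg _))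
    have h1 := Finset.sum_mul_sq_le_sq_mul_sq Finset.univ
      (fun s : Fin t => if T₀ ≤ s.val ∧ π s (past h s) v = none then (1 : ℝ) else 0)
      (fun s : Fin t => if T₀ ≤ s.val ∧ π s (past h s) v = none then
        capLin (extendZero z) (h s) else 0)
    have e0 : ∀ s : Fin t, (if T₀ ≤ s.val ∧ π s (past h s) v = none then (1 : ℝ) else 0) *
        (if T₀ ≤ s.val ∧ π s (past h s) v = none then capLin (extendZero z) (h s) else 0) =
        if T₀ ≤ s.val ∧ π s (past h s) v = none then capLin (extendZero z) (h s) else 0 := by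
      intro s; split_ifs <;> simp
    rw [Finset.sum_congr rfl fun s _ => e0 s] at h1
    refine h1.trans ?_
    rw [mul_pow, Real.sq_sqrt (Nat.cast_nonneg _), sq_wnorm (posDef_gram π T₀ A v h),
      dotProduct_gram_mulVec]
    refine mul_le_mul ?_ ?_ (Finset.sum_nonneg fun _ _ => sq_nonneg _) (Nat.cast_nonneg _)
    · have := sum_fin_ite_le t T₀ (fun s => π s (past h s) v = none) (zero_le_one (α := ℝ))
      rw [mul_one] at this
      refine le_trans (le_of_eq (Finset.sum_congr rfl fun s _ => ?_)) this
      split_ifs <;> simp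
    · refine le_trans (Finset.sum_le_sum fun s _ => ?_)
        (le_add_of_nonneg_left (dotProduct_self_nonneg' z))
      split_ifs
      · rw [← pow_two, ← sq_abs (designVec A (h s) ⬝ᵥ z), capLin_extendZero]
        exact pow_le_pow_left₀ (le_min zero_le_one (abs_nonneg _)) (min_le_right _ _) 2
      · simp
  -- The factor 2 undoes the halved mean. Passing to the grid point costs 1/T in the expectation and
  -- twice 1/T in the observed value.
  have key : ∀ s : Fin t, (if T₀ ≤ s.val ∧ π s (past h s) v = none then
      condExp M π (past h s) (capLin (extendZero z)) else 0) ≤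
      2 * (if T₀ ≤ s.val ∧ π s (past h s) v = none then
        condExp M π (past h s) (capLin (gridPoint m ζ)) / 2 - capLin (gridPoint m ζ) (h s) else 0) +
      2 * (if T₀ ≤ s.val ∧ π s (past h s) v = none then capLin (extendZero z) (h s) else 0) +
      3 * (if T₀ ≤ s.val ∧ π s (past h s) v = none then (1 / T : ℝ) else 0) := by
    intro s
    split_ifs
    · have h1 : condExp M π (past h s) (capLin (extendZero z)) ≤
          condExp M π (past h s) (capLin (gridPoint m ζ)) + 1 / T := by
        rw [← condExp_const M π (past h s) (1 / T), ← condExp_add]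
        exact condExp_mono M π _ fun x => by linarith [(abs_le.1 (hclose x)).2]
      have h2 := (abs_le.1 (hclose (h s))).1
      linarith
    · simp
  refine (Finset.sum_le_sum fun s _ => key s).trans ?_
  rw [Finset.sum_add_distrib, Finset.sum_add_distrib, ← Finset.mul_sum, ← Finset.mul_sum,
    ← Finset.mul_sum]
  linarith

/-! ### The iterative phase on good runs -/

/-- The exploration bonus of the outcome `x` in the round after the history `h`. -/
def bonus (π : Policy n) (T₀ : ℕ) (D : ℝ) {t : ℕ} (A : Node n → Finset (Node n))
    (h : Fin t → Outcome n) (x : Outcome n) : ℝ :=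
  ∑ v, if π t h v = none then min 1 (D * wnorm (gram π T₀ (A v) v h)⁻¹ (designVec (A v) x)) else 0

section GoodRun

variable {c₀ c₁ : ℝ} {T m : ℕ} {M : BLM n} {π : Policy n} {r : Node n → ℕ}
  {ω : Fin T → Outcome n}

lemma GoodRun.lt_of_mem (hr : IsCausalRank M r) (hω : GoodRun M π c₀ c₁ T m r ω) {t : Fin T}
    (ht : initLength n c₀ T ≤ t) (v : Node n) :
    ∀ u ∈ ancHat c₀ c₁ T (past ω t) v, r u < r v := by
  intro u hu
  have h6 : ancHat c₀ c₁ T (past ω t) v = ancHat c₀ c₁ T ω v := ancHat_pre t.isLt.le ht ω v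
  rw [h6] at hu
  exact lt_of_mem_ancHat hr hω.rank_lt hu

lemma GoodRun.bias_mem (hω : GoodRun M π c₀ c₁ T m r ω) (hc₁ : 0 < c₁) {t : Fin T}
    (ht : initLength n c₀ T ≤ t) {v : Node n} (hv : v ≠ root n) (x : Outcome n) :
    M.bias (ancHat c₀ c₁ T (past ω t) v) v x ∈
      Set.Icc 0 (n * (4 * c₁ / (T : ℝ) ^ (1 / 3 : ℝ))) := by
  refine M.bias_mem_Icc hv (by positivity) (fun u hu hu' => ?_) x
  have h6 : ancHat c₀ c₁ T (past ω t) v = ancHat c₀ c₁ T ω v := ancHat_pre t.isLt.le ht ω v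
  rw [h6] at hu'
  have h := not_detected_of_notMem hv hu hu'
  exact (hω.θ_lt v hv h.2.1 u hu h.1 h.2.2).le

/-- The excess over the radius is bias + 1 - √n. While it is not positive, the restricted weights
lie in the confidence set. -/
lemma GoodRun.wnorm_estimate_le (hω : GoodRun M π c₀ c₁ T m r ω) (hc₁ : 0 < c₁) (hn : 1 ≤ n)
    (hT : 2 ≤ T) {t : Fin T} (ht : initLength n c₀ T ≤ t) (v : Node n) :
    wnorm (gram π (initLength n c₀ T) (ancHat c₀ c₁ T (past ω t) v) v (past ω t))
      (estimate π (initLength n c₀ T) (ancHat c₀ c₁ T (past ω t) v) v (past ω t) -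
        M.restrict (ancHat c₀ c₁ T (past ω t) v) v) ≤
      radius n T t + (n * (4 * c₁ / (T : ℝ) ^ (1 / 3 : ℝ))) *
        Real.sqrt (t - initLength n c₀ T : ℕ) + (1 - Real.sqrt n) := by
  have hn0 : (1 : ℝ) ≤ n := by exact_mod_cast hn
  by_cases hv : v = root n
  · subst hv
    have hempty : ancHat c₀ c₁ T (past ω t) (root n) = ∅ := by
      have : root n ≠ target n := by
        intro h
        have := congrArg Fin.val h
        simp at this
        omega
      simp [ancHat, this]
    generalize ancHat c₀ c₁ T (past ω t) (root n) = A at hempty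
    subst hempty
    rw [wnorm, dotProduct]
    simp only [Finset.univ_eq_empty, Finset.sum_empty, Real.sqrt_zero]
    rw [radius]
    have : 0 ≤ (n * (4 * c₁ / (T : ℝ) ^ (1 / 3 : ℝ))) *
        Real.sqrt (t - initLength n c₀ T : ℕ) := by positivity
    have := Real.sqrt_nonneg (n * Real.log (1 + t * n) +
      2 * Real.log (1 / (1 / (n * Real.sqrt T))))
    linarith
  · have h6 : ancHat c₀ c₁ T (past ω t) v = ancHat c₀ c₁ T ω v := ancHat_pre t.isLt.le ht ω v
    have hpot := hω.noise_lt t v ht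
    rw [← h6] at hpot
    have h1 := wnorm_noiseSum_le (card_ancHat_le hn _ v) hn hT _ hpot
    have h2 := wnorm_estimate_sub_le M π (initLength n c₀ T) (ancHat c₀ c₁ T (past ω t) v) hv
      (by positivity) (hω.bias_mem hc₁ ht hv) (past ω t)
    linarith

lemma mem_searchSet_of_mem_confSet {ι : Type*} [Fintype ι] {B : Matrix ι ι ℝ} {c θ : ι → ℝ} {ρ : ℝ}
    (h : θ ∈ confSet B c ρ) : θ ∈ searchSet B c ρ := by
  rw [searchSet, if_pos ⟨_, h⟩]
  exact h

lemma searchSet_mem_Icc {ι : Type*} [Fintype ι] {B : Matrix ι ι ℝ} {c θ : ι → ℝ} {ρ : ℝ}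
    (h : θ ∈ searchSet B c ρ) (i : ι) : θ i ∈ Set.Icc (0 : ℝ) 1 := by
  rw [searchSet] at h
  split_ifs at h
  · exact h.1 i
  · exact h.1 i

/-- The center is within `d` of the search point in both cases: by the radius if the confidence set
is nonempty, and otherwise because θ' is itself a competitor for the nearest point of the box. So
closeness to the true weights survives the loss of coverage. -/
lemma wnorm_sub_le_of_mem_searchSet {ι : Type*} [Fintype ι] {B : Matrix ι ι ℝ} (hB : B.PosDef)
    {c θ θ' : ι → ℝ} {ρ d : ℝ} (h : θ ∈ searchSet B c ρ) (hθ' : ∀ i, θ' i ∈ Set.Icc (0 : ℝ) 1)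
    (hd : wnorm B (c - θ') ≤ d) (hρ : ρ ≤ d) : wnorm B (θ - θ') ≤ 2 * d := by
  have h1 : wnorm B (θ - c) ≤ d := by
    rw [searchSet] at h
    split_ifs at h
    · exact h.2.trans hρ
    · refine (h.2 θ' hθ').trans ?_
      rwa [wnorm_sub_comm]
  have h2 := wnorm_add_le hB (θ - c) (c - θ')
  rw [sub_add_sub_cancel] at h2
  linarith

/-- The bound on the weighted distance of the search sets from the restricted weights. -/
lemma GoodRun.wnorm_search_le (hω : GoodRun M π c₀ c₁ T m r ω) (hc₁ : 0 < c₁) (hn : 1 ≤ n)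
    (hT : 2 ≤ T) {t : Fin T} (ht : initLength n c₀ T ≤ t) (v : Node n)
    {θ : ancHat c₀ c₁ T (past ω t) v → ℝ}
    (hθ : θ ∈ searchSet (gram π (initLength n c₀ T) (ancHat c₀ c₁ T (past ω t) v) v (past ω t))
      (estimate π (initLength n c₀ T) (ancHat c₀ c₁ T (past ω t) v) v (past ω t))
      (radius n T t)) :
    wnorm (gram π (initLength n c₀ T) (ancHat c₀ c₁ T (past ω t) v) v (past ω t))
      (θ - M.restrict (ancHat c₀ c₁ T (past ω t) v) v) ≤
      2 * (radius n T t + (n * (4 * c₁ / (T : ℝ) ^ (1 / 3 : ℝ))) *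
        Real.sqrt (t - initLength n c₀ T : ℕ)) := by
  have hn1 : 1 ≤ Real.sqrt n := Real.one_le_sqrt.2 (by exact_mod_cast hn)
  refine wnorm_sub_le_of_mem_searchSet (posDef_gram _ _ _ _ _) hθ (M.restrict_mem_Icc _ _) ?_ ?_
  · have := hω.wnorm_estimate_le hc₁ hn hT ht v
    linarith
  · exact le_add_of_nonneg_right (by positivity)

variable {𝒜 : Finset (Action n)}

/-- In a round of the iterative phase of a good run, the optimistic value exceeds the expected
reward of the intervention by little more than the bonus. -/
lemma GoodRun.exists_optimistic (hr : IsCausalRank M r) (hω : GoodRun M π c₀ c₁ T m r ω)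
    (hπ : IsBLMLRUnknown 𝒜 c₀ c₁ T π) (hc₁ : 0 < c₁) (hn : 1 ≤ n)
    (hT : 2 ≤ T) {t : Fin T} (ht : initLength n c₀ T ≤ t) {D : ℝ}
    (hD : 2 * (radius n T t + (n * (4 * c₁ / (T : ℝ) ^ (1 / 3 : ℝ))) *
        Real.sqrt (t - initLength n c₀ T : ℕ)) ≤ D) :
    let A := ancHat c₀ c₁ T (past ω t)
    ∃ θ : (v : Node n) → A v → ℝ,
      (∀ v u, θ v u ∈ Set.Icc (0 : ℝ) 1) ∧
      (∀ v, wnorm (gram π (initLength n c₀ T) (A v) v (past ω t)) (θ v - M.restrict (A v) v) ≤ D) ∧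
      expReward (linProb A θ) (π t (past ω t)) ≤ expReward M.condProb (π t (past ω t)) +
        2 * (n * (n * (4 * c₁ / (T : ℝ) ^ (1 / 3 : ℝ)))) +
        2 * condExp M π (past ω t) (bonus π (initLength n c₀ T) D A (past ω t)) ∧
      ∀ a ∈ 𝒜, expReward (linProb A θ) a ≤ expReward (linProb A θ) (π t (past ω t)) ∧
        ((n * (4 * c₁ / (T : ℝ) ^ (1 / 3 : ℝ))) * Real.sqrt (t - initLength n c₀ T : ℕ) + 1 ≤
          Real.sqrt n → expReward (linProb A fun v => M.restrict (A v) v) a ≤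
            expReward (linProb A θ) (π t (past ω t))) := by
  intro A
  have hA : ∀ v, ∀ u ∈ A v, r u < r v := hω.lt_of_mem hr ht
  obtain ⟨θ, hθ, hopt⟩ := hπ.optimistic t t.isLt ht (past ω t) (acyclic_of_rank hA)
  have hbox : ∀ v u, θ v u ∈ Set.Icc (0 : ℝ) 1 := fun v u => searchSet_mem_Icc (hθ v) u
  have hwn : ∀ v, wnorm (gram π (initLength n c₀ T) (A v) v (past ω t))
      (θ v - M.restrict (A v) v) ≤ D := fun v =>
    (hω.wnorm_search_le hc₁ hn hT ht v (hθ v)).trans hD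
  -- The maximizer is tested against two competitors: another intervention with the same weights,
  -- which is always allowed, and the restricted true weights, which are known to be in the search
  -- set only while the bias fits into the slack.
  refine ⟨θ, hbox, hwn, ?_, fun a ha => ⟨hopt a ha θ hθ, fun hearly => hopt a ha _ fun v => ?_⟩⟩
  · have h := abs_expReward_sub_linProb_le hr hA (ε := n * (4 * c₁ / (T : ℝ) ^ (1 / 3 : ℝ)))
      (by positivity) (fun v hv => hω.bias_mem hc₁ ht hv) hbox (π t (past ω t))
    have h1 := (abs_le.1 h).1
    -- The duality of weighted norms turns the distance of the weights and the norm of the design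
    -- vector into the bonus.
    have h2 : ∑ v, (if π t (past ω t) v = none then
        ∑ x, doProb M.condProb (π t (past ω t)) x *
          capLin (extendZero (θ v - M.restrict (A v) v)) x else 0) ≤
        condExp M π (past ω t) (bonus π (initLength n c₀ T) D A (past ω t)) := by
      change _ ≤ condExp M π (past ω t) fun x => ∑ v, _
      rw [condExp_sum]
      refine Finset.sum_le_sum fun v _ => ?_
      split_ifs
      · change condExp M π (past ω t) _ ≤ _
        refine condExp_mono M π _ fun x => ?_
        rw [capLin_extendZero]
        refine min_le_min le_rfl ((abs_dotProduct_le
          (posDef_gram π (initLength n c₀ T) (A v) v (past ω t)) _ _).trans ?_)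
        rw [mul_comm]
        exact mul_le_mul_of_nonneg_right (hwn v) (wnorm_nonneg _)
      · rw [condExp_const]
    linarith
  · have hmem : M.restrict (A v) v ∈
        confSet (gram π (initLength n c₀ T) (A v) v (past ω t))
          (estimate π (initLength n c₀ T) (A v) v (past ω t)) (radius n T t) := by
      refine ⟨M.restrict_mem_Icc _ _, ?_⟩
      rw [wnorm_sub_comm]
      have := hω.wnorm_estimate_le hc₁ hn hT ht v
      linarith
    exact mem_searchSet_of_mem_confSet hmem

/-- As long as the bias is dominated by the confidence radius, the algorithm is optimistic. -/
lemma GoodRun.early_regret_le (hr : IsCausalRank M r) (hω : GoodRun M π c₀ c₁ T m r ω)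
    (h𝒜 : IsActionSet 𝒜)
    (hπ : IsBLMLRUnknown 𝒜 c₀ c₁ T π) (hc₁ : 0 < c₁) (hn : 1 ≤ n)
    (hT : 2 ≤ T) {t : Fin T} (ht : initLength n c₀ T ≤ t) {D : ℝ}
    (hD : 2 * (radius n T t + (n * (4 * c₁ / (T : ℝ) ^ (1 / 3 : ℝ))) *
        Real.sqrt (t - initLength n c₀ T : ℕ)) ≤ D)
    (hearly : (n * (4 * c₁ / (T : ℝ) ^ (1 / 3 : ℝ))) * Real.sqrt (t - initLength n c₀ T : ℕ) + 1 ≤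
          Real.sqrt n) :
    bestReward M 𝒜 - expReward M.condProb (π t (past ω t)) ≤
      4 * (n * (n * (4 * c₁ / (T : ℝ) ^ (1 / 3 : ℝ)))) +
      2 * condExp M π (past ω t)
        (bonus π (initLength n c₀ T) D (ancHat c₀ c₁ T (past ω t)) (past ω t)) := by
  obtain ⟨θ, -, -, hval, hopt⟩ := hω.exists_optimistic hr hπ hc₁ hn hT ht hD
  obtain ⟨a, ha, hbest⟩ := exists_bestReward_eq M h𝒜
  have h1 := (hopt a ha).2 hearly
  have h := abs_expReward_sub_linProb_le hr (hω.lt_of_mem hr ht)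
    (ε := n * (4 * c₁ / (T : ℝ) ^ (1 / 3 : ℝ)))
    (by positivity) (fun v hv => hω.bias_mem hc₁ ht hv) (fun v => M.restrict_mem_Icc _ v) a
  have h2 : ∀ v : Node n, (if a v = none then
      ∑ x, doProb M.condProb a x * capLin (extendZero (M.restrict (ancHat c₀ c₁ T (past ω t) v) v -
        M.restrict (ancHat c₀ c₁ T (past ω t) v) v)) x else 0) = 0 := by
    intro v
    simp only [capLin_extendZero, sub_self, dotProduct_zero, abs_zero]
    simp
  rw [Finset.sum_eq_zero fun v _ => h2 v] at h
  have h3 := (abs_le.1 h).2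
  rw [hbest]
  linarith

/-- Later, the regret of a round is compared with the average regret of the earlier rounds. -/
lemma GoodRun.late_regret_le (hr : IsCausalRank M r) (hω : GoodRun M π c₀ c₁ T m r ω)
    (hm : m = (n + 1) * T)
    (hπ : IsBLMLRUnknown 𝒜 c₀ c₁ T π) (hc₁ : 0 < c₁) (hn : 1 ≤ n)
    (hT : 2 ≤ T) {t : Fin T} (ht : initLength n c₀ T < t) {D τ : ℝ}
    (hτ : τ = ((t - initLength n c₀ T : ℕ) : ℝ))
    (hD : 2 * (radius n T t + (n * (4 * c₁ / (T : ℝ) ^ (1 / 3 : ℝ))) * Real.sqrt τ) ≤ D) :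
    bestReward M 𝒜 - expReward M.condProb (π t (past ω t)) ≤
      (∑ s : Fin t, if initLength n c₀ T ≤ s.val then
        (bestReward M 𝒜 - expReward M.condProb (π s (past (past ω t) s))) else 0) / τ +
      4 * (n * (n * (4 * c₁ / (T : ℝ) ^ (1 / 3 : ℝ)))) +
      2 * ((n + 1) * (2 * (Real.sqrt τ * D) + 2 * gridLevel n T m + 3)) / τ +
      2 * condExp M π (past ω t)
        (bonus π (initLength n c₀ T) D (ancHat c₀ c₁ T (past ω t)) (past ω t)) := by
  subst hτ
  set T₀ := initLength n c₀ T with hT₀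
  set ε := n * (4 * c₁ / (T : ℝ) ^ (1 / 3 : ℝ)) with hε
  have hε0 : 0 ≤ ε := by positivity
  set A := ancHat c₀ c₁ T (past ω t) with hAdef
  obtain ⟨θ, hbox, hwn, hval, hopt⟩ := hω.exists_optimistic hr hπ hc₁ hn hT ht.le hD
  have hA : ∀ v, ∀ u ∈ A v, r u < r v := hω.lt_of_mem hr ht.le
  set τ : ℝ := ((t - T₀ : ℕ) : ℝ) with hτ
  have hτ0 : 0 < τ := by rw [hτ]; exact_mod_cast Nat.sub_pos_of_lt ht
  set U := expReward (linProb A θ) (π t (past ω t)) with hU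
  set cap : Fin t → Node n → ℝ := fun s v =>
    if T₀ ≤ s.val ∧ π s (past (past ω t) s) v = none then
      condExp M π (past (past ω t) s) (capLin (extendZero (θ v - M.restrict (A v) v))) else 0
    with hcap
  -- For each earlier iterative round s, U is at least the value of a_s under the current weights θ,
  -- which is at least the true reward of a_s minus bias and prediction error. Since θ is the same
  -- for all s, the errors can be summed over the sample on which θ was fitted.
  have hstep : ∀ s : Fin t, (if T₀ ≤ s.val then bestReward M 𝒜 - U else 0) ≤
      (if T₀ ≤ s.val then
        (bestReward M 𝒜 - expReward M.condProb (π s (past (past ω t) s))) else 0) +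
      (if T₀ ≤ s.val then 2 * (n * ε) else 0) + 2 * ∑ v, cap s v := by
    intro s
    by_cases hs : T₀ ≤ s.val
    · simp only [hcap, hs, if_true, true_and]
      have hmem := hπ.mem s (s.isLt.trans t.isLt) hs (past (past ω t) s)
      have h1 := (hopt _ hmem).1
      have h2 := (abs_le.1 (abs_expReward_sub_linProb_le hr hA hε0
        (fun v hv => hω.bias_mem hc₁ ht.le hv) hbox (π s (past (past ω t) s)))).2
      have h3 : ∑ v, (if π s (past (past ω t) s) v = none then
          ∑ x, doProb M.condProb (π s (past (past ω t) s)) x *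
            capLin (extendZero (θ v - M.restrict (A v) v)) x else 0) =
          ∑ v, if π s (past (past ω t) s) v = none then condExp M π (past (past ω t) s)
            (capLin (extendZero (θ v - M.restrict (A v) v))) else 0 := rfl
      rw [h3] at h2
      linarith
    · simp only [hcap, hs, if_false, false_and]
      simp
  have hcapv : ∀ v, ∑ s, cap s v ≤ 2 * (Real.sqrt τ * D) + 2 * gridLevel n T m + 3 := by
    intro v
    have hz : ∀ u, |(θ v - M.restrict (A v) v) u| ≤ 1 := by
      intro u
      have h1 := hbox v u
      have h2 := M.restrict_mem_Icc (A v) v u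
      rw [Pi.sub_apply, abs_le]
      constructor <;> linarith [h1.1, h1.2, h2.1, h2.2]
    refine (sum_condExp_capLin_le M π T₀ (A v) v t.isLt.le (past ω t) hm (by omega)
      (hω.cap_lt t v) hz).trans ?_
    have := mul_le_mul_of_nonneg_left (hwn v) (Real.sqrt_nonneg τ)
    linarith
  have hcount : ∀ c : ℝ, ∑ s : Fin t, (if T₀ ≤ s.val then c else 0) = τ * c := by
    intro c
    rw [Fin.sum_univ_eq_sum_range (fun s => if T₀ ≤ s then c else 0) t, ← Finset.sum_filter,
      Finset.sum_const, nsmul_eq_mul]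
    congr 2
    rw [← Nat.card_Ico]
    congr 1
    ext s
    simp only [Finset.mem_filter, Finset.mem_range, Finset.mem_Ico]
    omega
  have hsum := Finset.sum_le_sum fun s (_ : s ∈ Finset.univ) => hstep s
  rw [hcount, Finset.sum_add_distrib, Finset.sum_add_distrib, hcount, ← Finset.mul_sum,
    Finset.sum_comm] at hsum
  have hcapsum : ∑ v, ∑ s, cap s v ≤
      (n + 1) * (2 * (Real.sqrt τ * D) + 2 * gridLevel n T m + 3) := by
    refine (Finset.sum_le_sum fun v _ => hcapv v).trans_eq ?_
    simp only [Finset.sum_const, Finset.card_univ, Fintype.card_fin, nsmul_eq_mul]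
    push_cast
    ring
  set X := ∑ s : Fin t, (if T₀ ≤ s.val then
    (bestReward M 𝒜 - expReward M.condProb (π s (past (past ω t) s))) else 0) with hX
  set Q := (n + 1) * (2 * (Real.sqrt τ * D) + 2 * gridLevel n T m + 3) with hQ
  have h1 : bestReward M 𝒜 - U ≤ X / τ + 2 * (n * ε) + 2 * Q / τ := by
    have h2 : bestReward M 𝒜 - U ≤ (X + τ * (2 * (n * ε)) + 2 * Q) / τ := by
      rw [le_div_iff₀ hτ0]; linarith
    refine h2.trans (le_of_eq ?_)
    field_simp
  linarith

end GoodRun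

/-! ### The elliptical potential -/

lemma extend_pre {t : ℕ} (h : Fin (t + 1) → Outcome n) :
    extend (pre t.le_succ h) (h (Fin.last t)) = h :=
  Fin.snoc_init_self (α := fun _ => Outcome n) h

/-- Each used round multiplies the determinant by 1 + w with w = V·B⁻¹V, and min(1, w) ≤ 2 log(1 +
w). -/
lemma sum_min_quad_le_log_det (π : Policy n) (T₀ : ℕ) (A : Finset (Node n)) (v : Node n) {t : ℕ}
    (h : Fin t → Outcome n) :
    ∑ s : Fin t, (if T₀ ≤ s.val ∧ π s (past h s) v = none then
      min 1 (designVec A (h s) ⬝ᵥ ((gram π T₀ A v (past h s))⁻¹ *ᵥ designVec A (h s))) else 0) ≤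
      2 * Real.log (gram π T₀ A v h).det := by
  induction t with
  | zero => simp [gram]
  | succ t ih =>
    rw [← extend_pre h]
    generalize pre t.le_succ h = h'
    generalize h (Fin.last t) = x
    have hpd := posDef_gram π T₀ A v h'
    have hih := ih h'
    simp only [Fin.sum_univ_castSucc, extend_castSucc, past_extend_castSucc, extend_last,
      past_extend_last, Fin.val_castSucc, Fin.val_last, gram_extend]
    split_ifs
    · have hw := quad_nonneg hpd.inv (designVec A x)
      rw [det_update1 hpd, Real.log_mul hpd.det_pos.ne' (by linarith)]
      have := min_one_le_two_mul_log hw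
      linarith
    · linarith

lemma min_one_mul_le {D y : ℝ} (hD : 1 ≤ D) : min 1 (D * y) ≤ D * min 1 y := by
  rcases min_cases 1 y with ⟨h, -⟩ | ⟨h, -⟩ <;> rw [h]
  · exact (min_le_left _ _).trans (by linarith)
  · exact min_le_right _ _

/-- For each node, the width D ≥ 1 comes out of the cap, and Cauchy–Schwarz separates the
deterministic factors aD from the capped norms, whose squares obey the elliptical potential bound.
The bound holds on every run, good or not. -/
lemma sum_bonus_le (π : Policy n) {c₀ c₁ : ℝ} {T : ℕ} (hn : 1 ≤ n) (a D : ℕ → ℝ)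
    (ha : ∀ t, 0 ≤ a t) (hD : ∀ t, 1 ≤ D t) {Q : ℝ}
    (hQ : ∑ t ∈ Finset.range T, (if initLength n c₀ T ≤ t then (a t * D t) ^ 2 else 0) ≤ Q)
    (ω : Fin T → Outcome n) :
    ∑ t : Fin T, (if initLength n c₀ T ≤ t.val then a t * bonus π (initLength n c₀ T) (D t)
      (ancHat c₀ c₁ T (past ω t)) (past ω t) (ω t) else 0) ≤
      (n + 1) * (Real.sqrt Q * Real.sqrt (2 * (n * Real.log (1 + T * n)))) := by
  set T₀ := initLength n c₀ T with hT₀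
  have hv : ∀ v : Node n, ∑ t : Fin T, (if T₀ ≤ t.val ∧ π t (past ω t) v = none then
      a t * min 1 (D t * wnorm (gram π T₀ (ancHat c₀ c₁ T (past ω t) v) v (past ω t))⁻¹
        (designVec (ancHat c₀ c₁ T (past ω t) v) (ω t))) else 0) ≤
      Real.sqrt Q * Real.sqrt (2 * (n * Real.log (1 + T * n))) := by
    intro v
    set A := ancHat c₀ c₁ T ω v with hA
    have hAt : ∀ t : Fin T, T₀ ≤ t.val → ancHat c₀ c₁ T (past ω t) v = A := fun t ht =>
      ancHat_pre t.isLt.le ht ω v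
    set y : Fin T → ℝ := fun t => if T₀ ≤ t.val ∧ π t (past ω t) v = none then
      min 1 (wnorm (gram π T₀ A v (past ω t))⁻¹ (designVec A (ω t))) else 0 with hy
    have h1 : ∀ t : Fin T, (if T₀ ≤ t.val ∧ π t (past ω t) v = none then
        a t * min 1 (D t * wnorm (gram π T₀ (ancHat c₀ c₁ T (past ω t) v) v (past ω t))⁻¹
          (designVec (ancHat c₀ c₁ T (past ω t) v) (ω t))) else 0) ≤
        (if T₀ ≤ t.val then a t * D t else 0) * y t := by
      intro t
      by_cases ht : T₀ ≤ t.val ∧ π t (past ω t) v = none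
      · rw [if_pos ht, if_pos ht.1, hAt t ht.1]
        simp only [hy, if_pos ht]
        rw [mul_assoc]
        exact mul_le_mul_of_nonneg_left (min_one_mul_le (hD t)) (ha t)
      · rw [if_neg ht]
        simp only [hy, if_neg ht, mul_zero, le_refl]
    refine (Finset.sum_le_sum fun t _ => h1 t).trans ?_
    have hcs := Finset.sum_mul_sq_le_sq_mul_sq Finset.univ
      (fun t : Fin T => if T₀ ≤ t.val then a t * D t else 0) y
    have e1 : ∑ t : Fin T, (if T₀ ≤ t.val then a t * D t else 0) ^ 2 ≤ Q := by
      refine le_trans (le_of_eq ?_) hQ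
      rw [← Fin.sum_univ_eq_sum_range (fun t => if T₀ ≤ t then (a t * D t) ^ 2 else 0)]
      exact Finset.sum_congr rfl fun t _ => by split_ifs <;> simp
    have e2 : ∑ t : Fin T, y t ^ 2 ≤ 2 * (n * Real.log (1 + T * n)) := by
      refine le_trans (Finset.sum_le_sum fun t _ => ?_)
        ((sum_min_quad_le_log_det π T₀ A v ω).trans
          (mul_le_mul_of_nonneg_left (log_det_gram_le π T₀ (card_ancHat_le hn ω v) v ω) (by norm_num)))
      simp only [hy]
      split_ifs
      · rw [← sq_wnorm (posDef_gram π T₀ A v (past ω t)).inv]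
        have hw := wnorm_nonneg (B := (gram π T₀ A v (past ω t))⁻¹) (designVec A (ω t))
        refine le_min (pow_le_one₀ (le_min zero_le_one hw) (min_le_left _ _)) ?_
        exact pow_le_pow_left₀ (le_min zero_le_one hw) (min_le_right _ _) 2
      · simp
    have hQ0 : 0 ≤ Q := (Finset.sum_nonneg fun _ _ => sq_nonneg _).trans e1
    rw [← Real.sqrt_mul hQ0]
    apply Real.le_sqrt_of_sq_le
    exact hcs.trans (mul_le_mul e1 e2 (Finset.sum_nonneg fun _ _ => sq_nonneg _) hQ0)
  calc ∑ t : Fin T, (if T₀ ≤ t.val then a t * bonus π T₀ (D t)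
        (ancHat c₀ c₁ T (past ω t)) (past ω t) (ω t) else 0)
      = ∑ v, ∑ t : Fin T, (if T₀ ≤ t.val ∧ π t (past ω t) v = none then
        a t * min 1 (D t * wnorm (gram π T₀ (ancHat c₀ c₁ T (past ω t) v) v (past ω t))⁻¹
          (designVec (ancHat c₀ c₁ T (past ω t) v) (ω t))) else 0) := by
        rw [Finset.sum_comm]
        refine Finset.sum_congr rfl fun t _ => ?_
        by_cases ht : T₀ ≤ t.val
        · simp only [ht, if_true, true_and, bonus, Finset.mul_sum, mul_ite, mul_zero]
        · simp only [ht, if_false, false_and, Finset.sum_const_zero]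
    _ ≤ ∑ _v : Node n, Real.sqrt Q * Real.sqrt (2 * (n * Real.log (1 + T * n))) :=
        Finset.sum_le_sum fun v _ => hv v
    _ = _ := by
        simp only [Finset.sum_const, Finset.card_univ, Fintype.card_fin, nsmul_eq_mul]
        push_cast
        ring

lemma bonus_nonneg (π : Policy n) (T₀ : ℕ) {D : ℝ} (hD : 0 ≤ D) {t : ℕ}
    (A : Node n → Finset (Node n)) (h : Fin t → Outcome n) (x : Outcome n) :
    0 ≤ bonus π T₀ D A h x := by
  refine Finset.sum_nonneg fun v _ => ?_
  split_ifs
  · exact le_min zero_le_one (mul_nonneg hD (wnorm_nonneg _))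
  · exact le_rfl

/-! ### Averaging weights -/

/-- The weight of the round `k` in the recursion for the average regret. -/
def avgWeight (t₀ k : ℕ) : ℝ := 1 / (max t₀ (k + 1) : ℕ)

lemma avgWeight_nonneg (t₀ k : ℕ) : 0 ≤ avgWeight t₀ k := by
  rw [avgWeight]; positivity

lemma avgWeight_mul_le (t₀ k : ℕ) : avgWeight t₀ k * k ≤ 1 := by
  rw [avgWeight, one_div_mul_eq_div]
  refine div_le_one_of_le₀ ?_ (by positivity)
  exact_mod_cast (Nat.le_succ k).trans (le_max_right _ _)

lemma sum_avgWeight_le (t₀ : ℕ) {L T : ℕ} (hL : L ≤ T) (hT : 2 ≤ T) :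
    ∑ k ∈ Finset.range L, avgWeight t₀ k ≤ 4 * Real.log T := by
  have h1 : ∑ k ∈ Finset.range L, avgWeight t₀ k ≤ ∑ k ∈ Finset.range T, 1 / ((k : ℝ) + 1) := by
    refine (Finset.sum_le_sum fun k _ => ?_).trans (Finset.sum_le_sum_of_subset_of_nonneg
      (Finset.range_mono hL) fun k _ _ => by positivity)
    rw [avgWeight]
    apply one_div_le_one_div_of_le (by positivity)
    exact_mod_cast le_max_right _ _
  have h2 := harmonic_le_one_add_log T
  have h3 : ((harmonic T : ℚ) : ℝ) = ∑ k ∈ Finset.range T, 1 / ((k : ℝ) + 1) := by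
    rw [harmonic]
    push_cast
    exact Finset.sum_congr rfl fun k _ => (one_div _).symm
  have h4 : Real.log 2 ≤ Real.log T := Real.log_le_log (by norm_num) (by exact_mod_cast hT)
  have h5 := Real.log_two_gt_d9
  linarith

/-- The first t₀ terms contribute 1/t₀ in total, and the later ones are dominated by the telescoping
differences 1/k - 1/(k+1), again 1/t₀. -/
lemma sum_sq_avgWeight_le {t₀ : ℕ} (ht₀ : 1 ≤ t₀) (L : ℕ) :
    ∑ k ∈ Finset.range L, avgWeight t₀ k ^ 2 ≤ 2 / t₀ := by
  have ht : (0 : ℝ) < t₀ := by exact_mod_cast ht₀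
  have key : ∀ L, ∑ k ∈ Finset.range L, avgWeight t₀ k ^ 2 ≤
      (min L t₀ : ℕ) / (t₀ : ℝ) ^ 2 + (1 / t₀ - 1 / (max L t₀ : ℕ)) := by
    intro L
    induction L with
    | zero => simp
    | succ k ih =>
      rw [Finset.sum_range_succ, avgWeight]
      rcases lt_or_ge k t₀ with h | h
      · rw [min_eq_left h.le, max_eq_right h.le] at ih
        rw [min_eq_left (show k + 1 ≤ t₀ from h), max_eq_right (show k + 1 ≤ t₀ from h),
          max_eq_left (show k + 1 ≤ t₀ from h)]
        push_cast
        rw [add_div, one_div_pow]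
        linarith
      · rw [min_eq_right h, max_eq_left h] at ih
        rw [min_eq_right (show t₀ ≤ k + 1 by omega), max_eq_left (show t₀ ≤ k + 1 by omega),
          max_eq_right (show t₀ ≤ k + 1 by omega)]
        push_cast
        have hk : (0 : ℝ) < k := by exact_mod_cast (ht₀.trans h)
        have h6 : (1 / ((k : ℝ) + 1)) ^ 2 ≤ 1 / k - 1 / (k + 1) := by
          have h7 : 1 / (k : ℝ) - 1 / (k + 1) = 1 / (k * (k + 1)) := by field_simp; ring
          rw [h7, one_div_pow]
          apply one_div_le_one_div_of_le (by positivity)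
          nlinarith
        linarith
  refine (key L).trans ?_
  have h1 : ((min L t₀ : ℕ) : ℝ) / (t₀ : ℝ) ^ 2 ≤ 1 / t₀ := by
    rw [div_le_div_iff₀ (by positivity) ht]
    have : ((min L t₀ : ℕ) : ℝ) ≤ t₀ := by exact_mod_cast min_le_right _ _
    nlinarith
  have h2 : (0 : ℝ) ≤ 1 / (max L t₀ : ℕ) := by positivity
  have h3 : (2 : ℝ) / t₀ = 1 / t₀ + 1 / t₀ := by ring
  linarith

/-- A sequence that eventually exceeds its running average by little has a small sum. -/
lemma sum_le_of_le_average {x y : ℕ → ℝ} {t₀ L : ℕ} (ht₀ : 1 ≤ t₀)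
    (hearly : ∀ k < L, k < t₀ → x k ≤ y k)
    (hlate : ∀ k < L, t₀ ≤ k → x k ≤ (∑ i ∈ Finset.range k, x i) / k + y k) :
    ∑ i ∈ Finset.range L, x i ≤
      (max L t₀ : ℕ) * ∑ i ∈ Finset.range L, avgWeight t₀ i * y i := by
  -- With S_k the partial sums, a late step gives S_{k+1}/(k+1) ≤ S_k/k + y_k/(k+1). In the early
  -- phase the denominator stays t₀. Both add `avgWeight` times y_k to the normalized sum.
  have key : ∀ k ≤ L, ∑ i ∈ Finset.range k, x i ≤
      (max k t₀ : ℕ) * ∑ i ∈ Finset.range k, avgWeight t₀ i * y i := by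
    intro k
    induction k with
    | zero => simp
    | succ k ih =>
      intro hk
      have ihk := ih (by omega)
      rw [Finset.sum_range_succ, Finset.sum_range_succ, avgWeight]
      rcases lt_or_ge k t₀ with h | h
      · rw [max_eq_right h.le] at ihk
        rw [max_eq_right (show k + 1 ≤ t₀ from h), max_eq_left (show k + 1 ≤ t₀ from h)]
        have ht : (0 : ℝ) < t₀ := by exact_mod_cast ht₀
        have h1 := hearly k (by omega) h
        have h2 : (t₀ : ℝ) * (∑ i ∈ Finset.range k, avgWeight t₀ i * y i + 1 / t₀ * y k) =
            t₀ * ∑ i ∈ Finset.range k, avgWeight t₀ i * y i + y k := by field_simp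
        rw [h2]
        linarith
      · rw [max_eq_left h] at ihk
        rw [max_eq_left (show t₀ ≤ k + 1 by omega), max_eq_right (show t₀ ≤ k + 1 by omega)]
        have hk0 : (0 : ℝ) < k := by exact_mod_cast (ht₀.trans h)
        have h1 := hlate k (by omega) h
        push_cast
        set S := ∑ i ∈ Finset.range k, x i
        set W := ∑ i ∈ Finset.range k, avgWeight t₀ i * y i
        have h2 : ((k : ℝ) + 1) * (W + 1 / (k + 1) * y k) = (k + 1) * W + y k := by field_simp
        rw [h2]
        have h3 : S / k ≤ W := by rw [div_le_iff₀ hk0]; linarith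
        linarith
  exact key L le_rfl

/-! ### The regret on good runs -/

/-- The width of the search sets after `k` rounds of the iterative phase. -/
def searchWidth (ρ ε : ℝ) (k : ℕ) : ℝ := 2 * (ρ + ε * Real.sqrt k)

/-- The part of the per-round regret that does not come from the bonus. -/
def driftTerm (n : ℕ) (ρ ε lam : ℝ) (t₀ k : ℕ) : ℝ :=
  12 * (n + 1) * ε + 8 * (n + 1) * ρ * Real.sqrt (2 * avgWeight t₀ k) +
    4 * (n + 1) * (2 * lam + 3) * avgWeight t₀ k

/-- The average over the past divides by k while the weight has k + 1; the factor 2 covers the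
difference. -/
lemma sqrt_div_self_le {t₀ k : ℕ} (hk : t₀ ≤ k) (hk1 : 1 ≤ k) :
    Real.sqrt k / k ≤ Real.sqrt (2 * avgWeight t₀ k) ∧ 1 / (k : ℝ) ≤ 2 * avgWeight t₀ k := by
  have hk0 : (1 : ℝ) ≤ k := by exact_mod_cast hk1
  have h1 : 1 / (k : ℝ) ≤ 2 * avgWeight t₀ k := by
    rw [avgWeight, max_eq_right (show t₀ ≤ k + 1 by omega), mul_one_div,
      div_le_div_iff₀ (by linarith) (by positivity)]
    push_cast
    linarith
  refine ⟨?_, h1⟩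
  apply Real.le_sqrt_of_sq_le
  rw [div_pow, Real.sq_sqrt (by linarith)]
  refine le_trans (le_of_eq ?_) h1
  field_simp

lemma sum_range_eq_add {N a L : ℕ} (h : N = a + L) (f : ℕ → ℝ) :
    ∑ t ∈ Finset.range N, f t = ∑ t ∈ Finset.range a, f t + ∑ k ∈ Finset.range L, f (a + k) := by
  subst h
  exact Finset.sum_range_add f a L

/-- Initial rounds cost at most 1 each, and the averaging recursion handles the rest. The bonuses
stay conditional expectations, because only the expectation over all runs lets them be replaced by
realized values. -/
lemma GoodRun.sum_regret_le {c₀ c₁ : ℝ} {T m : ℕ} {M : BLM n} {π : Policy n} {r : Node n → ℕ}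
    {ω : Fin T → Outcome n} {𝒜 : Finset (Action n)} (hr : IsCausalRank M r)
    (hω : GoodRun M π c₀ c₁ T m r ω) (hm : m = (n + 1) * T) (h𝒜 : IsActionSet 𝒜)
    (hπ : IsBLMLRUnknown 𝒜 c₀ c₁ T π) (hc₁ : 0 < c₁) (hn : 1 ≤ n) (hT : 2 ≤ T)
    (hT₀ : initLength n c₀ T ≤ T) {t₀ : ℕ} (ht₀ : 1 ≤ t₀) (ht₀T : t₀ ≤ T) {ρ ε : ℝ}
    (hρ : ∀ t < T, radius n T t ≤ ρ) (hρ0 : 0 ≤ ρ) (hε : ε = n * (4 * c₁ / (T : ℝ) ^ (1 / 3 : ℝ)))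
    (hearly : ∀ k < t₀, ε * Real.sqrt k + 1 ≤ Real.sqrt n) :
    ∑ t : Fin T, (bestReward M 𝒜 - expReward M.condProb (π t (past ω t))) ≤
      initLength n c₀ T + T * (∑ k ∈ Finset.range (T - initLength n c₀ T),
        avgWeight t₀ k * driftTerm n ρ ε (gridLevel n T m) t₀ k +
      2 * ∑ t : Fin T, (if initLength n c₀ T ≤ t.val then
        condExp M π (past ω t) (fun x => avgWeight t₀ (t - initLength n c₀ T) *
          bonus π (initLength n c₀ T) (searchWidth ρ ε (t - initLength n c₀ T))
            (ancHat c₀ c₁ T (past ω t)) (past ω t) x) else 0)) := by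
  set T₀ := initLength n c₀ T with hT₀def
  obtain ⟨L, hTL⟩ : ∃ L, T = T₀ + L := ⟨T - T₀, by omega⟩
  have hL : T - T₀ = L := by omega
  rw [hL]
  have hε0 : 0 ≤ ε := by rw [hε]; positivity
  set X : ℕ → ℝ := fun t => if h : t < T then
    bestReward M 𝒜 - expReward M.condProb (π t (past ω ⟨t, h⟩)) else 0 with hX
  set B : ℕ → ℝ := fun t => if h : t < T then
    condExp M π (past ω ⟨t, h⟩) (bonus π T₀ (searchWidth ρ ε (t - T₀))
      (ancHat c₀ c₁ T (past ω ⟨t, h⟩)) (past ω ⟨t, h⟩)) else 0 with hB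
  have hXt : ∀ t (h : t < T), X t = bestReward M 𝒜 - expReward M.condProb (π t (past ω ⟨t, h⟩)) :=
    fun t h => by simp only [hX, h, dif_pos]
  have hBt : ∀ t (h : t < T), B t = condExp M π (past ω ⟨t, h⟩)
      (bonus π T₀ (searchWidth ρ ε (t - T₀)) (ancHat c₀ c₁ T (past ω ⟨t, h⟩)) (past ω ⟨t, h⟩)) :=
    fun t h => by simp only [hB, h, dif_pos]
  have hw : ∀ k, 0 ≤ searchWidth ρ ε k := fun k => by rw [searchWidth]; positivity
  have hB0 : ∀ t, 0 ≤ B t := by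
    intro t
    simp only [hB]
    split_ifs with h
    · rw [← condExp_const M π (past ω ⟨t, h⟩) 0]
      exact condExp_mono M π _ fun x => bonus_nonneg π T₀ (hw _) _ _ x
    · exact le_rfl
  have hlam0 : 0 ≤ gridLevel n T m := by
    rw [gridLevel]
    have h1 : 0 ≤ Real.log (2 * m + 1) := Real.log_nonneg (by
      have : (0 : ℝ) ≤ m := Nat.cast_nonneg m
      linarith)
    have h2 := (log_pos_of_two_le hT).le
    positivity
  set y : ℕ → ℝ := fun k => driftTerm n ρ ε (gridLevel n T m) t₀ k + 2 * B (T₀ + k) with hy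
  have hdrift0 : ∀ k, 12 * (n + 1) * ε ≤ driftTerm n ρ ε (gridLevel n T m) t₀ k := by
    intro k
    have := avgWeight_nonneg t₀ k
    rw [driftTerm, add_assoc]
    exact le_add_of_nonneg_right (by positivity)
  have hnε : 0 ≤ n * ε := by positivity
  have hy0 : ∀ k, 0 ≤ y k := fun k => by
    have h1 := hdrift0 k
    have h2 := hB0 (T₀ + k)
    have h3 : 0 ≤ 12 * ((n : ℝ) + 1) * ε := by positivity
    simp only [hy]
    linarith
  have hwidth : ∀ k (h : T₀ + k < T), 2 * (radius n T (T₀ + k) +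
      n * (4 * c₁ / (T : ℝ) ^ (1 / 3 : ℝ)) * Real.sqrt k) ≤ searchWidth ρ ε k := by
    intro k h
    rw [← hε, searchWidth]
    linarith [hρ _ h]
  have hmain := sum_le_of_le_average (x := fun k => X (T₀ + k)) (y := y) (L := L) ht₀
    (fun k hk hkt => by
      have ht : T₀ + k < T := by omega
      have hsub : T₀ + k - T₀ = k := by omega
      have h1 := hω.early_regret_le hr h𝒜 hπ hc₁ hn hT (t := ⟨T₀ + k, ht⟩) (Nat.le_add_right _ _)
        (D := searchWidth ρ ε k) (by simpa only [← hT₀def, hsub] using hwidth k ht)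
        (by simpa only [← hT₀def, hsub, ← hε] using hearly k hkt)
      simp only [hy]
      rw [hXt _ ht, hBt _ ht, hsub]
      rw [← hε, ← hT₀def] at h1
      have h2 := hdrift0 k
      linarith)
    (fun k hk hkt => by
      have ht : T₀ + k < T := by omega
      have hk1 : 1 ≤ k := ht₀.trans hkt
      have hsub : T₀ + k - T₀ = k := by omega
      have h1 := hω.late_regret_le hr hm hπ hc₁ hn hT (t := ⟨T₀ + k, ht⟩)
        (show T₀ < T₀ + k by omega) (D := searchWidth ρ ε k) (τ := k)
        (by simp only [← hT₀def, hsub]) (hwidth k ht)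
      simp only [hy]
      rw [hXt _ ht, hBt _ ht, hsub]
      rw [← hε, ← hT₀def] at h1
      have hsum : ∑ s : Fin (T₀ + k), (if T₀ ≤ s.val then (bestReward M 𝒜 -
          expReward M.condProb (π s (past (past ω ⟨T₀ + k, ht⟩) s))) else 0) =
          ∑ i ∈ Finset.range k, X (T₀ + i) := by
        have e1 : ∀ s : Fin (T₀ + k), (if T₀ ≤ s.val then (bestReward M 𝒜 -
            expReward M.condProb (π s (past (past ω ⟨T₀ + k, ht⟩) s))) else 0) =
            if T₀ ≤ s.val then X s else 0 := by
          intro s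
          rw [hXt s (s.isLt.trans ht)]
          rfl
        rw [Finset.sum_congr rfl fun s _ => e1 s,
          Fin.sum_univ_eq_sum_range (fun s => if T₀ ≤ s then X s else 0), Finset.sum_range_add,
          Finset.sum_eq_zero, zero_add]
        · exact Finset.sum_congr rfl fun i _ => by simp
        · intro s hs
          rw [Finset.mem_range] at hs
          rw [if_neg (by omega)]
      rw [hsum] at h1
      have hk0 : (0 : ℝ) < k := by exact_mod_cast hk1
      obtain ⟨h2, h3⟩ := sqrt_div_self_le hkt hk1
      -- The part 2ε√k of the width, multiplied by √k/k, leaves the constant 8(n+1)ε. With the model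
      -- bias 4nε it is at most the leading 12(n+1)ε of `driftTerm`.
      have h4 : 4 * (n * ε) + 2 * ((n + 1) * (2 * (Real.sqrt k * searchWidth ρ ε k) +
          2 * gridLevel n T m + 3)) / k ≤ driftTerm n ρ ε (gridLevel n T m) t₀ k := by
        have e1 : 2 * ((n + 1) * (2 * (Real.sqrt k * searchWidth ρ ε k) +
            2 * gridLevel n T m + 3)) / k = 8 * (n + 1) * ρ * (Real.sqrt k / k) + 8 * (n + 1) * ε +
            2 * (n + 1) * (2 * gridLevel n T m + 3) * (1 / k) := by
          have e2 : Real.sqrt k * searchWidth ρ ε k = 2 * (ρ * Real.sqrt k + ε * k) := by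
            rw [searchWidth]
            linear_combination (2 * ε) * Real.mul_self_sqrt hk0.le
          rw [e2]
          field_simp
          ring
        have e3 : 8 * (n + 1) * ρ * (Real.sqrt k / k) ≤
            8 * (n + 1) * ρ * Real.sqrt (2 * avgWeight t₀ k) :=
          mul_le_mul_of_nonneg_left h2 (by positivity)
        have e4 : 2 * (n + 1) * (2 * gridLevel n T m + 3) * (1 / k) ≤
            2 * (n + 1) * (2 * gridLevel n T m + 3) * (2 * avgWeight t₀ k) :=
          mul_le_mul_of_nonneg_left h3 (by positivity)
        rw [e1, driftTerm]
        linarith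
      linarith)
  have hleft : ∑ t : Fin T, (bestReward M 𝒜 - expReward M.condProb (π t (past ω t))) =
      ∑ t ∈ Finset.range T₀, X t + ∑ k ∈ Finset.range L, X (T₀ + k) := by
    rw [← sum_range_eq_add hTL, ← Fin.sum_univ_eq_sum_range]
    exact Finset.sum_congr rfl fun t _ => (hXt t t.isLt).symm
  have hinit : ∑ t ∈ Finset.range T₀, X t ≤ T₀ := by
    have h1 : ∀ t ∈ Finset.range T₀, X t ≤ 1 := by
      intro t ht
      rw [Finset.mem_range] at ht
      rw [hXt t (by omega)]
      exact bestReward_sub_le_one M h𝒜 _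
    refine (Finset.sum_le_sum h1).trans_eq ?_
    simp
  have hright : ∑ k ∈ Finset.range L, avgWeight t₀ k * y k =
      ∑ k ∈ Finset.range L, avgWeight t₀ k * driftTerm n ρ ε (gridLevel n T m) t₀ k +
      2 * ∑ t : Fin T, (if T₀ ≤ t.val then condExp M π (past ω t) (fun x =>
        avgWeight t₀ (t - T₀) * bonus π T₀ (searchWidth ρ ε (t - T₀))
            (ancHat c₀ c₁ T (past ω t)) (past ω t) x) else 0) := by
    have e1 : ∑ t : Fin T, (if T₀ ≤ t.val then condExp M π (past ω t) (fun x =>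
        avgWeight t₀ (t - T₀) * bonus π T₀ (searchWidth ρ ε (t - T₀))
            (ancHat c₀ c₁ T (past ω t)) (past ω t) x) else 0) =
        ∑ k ∈ Finset.range L, avgWeight t₀ k * B (T₀ + k) := by
      have e2 : ∀ t : Fin T, (if T₀ ≤ t.val then condExp M π (past ω t) (fun x =>
          avgWeight t₀ (t - T₀) * bonus π T₀ (searchWidth ρ ε (t - T₀))
            (ancHat c₀ c₁ T (past ω t)) (past ω t) x) else 0) =
          if T₀ ≤ t.val then avgWeight t₀ (t - T₀) * B t else 0 := by
        intro t
        rw [hBt t t.isLt, condExp_const_mul]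
      rw [Finset.sum_congr rfl fun t _ => e2 t, Fin.sum_univ_eq_sum_range
        (fun t => if T₀ ≤ t then avgWeight t₀ (t - T₀) * B t else 0), sum_range_eq_add hTL,
        Finset.sum_eq_zero, zero_add]
      · exact Finset.sum_congr rfl fun i _ => by simp
      · intro s hs
        rw [Finset.mem_range] at hs
        rw [if_neg (by omega)]
    rw [e1, Finset.mul_sum, ← Finset.sum_add_distrib]
    exact Finset.sum_congr rfl fun k _ => by simp only [hy]; ring
  rw [← hright, hleft]
  refine add_le_add hinit (hmain.trans ?_)
  refine mul_le_mul_of_nonneg_right ?_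
    (Finset.sum_nonneg fun k _ => mul_nonneg (avgWeight_nonneg _ _) (hy0 k))
  have : max L t₀ ≤ T := max_le (by omega) ht₀T
  exact_mod_cast this

/-! ### The expected regret -/

lemma regret_eq_trajExp (M : BLM n) (𝒜 : Finset (Action n)) (π : Policy n) (T : ℕ) :
    regret M 𝒜 π T = trajExp M π T fun ω =>
      ∑ t : Fin T, (bestReward M 𝒜 - expReward M.condProb (π t (past ω t))) := rfl

lemma sum_regret_le (M : BLM n) {𝒜 : Finset (Action n)} (h𝒜 : IsActionSet 𝒜) (π : Policy n)
    {T : ℕ} (ω : Fin T → Outcome n) :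
    ∑ t : Fin T, (bestReward M 𝒜 - expReward M.condProb (π t (past ω t))) ≤ T := by
  refine (Finset.sum_le_sum fun t _ => bestReward_sub_le_one M h𝒜 _).trans_eq ?_
  simp

lemma regret_le_horizon (M : BLM n) {𝒜 : Finset (Action n)} (h𝒜 : IsActionSet 𝒜) (π : Policy n)
    (T : ℕ) : regret M 𝒜 π T ≤ T := by
  rw [regret_eq_trajExp, ← trajExp_const M π T (T : ℝ)]
  exact trajExp_mono M π fun ω => sum_regret_le M h𝒜 π ω

/-- On bad runs the regret is at most T. As the bonuses are nonnegative, their sum may be kept on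
bad runs too; its expectation is then over all runs, where the tower property and the pathwise bound
`sum_bonus_le` apply. -/
lemma regret_le_of_goodRun {c₀ c₁ : ℝ} {T m : ℕ} {M : BLM n} {π : Policy n} {r : Node n → ℕ}
    {𝒜 : Finset (Action n)} (hr : IsCausalRank M r)
    (hm : m = (n + 1) * T) (h𝒜 : IsActionSet 𝒜)
    (hπ : IsBLMLRUnknown 𝒜 c₀ c₁ T π) (hc₁ : 0 < c₁) (hn : 1 ≤ n) (hT : 2 ≤ T)
    (hT₀ : initLength n c₀ T ≤ T) {t₀ : ℕ} (ht₀ : 1 ≤ t₀) (ht₀T : t₀ ≤ T) {ρ ε : ℝ}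
    (hρ : ∀ t < T, radius n T t ≤ ρ) (hρ1 : 1 / 2 ≤ ρ)
    (hε : ε = n * (4 * c₁ / (T : ℝ) ^ (1 / 3 : ℝ)))
    (hearly : ∀ k < t₀, ε * Real.sqrt k + 1 ≤ Real.sqrt n) {K Q : ℝ}
    (hK : ∑ k ∈ Finset.range (T - initLength n c₀ T),
      avgWeight t₀ k * driftTerm n ρ ε (gridLevel n T m) t₀ k ≤ K)
    (hQ : ∑ k ∈ Finset.range (T - initLength n c₀ T),
      (avgWeight t₀ k * searchWidth ρ ε k) ^ 2 ≤ Q) :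
    regret M 𝒜 π T ≤ initLength n c₀ T +
      T * trajPr M π T (fun ω => ¬ GoodRun M π c₀ c₁ T m r ω) +
      T * (K + 2 * ((n + 1) * (Real.sqrt Q * Real.sqrt (2 * (n * Real.log (1 + T * n)))))) := by
  classical
  set T₀ := initLength n c₀ T with hT₀def
  have hε0 : 0 ≤ ε := by rw [hε]; positivity
  have hw1 : ∀ k, 1 ≤ searchWidth ρ ε k := fun k => by
    have : 0 ≤ ε * Real.sqrt k := by positivity
    rw [searchWidth]
    linarith
  let g : ∀ t : ℕ, (Fin t → Outcome n) → Outcome n → ℝ := fun t h x =>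
    if T₀ ≤ t then avgWeight t₀ (t - T₀) * bonus π T₀ (searchWidth ρ ε (t - T₀))
      (ancHat c₀ c₁ T h) h x else 0
  have hg0 : ∀ t h x, 0 ≤ g t h x := by
    intro t h x
    simp only [g]
    split_ifs
    · exact mul_nonneg (avgWeight_nonneg _ _) (bonus_nonneg π T₀ (by linarith [hw1 (t - T₀)]) _ _ _)
    · exact le_rfl
  have hK0 : 0 ≤ K := by
    refine le_trans (Finset.sum_nonneg fun k _ => ?_) hK
    have h1 : 0 ≤ Real.log (2 * m + 1) := Real.log_nonneg (by
      have : (0 : ℝ) ≤ m := Nat.cast_nonneg m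
      linarith)
    have h2 := (log_pos_of_two_le hT).le
    have h3 := avgWeight_nonneg t₀ k
    have h4 : 0 ≤ ρ := by linarith
    rw [driftTerm, gridLevel]
    positivity
  have hpath : ∀ ω : Fin T → Outcome n,
      ∑ t : Fin T, (bestReward M 𝒜 - expReward M.condProb (π t (past ω t))) ≤
      (T₀ + T * (if ¬ GoodRun M π c₀ c₁ T m r ω then 1 else 0) + T * K) +
        2 * T * ∑ t : Fin T, condExp M π (past ω t) (g t (past ω t)) := by
    intro ω
    have hS0 : 0 ≤ ∑ t : Fin T, condExp M π (past ω t) (g t (past ω t)) :=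
      Finset.sum_nonneg fun t _ => by
        rw [← condExp_const M π (past ω t) 0]
        exact condExp_mono M π _ fun x => hg0 _ _ x
    by_cases hω : GoodRun M π c₀ c₁ T m r ω
    · have h1 := hω.sum_regret_le hr hm h𝒜 hπ hc₁ hn hT hT₀ ht₀ ht₀T hρ (by linarith) hε hearly
      rw [← hT₀def] at h1
      have h2 : ∑ t : Fin T, condExp M π (past ω t) (g t (past ω t)) =
          ∑ t : Fin T, (if T₀ ≤ t.val then condExp M π (past ω t) (fun x =>
          avgWeight t₀ (t - T₀) * bonus π T₀ (searchWidth ρ ε (t - T₀))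
            (ancHat c₀ c₁ T (past ω t)) (past ω t) x) else 0) := by
        refine Finset.sum_congr rfl fun t _ => ?_
        by_cases ht : T₀ ≤ t.val
        · simp only [g, ht, if_true]
        · simp only [g, ht, if_false]
          exact condExp_const M π _ 0
      rw [← h2] at h1
      refine h1.trans ?_
      have h3 := mul_le_mul_of_nonneg_left hK (Nat.cast_nonneg (α := ℝ) T)
      have h4 : (if ¬ GoodRun M π c₀ c₁ T m r ω then (1 : ℝ) else 0) = 0 := by simp [hω]
      rw [h4]
      linarith
    · have h1 := sum_regret_le M h𝒜 π ω
      have h4 : (if ¬ GoodRun M π c₀ c₁ T m r ω then (1 : ℝ) else 0) = 1 := by simp [hω]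
      rw [h4]
      have h5 : (0 : ℝ) ≤ T * K := by positivity
      have h6 : (0 : ℝ) ≤ 2 * T * ∑ t : Fin T, condExp M π (past ω t) (g t (past ω t)) := by
        positivity
      have h7 : (0 : ℝ) ≤ T₀ := Nat.cast_nonneg _
      linarith
  have hbonus : ∀ ω : Fin T → Outcome n, ∑ t : Fin T, g t (past ω t) (ω t) ≤
      (n + 1) * (Real.sqrt Q * Real.sqrt (2 * (n * Real.log (1 + T * n)))) := by
    intro ω
    refine sum_bonus_le π hn (fun t => avgWeight t₀ (t - T₀)) (fun t => searchWidth ρ ε (t - T₀))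
      (fun t => avgWeight_nonneg _ _) (fun t => hw1 _) (le_trans (le_of_eq ?_) hQ) ω
    rw [← hT₀def]
    obtain ⟨L, hL⟩ : ∃ L, T = T₀ + L := ⟨T - T₀, by omega⟩
    have hL' : T - T₀ = L := by omega
    rw [hL', sum_range_eq_add hL, Finset.sum_eq_zero, zero_add]
    · exact Finset.sum_congr rfl fun i _ => by simp
    · intro s hs
      rw [Finset.mem_range] at hs
      rw [if_neg (by omega)]
  rw [regret_eq_trajExp]
  refine (trajExp_mono M π hpath).trans ?_
  rw [trajExp_add, trajExp_const_mul, trajExp_sum_condExp, trajExp_add, trajExp_add,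
    trajExp_const, trajExp_const_mul, trajExp_const]
  have h1 := trajExp_mono M π hbonus
  rw [trajExp_const] at h1
  have h2 := mul_le_mul_of_nonneg_left h1 (show (0 : ℝ) ≤ 2 * T by positivity)
  have h3 : (trajExp M π T fun ω => if ¬ GoodRun M π c₀ c₁ T m r ω then (1 : ℝ) else 0) =
      trajPr M π T (fun ω => ¬ GoodRun M π c₀ c₁ T m r ω) := by
    rw [trajPr]
    congr 1
    funext ω
    congr
  rw [h3]
  linarith

/-! ### Numerical bounds -/

lemma half_lt_log {T : ℕ} (hT : 2 ≤ T) : 0.69 ≤ Real.log T := by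
  have h1 : Real.log 2 ≤ Real.log T :=
    Real.log_le_log (by norm_num) (by exact_mod_cast hT)
  have := Real.log_two_gt_d9
  linarith

lemma log_one_add_mul_le {T t : ℕ} (hT : 2 ≤ T) (ht : t ≤ T) (hnT : n ≤ T) :
    Real.log (1 + t * n) ≤ 3 * Real.log T := by
  have h2 : (2 : ℝ) ≤ T := by exact_mod_cast hT
  rw [show (3 : ℝ) * Real.log T = Real.log ((T : ℝ) ^ 3) by rw [Real.log_pow]; norm_num]
  apply Real.log_le_log (by positivity)
  have h1 : (t : ℝ) * n ≤ T * T := by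
    exact_mod_cast Nat.mul_le_mul ht hnT
  nlinarith [mul_nonneg (sub_nonneg.2 h2) (sq_nonneg (T : ℝ))]

lemma radius_le {T t : ℕ} (hn : 1 ≤ n) (hT : 2 ≤ T) (ht : t ≤ T) (hnT : n ≤ T) :
    radius n T t ≤ 4 * Real.sqrt (n * Real.log T) := by
  have hl := half_lt_log hT
  have hn1 : (1 : ℝ) ≤ n := by exact_mod_cast hn
  have hT2 : (2 : ℝ) ≤ T := by exact_mod_cast hT
  have hnl : 0 ≤ n * Real.log T := by positivity
  have hsq := Real.sq_sqrt hnl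
  have hs0 := Real.sqrt_nonneg (n * Real.log T)
  have h1 : Real.log (1 / (1 / (n * Real.sqrt T))) ≤ 3 / 2 * Real.log T := by
    rw [one_div_one_div, Real.log_mul (by positivity) (by positivity),
      Real.log_sqrt (by positivity)]
    have : Real.log n ≤ Real.log T := Real.log_le_log (by positivity) (by exact_mod_cast hnT)
    linarith
  have h2 := log_one_add_mul_le (n := n) hT ht hnT
  have h3 : Real.sqrt (n * Real.log (1 + t * n) + 2 * Real.log (1 / (1 / (n * Real.sqrt T)))) ≤
      5 / 2 * Real.sqrt (n * Real.log T) := by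
    refine Real.sqrt_le_iff.2 ⟨by positivity, ?_⟩
    rw [mul_pow, hsq]
    have h4 := mul_le_mul_of_nonneg_left h2 (Nat.cast_nonneg (α := ℝ) n)
    have h5 : Real.log T ≤ n * Real.log T := le_mul_of_one_le_left (by linarith) hn1
    nlinarith
  have h6 : Real.sqrt n ≤ 3 / 2 * Real.sqrt (n * Real.log T) := by
    refine Real.sqrt_le_iff.2 ⟨by positivity, ?_⟩
    rw [mul_pow, hsq]
    nlinarith
  rw [radius]
  linarith

lemma gridLevel_le {T : ℕ} (hn : 1 ≤ n) (hT : 2 ≤ T) (hnT : n ≤ T) :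
    gridLevel n T ((n + 1) * T) ≤ 10 * (n * Real.log T) := by
  have hl := half_lt_log hT
  have hn1 : (1 : ℝ) ≤ n := by exact_mod_cast hn
  have hT2 : (2 : ℝ) ≤ T := by exact_mod_cast hT
  have hnT' : (n : ℝ) ≤ T := by exact_mod_cast hnT
  have h1 : Real.log (2 * ((n + 1) * T : ℕ) + 1) ≤ 4 * Real.log T := by
    rw [show (4 : ℝ) * Real.log T = Real.log ((T : ℝ) ^ 4) by rw [Real.log_pow]; norm_num]
    apply Real.log_le_log (by positivity)
    push_cast
    have h2 : (n + 1) * (T : ℝ) ≤ (T + 1) * T := by gcongr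
    have h3 : (4 : ℝ) ≤ (T : ℝ) ^ 2 := by nlinarith
    have h4 : (4 : ℝ) * (T : ℝ) ^ 2 ≤ (T : ℝ) ^ 2 * (T : ℝ) ^ 2 :=
      mul_le_mul_of_nonneg_right h3 (by positivity)
    nlinarith
  rw [gridLevel]
  have h5 : (n + 1) * Real.log (2 * ((n + 1) * T : ℕ) + 1) ≤ (2 * n) * (4 * Real.log T) :=
    mul_le_mul (by linarith) h1 (Real.log_nonneg (by
      have : (0 : ℝ) ≤ ((n + 1) * T : ℕ) := Nat.cast_nonneg _
      linarith)) (by positivity)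
  have h6 : Real.log T ≤ n * Real.log T := le_mul_of_one_le_left (by linarith) hn1
  linarith

/-- Cauchy–Schwarz with the split w^{3/2} = w^{1/2}·w, using the sums of w and of w². -/
lemma sum_avgWeight_mul_sqrt_le {t₀ L T : ℕ} (ht₀ : 1 ≤ t₀) (hL : L ≤ T) (hT : 2 ≤ T) :
    ∑ k ∈ Finset.range L, avgWeight t₀ k * Real.sqrt (2 * avgWeight t₀ k) ≤
      Real.sqrt (16 * Real.log T / t₀) := by
  have hl := half_lt_log hT
  apply Real.le_sqrt_of_sq_le
  have h1 := Finset.sum_mul_sq_le_sq_mul_sq (Finset.range L)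
    (fun k => Real.sqrt (avgWeight t₀ k)) (fun k => Real.sqrt 2 * avgWeight t₀ k)
  have e1 : ∀ k, Real.sqrt (avgWeight t₀ k) * (Real.sqrt 2 * avgWeight t₀ k) =
      avgWeight t₀ k * Real.sqrt (2 * avgWeight t₀ k) := by
    intro k
    rw [Real.sqrt_mul (by norm_num)]
    ring
  have e2 : ∀ k, Real.sqrt (avgWeight t₀ k) ^ 2 = avgWeight t₀ k :=
    fun k => Real.sq_sqrt (avgWeight_nonneg _ _)
  have e3 : ∀ k, (Real.sqrt 2 * avgWeight t₀ k) ^ 2 = 2 * avgWeight t₀ k ^ 2 := by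
    intro k
    rw [mul_pow, Real.sq_sqrt (by norm_num)]
  simp only [e1, e2, e3, ← Finset.mul_sum] at h1
  refine h1.trans ?_
  have h2 := sum_avgWeight_le t₀ hL hT
  have h3 := sum_sq_avgWeight_le ht₀ L
  calc (∑ k ∈ Finset.range L, avgWeight t₀ k) * (2 * ∑ k ∈ Finset.range L, avgWeight t₀ k ^ 2)
      ≤ (4 * Real.log T) * (2 * (2 / t₀)) :=
        mul_le_mul h2 (by linarith) (mul_nonneg (by norm_num)
          (Finset.sum_nonneg fun _ _ => sq_nonneg _)) (by positivity)
    _ = 16 * Real.log T / t₀ := by ring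

lemma sum_avgWeight_mul_driftTerm_le {t₀ L T : ℕ} (ht₀ : 1 ≤ t₀) (hL : L ≤ T) (hT : 2 ≤ T)
    {ρ ε lam : ℝ} (hρ : 0 ≤ ρ) (hε : 0 ≤ ε) (hlam : 0 ≤ lam) :
    ∑ k ∈ Finset.range L, avgWeight t₀ k * driftTerm n ρ ε lam t₀ k ≤
      12 * (n + 1) * ε * (4 * Real.log T) + 8 * (n + 1) * ρ * Real.sqrt (16 * Real.log T / t₀) +
        4 * (n + 1) * (2 * lam + 3) * (2 / t₀) := by
  have e1 : ∀ k, avgWeight t₀ k * driftTerm n ρ ε lam t₀ k =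
      12 * (n + 1) * ε * avgWeight t₀ k +
      8 * (n + 1) * ρ * (avgWeight t₀ k * Real.sqrt (2 * avgWeight t₀ k)) +
      4 * (n + 1) * (2 * lam + 3) * avgWeight t₀ k ^ 2 := by
    intro k
    rw [driftTerm]
    ring
  simp only [e1, Finset.sum_add_distrib, ← Finset.mul_sum]
  refine add_le_add (add_le_add ?_ ?_) ?_
  · exact mul_le_mul_of_nonneg_left (sum_avgWeight_le t₀ hL hT) (by positivity)
  · exact mul_le_mul_of_nonneg_left (sum_avgWeight_mul_sqrt_le ht₀ hL hT) (by positivity)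
  · exact mul_le_mul_of_nonneg_left (sum_sq_avgWeight_le ht₀ L) (by positivity)

lemma sum_sq_avgWeight_mul_searchWidth_le {t₀ L T : ℕ} (ht₀ : 1 ≤ t₀) (hL : L ≤ T) (hT : 2 ≤ T)
    (ρ ε : ℝ) :
    ∑ k ∈ Finset.range L, (avgWeight t₀ k * searchWidth ρ ε k) ^ 2 ≤
      8 * (ρ ^ 2 * (2 / t₀) + ε ^ 2 * (4 * Real.log T)) := by
  have h1 : ∀ k ∈ Finset.range L, (avgWeight t₀ k * searchWidth ρ ε k) ^ 2 ≤
      8 * (ρ ^ 2 * avgWeight t₀ k ^ 2 + ε ^ 2 * avgWeight t₀ k) := by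
    intro k _
    have hw := avgWeight_nonneg t₀ k
    have hwk := mul_le_mul_of_nonneg_left (avgWeight_mul_le t₀ k)
      (mul_nonneg (sq_nonneg ε) hw)
    have hk := Real.sq_sqrt (Nat.cast_nonneg (α := ℝ) k)
    have h2 : (ρ + ε * Real.sqrt k) ^ 2 ≤ 2 * (ρ ^ 2 + ε ^ 2 * k) := by
      nlinarith [sq_nonneg (ρ - ε * Real.sqrt k)]
    have h3 := mul_le_mul_of_nonneg_left h2 (sq_nonneg (avgWeight t₀ k))
    rw [searchWidth]
    nlinarith
  refine (Finset.sum_le_sum h1).trans ?_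
  rw [← Finset.mul_sum, Finset.sum_add_distrib, ← Finset.mul_sum, ← Finset.mul_sum]
  refine mul_le_mul_of_nonneg_left (add_le_add ?_ ?_) (by norm_num)
  · exact mul_le_mul_of_nonneg_left (sum_sq_avgWeight_le ht₀ L) (sq_nonneg ρ)
  · exact mul_le_mul_of_nonneg_left (sum_avgWeight_le t₀ hL hT) (sq_nonneg ε)

/-- By the choice of t₀, 1/t₀ ≤ 16ε²/n, which turns every term into a multiple of nεl. The multiples
96, 1024 and 6656 add up to 7776, and Tε = 4c₁ns² supplies the factor 4. -/
lemma mul_driftBound_le {l s c₁ ε lam : ℝ} {t₀ T : ℕ} (hn : 1 ≤ n) (hnl : 1 ≤ n * l) (hl : 0 ≤ l)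
    (hc₁ : 0 ≤ c₁) (hε0 : 0 ≤ ε) (hε1 : ε ≤ 1) (hTε : T * ε = 4 * c₁ * n * s ^ 2)
    (hu : n * (1 / (t₀ : ℝ)) ≤ 16 * ε ^ 2) (hlam0 : 0 ≤ lam) (hlam : lam ≤ 10 * (n * l)) :
    T * (12 * (n + 1) * ε * (4 * l) +
      8 * (n + 1) * (4 * Real.sqrt (n * l)) * Real.sqrt (16 * l / t₀) +
      4 * (n + 1) * (2 * lam + 3) * (2 / t₀)) ≤ 31104 * c₁ * (n ^ 3 * s ^ 2 * l) := by
  have hn1 : (1 : ℝ) ≤ n := by exact_mod_cast hn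
  have hn3 : (n : ℝ) ^ 2 ≤ n ^ 3 := pow_le_pow_right₀ hn1 (by norm_num)
  set R := Real.sqrt (n * l) with hR
  set u : ℝ := 1 / (t₀ : ℝ) with hudef
  have hu0 : 0 ≤ u := by positivity
  have hsqrt1 : R * Real.sqrt (16 * l / t₀) ≤ 16 * ε * l := by
    rw [hR, ← Real.sqrt_mul (by linarith)]
    refine Real.sqrt_le_iff.2 ⟨by positivity, ?_⟩
    have e1 : n * l * (16 * l / t₀) = 16 * l ^ 2 * (n * u) := by rw [hudef]; ring
    rw [e1]
    have := mul_le_mul_of_nonneg_left hu (show 0 ≤ 16 * l ^ 2 by positivity)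
    linarith
  have hd1 : 12 * (n + 1) * ε * (4 * l) ≤ 96 * n * ε * l := by
    have : 0 ≤ ε * l := by positivity
    nlinarith
  have hd2 : 8 * (n + 1) * (4 * R) * Real.sqrt (16 * l / t₀) ≤ 1024 * n * ε * l := by
    calc 8 * (n + 1) * (4 * R) * Real.sqrt (16 * l / t₀)
        = 32 * (n + 1) * (R * Real.sqrt (16 * l / t₀)) := by ring
      _ ≤ 32 * (2 * n) * (16 * ε * l) := by
          gcongr
          linarith
      _ = _ := by ring
  have hd3 : 4 * (n + 1) * (2 * lam + 3) * (2 / t₀) ≤ 6656 * n * ε * l := by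
    calc 4 * (n + 1) * (2 * lam + 3) * (2 / t₀) = 8 * (n + 1) * (2 * lam + 3) * u := by
          rw [hudef]; ring
      _ ≤ 8 * (2 * n) * (26 * (n * l)) * u := by
          gcongr
          · linarith
          · linarith
      _ = 416 * n * l * (n * u) := by ring
      _ ≤ 416 * n * l * (16 * ε ^ 2) := by gcongr
      _ ≤ 416 * n * l * (16 * ε) := by
          gcongr
          nlinarith
      _ = _ := by ring
  calc _ ≤ T * (7776 * n * ε * l) := by
          gcongr
          linarith
      _ = 7776 * n * l * (T * ε) := by ring
      _ = 31104 * c₁ * (n ^ 2 * s ^ 2 * l) := by rw [hTε]; ring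
      _ ≤ _ := by gcongr

/-- This term sets the cubic order in n: one factor from the number of nodes, √n (rounded up to n)
from the log-determinant, and one from ε. -/
lemma mul_bonusBound_le {s c₁ ε : ℝ} {t₀ T : ℕ} (hn : 1 ≤ n) (hT : 2 ≤ T) (hnT : n ≤ T)
    (hε0 : 0 ≤ ε) (hTε : T * ε = 4 * c₁ * n * s ^ 2)
    (hu : n * (1 / (t₀ : ℝ)) ≤ 16 * ε ^ 2) :
    T * (2 * ((n + 1) * (Real.sqrt (8 * ((4 * Real.sqrt (n * Real.log T)) ^ 2 * (2 / t₀) +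
      ε ^ 2 * (4 * Real.log T))) * Real.sqrt (2 * (n * Real.log (1 + T * n)))))) ≤
      2528 * c₁ * (n ^ 3 * s ^ 2 * Real.log T) := by
  have hlog := half_lt_log hT
  have hn1 : (1 : ℝ) ≤ n := by exact_mod_cast hn
  set l := Real.log T with hl
  set R := Real.sqrt (n * l) with hR
  have hRsq : R ^ 2 = n * l := Real.sq_sqrt (by positivity)
  set u : ℝ := 1 / (t₀ : ℝ) with hudef
  have hu0 : 0 ≤ u := by positivity
  have hsqrt2 : Real.sqrt (8 * ((4 * R) ^ 2 * (2 / t₀) + ε ^ 2 * (4 * l))) *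
      Real.sqrt (2 * (n * Real.log (1 + T * n))) ≤ 158 * ε * l * n := by
    have h1 := log_one_add_mul_le (n := n) hT le_rfl hnT
    rw [← hl] at h1
    rw [← Real.sqrt_mul (by positivity)]
    refine Real.sqrt_le_iff.2 ⟨by positivity, ?_⟩
    have e1 : 8 * ((4 * R) ^ 2 * (2 / t₀) + ε ^ 2 * (4 * l)) ≤ 4128 * ε ^ 2 * l := by
      have e2 : 8 * ((4 * R) ^ 2 * (2 / t₀) + ε ^ 2 * (4 * l)) =
          256 * l * (n * u) + 32 * ε ^ 2 * l := by
        rw [mul_pow, hRsq, hudef]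
        ring
      rw [e2]
      have := mul_le_mul_of_nonneg_left hu (show 0 ≤ 256 * l by positivity)
      linarith
    calc 8 * ((4 * R) ^ 2 * (2 / t₀) + ε ^ 2 * (4 * l)) * (2 * (n * Real.log (1 + T * n)))
        ≤ 4128 * ε ^ 2 * l * (2 * (n * (3 * l))) := by
          refine mul_le_mul e1 (by gcongr) ?_ (by positivity)
          have : 0 ≤ Real.log (1 + T * n) := Real.log_nonneg (by
            have : (0 : ℝ) ≤ T * n := by positivity
            linarith)
          positivity
      _ = 24768 * (ε ^ 2 * l ^ 2) * n := by ring
      _ ≤ 24964 * (ε ^ 2 * l ^ 2) * n ^ 2 := by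
          have : (n : ℝ) ≤ n ^ 2 := le_self_pow₀ (by linarith) (by norm_num)
          gcongr
          norm_num
      _ = (158 * ε * l * n) ^ 2 := by ring
  calc _ ≤ T * (2 * ((2 * n) * (158 * ε * l * n))) := by
          gcongr
          linarith
      _ = 632 * n ^ 2 * l * (T * ε) := by ring
      _ = _ := by rw [hTε]; ring

lemma mul_failure_le {s l p : ℝ} {T : ℕ} (hn : 1 ≤ n) (hT : 2 ≤ T) (hs : 1 ≤ s) (hl : 0.69 ≤ l)
    (hp : p ≤ 2 * (n + 1) ^ 2 / (T : ℝ) ^ 2 + 2 * (n + 1) / T) :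
    T * p ≤ 16 * (n ^ 3 * s ^ 2 * l) := by
  have hn1 : (1 : ℝ) ≤ n := by exact_mod_cast hn
  have hT2 : (2 : ℝ) ≤ T := by exact_mod_cast hT
  have h1 := mul_le_mul_of_nonneg_left hp (Nat.cast_nonneg (α := ℝ) T)
  have h2 : (T : ℝ) * (2 * (n + 1) ^ 2 / (T : ℝ) ^ 2 + 2 * (n + 1) / T) =
      2 * (n + 1) ^ 2 / T + 2 * (n + 1) := by
    field_simp
  have h3 : 2 * ((n : ℝ) + 1) ^ 2 / T ≤ 4 * n ^ 2 := by
    rw [div_le_iff₀ (by linarith)]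
    have h4 : ((n : ℝ) + 1) ^ 2 ≤ (2 * n) ^ 2 := by gcongr; linarith
    have h5 := mul_le_mul_of_nonneg_left hT2 (sq_nonneg (n : ℝ))
    linarith
  have h4 : (n : ℝ) ^ 2 * 0.69 ≤ n ^ 3 * s ^ 2 * l := by
    calc (n : ℝ) ^ 2 * 0.69 ≤ n ^ 3 * 0.69 := by gcongr; norm_num
      _ ≤ (n ^ 3 * s ^ 2) * 0.69 := by
          gcongr
          exact le_mul_of_one_le_right (by positivity) (one_le_pow₀ hs)
      _ ≤ _ := by gcongr
  have h5 : (n : ℝ) ≤ n ^ 2 := le_self_pow₀ hn1 (by norm_num)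
  linarith

lemma initLength_le {c₀ : ℝ} {T : ℕ} (hx : 1 ≤ c₀ * (T : ℝ) ^ (2 / 3 : ℝ) * Real.log T) :
    (initLength n c₀ T : ℝ) ≤ 4 * n * (c₀ * (T : ℝ) ^ (2 / 3 : ℝ) * Real.log T) := by
  have h1 : (initCount c₀ T : ℝ) ≤ 2 * (c₀ * (T : ℝ) ^ (2 / 3 : ℝ) * Real.log T) := by
    have := Nat.ceil_lt_add_one (zero_le_one.trans hx)
    rw [initCount]
    linarith
  have h2 : ((n - 1 : ℕ) : ℝ) ≤ n := by exact_mod_cast Nat.sub_le n 1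
  rw [initLength]
  push_cast
  calc 2 * ((n - 1 : ℕ) : ℝ) * initCount c₀ T
      ≤ 2 * n * (2 * (c₀ * (T : ℝ) ^ (2 / 3 : ℝ) * Real.log T)) := by gcongr
    _ = _ := by ring

/-! ### The regret bound -/

/-- With n = 1 there is nothing to intervene on. The case is separate because the slack √n - 1 then
vanishes. -/
lemma regret_of_single {M : BLM 1} {𝒜 : Finset (Action 1)} {π : Policy 1} {c₀ c₁ : ℝ} {T : ℕ}
    (h𝒜 : IsActionSet 𝒜) (hπ : IsBLMLRUnknown 𝒜 c₀ c₁ T π) : regret M 𝒜 π T = 0 := by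
  have h1 : ∀ a ∈ 𝒜, a = nullAction 1 := by
    intro a ha
    funext v
    fin_cases v
    · exact h𝒜.not_root a ha
    · exact h𝒜.not_target a ha
  obtain ⟨b, hb, hbest⟩ := exists_bestReward_eq M h𝒜
  rw [regret]
  refine Finset.sum_eq_zero fun ω _ => ?_
  rw [Finset.sum_eq_zero, mul_zero]
  intro t _
  have h2 := h1 _ (hπ.mem t t.isLt (by simp [initLength]) (past ω t))
  rw [h2]
  rw [h1 b hb] at hbest
  simp [hbest]

lemma regret_le_of_large {c₀ c₁ s l : ℝ} {T : ℕ} {M : BLM n} {π : Policy n}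
    {𝒜 : Finset (Action n)} (h𝒜 : IsActionSet 𝒜) (hπ : IsBLMLRUnknown 𝒜 c₀ c₁ T π)
    (hc₁ : 0 < c₁) (hc : 1 ≤ c₀ * c₁ ^ 2) (hn : 2 ≤ n) (hT : 2 ≤ T)
    (hs : s = (T : ℝ) ^ (1 / 3 : ℝ)) (hl : l = Real.log T)
    (hx : 1 ≤ c₀ * (T : ℝ) ^ (2 / 3 : ℝ) * Real.log T) (hT₀ : initLength n c₀ T ≤ T)
    (hns : (n : ℝ) ≤ s) (hεs : 4 * c₁ * n ≤ s) (hq : 1 ≤ 256 * c₁ ^ 2 * n * s) :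
    regret M 𝒜 π T ≤ (4 * c₀ + 16 + 33632 * c₁) * (n ^ 3 * s ^ 2 * l) := by
  obtain ⟨r, hr⟩ := M.exists_isCausalRank
  have hn2 : (2 : ℝ) ≤ n := by exact_mod_cast hn
  have hn1 : 1 ≤ n := by omega
  have hT2 : (2 : ℝ) ≤ T := by exact_mod_cast hT
  have hlog := half_lt_log hT
  rw [← hl] at hlog
  have hs1 : 1 ≤ s := by linarith
  have hs0 : 0 < s := by linarith
  have hsT : s ^ 3 = T := by rw [hs]; exact rpow_one_third_pow T
  have hs2 : (T : ℝ) ^ (2 / 3 : ℝ) = s ^ 2 := by rw [hs]; exact rpow_two_thirds T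
  have hsleT : s ≤ T := by
    rw [← hsT]
    exact le_self_pow₀ hs1 (by norm_num)
  have hnT : n ≤ T := by exact_mod_cast hns.trans hsleT
  set ε : ℝ := n * (4 * c₁ / s) with hε
  have hε0 : 0 < ε := by positivity
  have hεs' : ε * s = 4 * c₁ * n := by rw [hε]; field_simp
  have hε1 : ε ≤ 1 := by
    rw [hε, mul_div_assoc', div_le_one hs0]
    linarith
  have hTε : T * ε = 4 * c₁ * n * s ^ 2 := by
    rw [← hsT]
    linear_combination s ^ 2 * hεs'
  -- Up to this time the bias ε√k is at most √n/4. For n ≥ 2, √n ≥ 4/3, so a quarter of √n plus the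
  -- 1 for the regularizer still fits into √n.
  set q : ℝ := n / (16 * ε ^ 2) with hqdef
  have hq0 : 0 < q := by positivity
  set t₀ := ⌈q⌉₊ with ht₀def
  have ht₀ : 1 ≤ t₀ := Nat.one_le_ceil_iff.2 hq0
  have hqT : q ≤ T := by
    rw [hqdef, div_le_iff₀ (by positivity)]
    have e1 : (T : ℝ) * (16 * ε ^ 2) = n * (256 * c₁ ^ 2 * n * s) := by
      calc (T : ℝ) * (16 * ε ^ 2) = 16 * ε * (T * ε) := by ring
        _ = 64 * c₁ * n * s * (ε * s) := by rw [hTε]; ring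
        _ = _ := by rw [hεs']; ring
    rw [e1]
    exact le_mul_of_one_le_right (by linarith) hq
  have ht₀T : t₀ ≤ T := Nat.ceil_le.2 hqT
  have hu : n * (1 / (t₀ : ℝ)) ≤ 16 * ε ^ 2 := by
    have h1 : 1 / (t₀ : ℝ) ≤ 1 / q := one_div_le_one_div_of_le hq0 (Nat.le_ceil q)
    have h2 : n * (1 / q) = 16 * ε ^ 2 := by rw [hqdef]; field_simp
    rw [← h2]
    exact mul_le_mul_of_nonneg_left h1 (by linarith)
  have hearly : ∀ k < t₀, ε * Real.sqrt k + 1 ≤ Real.sqrt n := by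
    intro k hk
    have hkq : (k : ℝ) < q := Nat.lt_ceil.1 hk
    have h1 : ε * Real.sqrt k ≤ Real.sqrt n / 4 := by
      have h2 : Real.sqrt k ≤ Real.sqrt n / (4 * ε) := by
        refine Real.sqrt_le_iff.2 ⟨by positivity, ?_⟩
        rw [div_pow, Real.sq_sqrt (by linarith)]
        refine hkq.le.trans (le_of_eq ?_)
        rw [hqdef]
        ring
      calc ε * Real.sqrt k ≤ ε * (Real.sqrt n / (4 * ε)) := mul_le_mul_of_nonneg_left h2 hε0.le
        _ = Real.sqrt n / 4 := by field_simp
    have h3 : 4 / 3 ≤ Real.sqrt n := Real.le_sqrt_of_sq_le (by norm_num; linarith)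
    linarith
  set R : ℝ := Real.sqrt (n * l) with hR
  have hnl : 1 ≤ n * l := by nlinarith
  have hR1 : 1 ≤ R := Real.one_le_sqrt.2 hnl
  have hRsq : R ^ 2 = n * l := Real.sq_sqrt (by linarith)
  have hρ : ∀ t < T, radius n T t ≤ 4 * R := fun t ht => by
    rw [hR, hl]
    exact radius_le hn1 hT ht.le hnT
  have hlamle := gridLevel_le hn1 hT hnT
  rw [← hl] at hlamle
  have hlam0 : 0 ≤ gridLevel n T ((n + 1) * T) := by
    rw [gridLevel, ← hl]
    have h1 : 0 ≤ Real.log (2 * ((n + 1) * T : ℕ) + 1) := Real.log_nonneg (by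
      have : (0 : ℝ) ≤ ((n + 1) * T : ℕ) := Nat.cast_nonneg _
      linarith)
    positivity
  set lam := gridLevel n T ((n + 1) * T) with hlam
  have hK := sum_avgWeight_mul_driftTerm_le (n := n) (ρ := 4 * R) ht₀
    (Nat.sub_le T (initLength n c₀ T)) hT (by linarith) hε0.le hlam0
  have hQ := sum_sq_avgWeight_mul_searchWidth_le ht₀
    (Nat.sub_le T (initLength n c₀ T)) hT (4 * R) ε
  have hmain := regret_le_of_goodRun hr rfl h𝒜 hπ hc₁ hn1 hT hT₀ ht₀ ht₀T hρ (by linarith)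
    (by rw [hε, hs]) hearly hK hQ
  rw [← hl] at hmain
  have hbad := trajPr_not_goodRun_le (r := r) hr hc₁ hc hT hx hπ.init hT₀ ((n + 1) * T)
  have hinit := initLength_le (n := n) hx
  rw [hs2, ← hl] at hinit
  set P : ℝ := n ^ 3 * s ^ 2 * l with hP
  have hn31 : (n : ℝ) ≤ n ^ 3 := le_self_pow₀ (by linarith) (by norm_num)
  have hc₀ : 0 < c₀ := by
    by_contra h
    linarith [mul_nonpos_of_nonpos_of_nonneg (not_lt.1 h) (sq_nonneg c₁)]
  have hinit' : (initLength n c₀ T : ℝ) ≤ 4 * c₀ * P := by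
    refine hinit.trans ?_
    rw [hP]
    calc 4 * (n : ℝ) * (c₀ * s ^ 2 * l) ≤ 4 * (n : ℝ) ^ 3 * (c₀ * s ^ 2 * l) := by gcongr
      _ = _ := by ring
  have hbad' := mul_failure_le hn1 hT hs1 hlog hbad
  have hdrift := mul_driftBound_le hn1 hnl (by linarith) hc₁.le hε0.le hε1 hTε hu hlam0 hlamle
  have hbon := mul_bonusBound_le hn1 hT hnT hε0.le hTε hu
  rw [← hl, ← hR] at hbon
  refine hmain.trans ?_
  rw [mul_add (T : ℝ)]
  linarith

end CCB

end

/-! ### The theorem, by cases on the size of the horizon -/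

theorem theorem3 (c₀ c₁ : ℝ) (hc₀ : 0 < c₀) (hc₁ : 0 < c₁) (hc₁' : c₁ ≠ 1)
    (hc : max (1 / c₁ ^ 2) (1 / (1 - c₁) ^ 2) ≤ c₀) :
    ∃ C : ℝ, 0 < C ∧ ∀ n : ℕ, 1 ≤ n → ∀ T : ℕ, 2 ≤ T →
      ∀ (M : CCB.BLM n) (𝒜 : Finset (CCB.Action n)) (π : CCB.Policy n),
        CCB.IsActionSet 𝒜 → CCB.IsBLMLRUnknown 𝒜 c₀ c₁ T π →
          CCB.regret M 𝒜 π T ≤ C * ((n : ℝ) ^ 3 * (T : ℝ) ^ (2 / 3 : ℝ) * Real.log T) := by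
  -- Once s is at least C₁n³, the summands give in turn n ≤ s, t₀ ≤ T, a number of repetitions that
  -- is at least 1 before rounding, and ε ≤ 1.
  set C₁ : ℝ := 1 + 1 / c₁ ^ 2 + 2 / c₀ + 4 * c₁ with hC₁
  have hC₁0 : 0 < C₁ := by positivity
  refine ⟨2 * C₁ + 4 * c₀ + 16 + 33632 * c₁, by positivity, fun n hn T hT M 𝒜 π h𝒜 hπ => ?_⟩
  set s : ℝ := (T : ℝ) ^ (1 / 3 : ℝ) with hs
  set l : ℝ := Real.log T with hl
  have hlog : 0.69 ≤ l := CCB.half_lt_log hT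
  have hs1 : 1 ≤ s := Real.one_le_rpow (by exact_mod_cast (by omega : 1 ≤ T)) (by norm_num)
  have hsT : s ^ 3 = T := CCB.rpow_one_third_pow T
  have hs2 : (T : ℝ) ^ (2 / 3 : ℝ) = s ^ 2 := CCB.rpow_two_thirds T
  have hn1 : (1 : ℝ) ≤ n := by exact_mod_cast hn
  have hn3 : (1 : ℝ) ≤ n ^ 3 := one_le_pow₀ hn1
  have hnn3 : (n : ℝ) ≤ n ^ 3 := le_self_pow₀ hn1 (by norm_num)
  rw [hs2]
  set P : ℝ := n ^ 3 * s ^ 2 * l with hP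
  have hP0 : 0 ≤ P := by positivity
  rcases hn.eq_or_lt with rfl | hn2
  · rw [CCB.regret_of_single h𝒜 hπ]
    positivity
  have hhor := CCB.regret_le_horizon M h𝒜 π T
  -- For small s, the trivial bound T = s·s² is already below C₁n³s².
  rcases lt_or_ge s (C₁ * n ^ 3) with hsmall | hlarge
  · have h1 : (T : ℝ) ≤ 2 * C₁ * P := by
      calc (T : ℝ) = s * s ^ 2 := by rw [← hsT]; ring
        _ ≤ C₁ * n ^ 3 * s ^ 2 := by gcongr
        _ ≤ C₁ * n ^ 3 * s ^ 2 * (2 * l) := le_mul_of_one_le_right (by positivity) (by linarith)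
        _ = _ := by rw [hP]; ring
    have h2 : 0 ≤ (4 * c₀ + 16 + 33632 * c₁) * P := by positivity
    linarith
  have hC₁s : C₁ ≤ s := (le_mul_of_one_le_right hC₁0.le hn3).trans hlarge
  have hinv1 : 0 < 1 / c₁ ^ 2 := by positivity
  have hinv0 : 0 < 2 / c₀ := by positivity
  have hC₁n : C₁ * n ≤ s := (mul_le_mul_of_nonneg_left hnn3 hC₁0.le).trans hlarge
  have hss : s ≤ s ^ 2 := le_self_pow₀ hs1 (by norm_num)
  have hx : 1 ≤ c₀ * (T : ℝ) ^ (2 / 3 : ℝ) * Real.log T := by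
    rw [hs2, ← hl]
    calc (1 : ℝ) = c₀ * (2 / c₀) * (1 / 2) := by field_simp
      _ ≤ c₀ * s ^ 2 * l := by
          gcongr
          · linarith
          · linarith
  -- If the run ends within the initial phase, the trivial bound T is below the length of that
  -- phase.
  rcases lt_or_ge T (CCB.initLength n c₀ T) with hshort | hlong
  · have h1 := CCB.initLength_le (n := n) hx
    rw [hs2, ← hl] at h1
    have h2 : (T : ℝ) ≤ CCB.initLength n c₀ T := by exact_mod_cast hshort.le
    have h3 : 4 * n * (c₀ * s ^ 2 * l) ≤ 4 * c₀ * P := by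
      calc 4 * n * (c₀ * s ^ 2 * l) ≤ 4 * (n : ℝ) ^ 3 * (c₀ * s ^ 2 * l) := by gcongr
        _ = _ := by rw [hP]; ring
    have h4 : 0 ≤ (2 * C₁ + 16 + 33632 * c₁) * P := by positivity
    linarith
  have hcc : 1 ≤ c₀ * c₁ ^ 2 := by
    have := (le_max_left _ _).trans hc
    rwa [div_le_iff₀ (by positivity)] at this
  have hmain := CCB.regret_le_of_large (M := M) h𝒜 hπ hc₁ hcc hn2 hT hs hl hx hlong
    (by nlinarith) (by nlinarith) (by
      have h1 : 1 ≤ c₁ ^ 2 * s := by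
        calc (1 : ℝ) = c₁ ^ 2 * (1 / c₁ ^ 2) := by field_simp
          _ ≤ c₁ ^ 2 * s := by
            gcongr
            linarith
      nlinarith)
  have h5 : 0 ≤ 2 * C₁ * P := by positivity
  linarith
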